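/- Let $n\in\mathbf N$, and let $A,B$ be complex $n\times n$ matrices with $-B^\dagger A+A^\dagger B=0$ and $A^\dagger A+B^\dagger B>0$. Write $L^2=L^2((0,\infty);\mathbf C^n)$ and let $H_{0,A,B}$ be the operator $H_{0,A,B}\psi=-\psi''$ in $L^2$ with domain $$D(H_{0,A,B})=\{\psi\in \mathbf H_2:\ -B^\dagger\psi(0)+A^\dagger\psi'(0)=0\},$$ where $\mathbf H_2$ is the second Sobolev space of $\mathbf C^n$-valued functions on $(0,\infty)$. Let $H_0:=H_{0,-I,0}$ be the operator with the Neumann boundary condition $\psi'(0)=0$. For real $k\neq0$ and $x>0$ put $$\varphi_{0,A,B}(k,x)=\cos(kx)\,A+\tfrac{\sin(kx)}{k}\,B,\qquad J_{0,A,B}(k)=B-ikA,\qquad \psi_{0,A,B}(k,x)=-ik\,\varphi_{0,A,B}(k,x)\,J_{0,A,B}(k)^{-1},$$ and $\psi^{\pm}_{0,A,B}(k,x)=\psi_{0,A,B}(\mp k,x)$. The generalized Fourier maps $F^\pm_{0,A,B}$ are the bounded operators on $L^2$ with $$(F^\pm_{0,A,B}\psi)(k)=\sqrt{\tfrac2\pi}\int_0^\infty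 \psi^\pm_{0,A,B}(k,x)^\dagger\,\psi(x)\,dx,\qquad \psi\in L^1\cap L^2,$$ and $F_0:=F^+_{0,-I,0}=F^-_{0,-I,0}$ (the cosine transform). Then the operators $H_{0,A,B}$ and $H_0$ have spectral resolutions $H=\int\lambda\,dE(\lambda)$ with projection-valued measures $E$, the operators $F^\pm_{0,A,B}$ and $F_0$ are well defined, and the wave operators $$W_\pm(H_{0,A,B},H_0)=\mathop{\mathrm{s\text{-}lim}}_{t\to\pm\infty} e^{itH_{0,A,B}}\,e^{-itH_0}\,P_{\mathrm{ac}}(H_0)$$ exist, where $P_{\mathrm{ac}}(H_0)$ is the orthogonal projector onto the subspace of absolute continuity of $H_0$. They are complete, that is, their range is the subspace of absolute continuity $\mathcal H_{\mathrm{ac}}(H_{0,A,B})$; they are isometric from $L^2$ onto $\mathcal H_{\mathrm{ac}}(H_{0,A,B})$; and $$W_\pm(H_{0,A,B},H_0)=\bigl(F^\pm_{0,A,B}\bigr)^\dagger F_0 .$$ -/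

import Mathlib

open MeasureTheory Filter Topology Set
open scoped ContDiff InnerProductSpace ComplexOrder

/-! ### Projection-valued measures and the spectral calculus -/

/-- A projection-valued Borel measure (spectral measure) on `ℝ` in a Hilbert space `𝓗`: orthogonal
projections, multiplicative on intersections, normalized, countably additive in the strong sense.
The values on non-measurable sets are irrelevant. -/
structure ProjectionValuedMeasure (𝓗 : Type*) [NormedAddCommGroup 𝓗] [InnerProductSpace ℂ 𝓗]
    [CompleteSpace 𝓗] where
  proj : Set ℝ → 𝓗 →L[ℂ] 𝓗
  isStarProjection : ∀ S, MeasurableSet S → IsStarProjection (proj S)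
  proj_univ : proj univ = 1
  proj_inter : ∀ S T, MeasurableSet S → MeasurableSet T → proj (S ∩ T) = proj S * proj T
  hasSum_proj : ∀ S : ℕ → Set ℝ, (∀ i, MeasurableSet (S i)) → Pairwise (Function.onFun Disjoint S) →
    ∀ ψ, HasSum (fun i => proj (S i) ψ) (proj (⋃ i, S i) ψ)

namespace ProjectionValuedMeasure

variable {𝓗 : Type*} [NormedAddCommGroup 𝓗] [InnerProductSpace ℂ 𝓗] [CompleteSpace 𝓗]

theorem proj_empty (E : ProjectionValuedMeasure 𝓗) : E.proj ∅ = 0 := by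
  ext ψ
  have h := E.hasSum_proj (fun _ => ∅) (fun _ => MeasurableSet.empty)
    (fun _ _ _ => disjoint_bot_left) ψ
  have h0 := h.summable.tendsto_atTop_zero
  simpa using tendsto_nhds_unique tendsto_const_nhds h0

theorem norm_sq_proj (E : ProjectionValuedMeasure 𝓗) (ψ : 𝓗) {S : Set ℝ} (hS : MeasurableSet S) :
    ‖E.proj S ψ‖ ^ 2 = (⟪ψ, E.proj S ψ⟫_ℂ).re := by
  have hp := E.isStarProjection S hS
  have h1 : ⟪E.proj S ψ, E.proj S ψ⟫_ℂ = ⟪ψ, E.proj S ψ⟫_ℂ := by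
    have h2 : E.proj S (E.proj S ψ) = E.proj S ψ :=
      congrArg (fun T : 𝓗 →L[ℂ] 𝓗 => T ψ) hp.isIdempotentElem
    have h3 := ContinuousLinearMap.adjoint_inner_right (E.proj S) ψ (E.proj S ψ)
    rw [hp.isSelfAdjoint.adjoint_eq, h2] at h3
    exact h3.symm
  rw [← h1, inner_self_eq_norm_sq_to_K]
  norm_cast

/-- The scalar spectral measure `S ↦ ‖E(S)ψ‖² = (E(S)ψ, ψ)` of the vector `ψ`. -/
noncomputable def scalarMeasure (E : ProjectionValuedMeasure 𝓗) (ψ : 𝓗) : Measure ℝ :=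
  Measure.ofMeasurable (fun S _ => ENNReal.ofReal (‖E.proj S ψ‖ ^ 2))
    (by simp [E.proj_empty])
    (by
      intro f hf hd
      have h1 := E.hasSum_proj f hf hd ψ
      have h2 : HasSum (fun i => ‖E.proj (f i) ψ‖ ^ 2) (‖E.proj (⋃ i, f i) ψ‖ ^ 2) := by
        rw [E.norm_sq_proj ψ (MeasurableSet.iUnion hf)]
        simp_rw [fun i => E.norm_sq_proj ψ (hf i)]
        exact Complex.reCLM.hasSum ((innerSL ℂ ψ).hasSum h1)
      rw [← h2.tsum_eq, ENNReal.ofReal_tsum_of_nonneg (fun i => by positivity) h2.summable])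

theorem scalarMeasure_apply (E : ProjectionValuedMeasure 𝓗) (ψ : 𝓗) {S : Set ℝ}
    (hS : MeasurableSet S) : E.scalarMeasure ψ S = ENNReal.ofReal (‖E.proj S ψ‖ ^ 2) :=
  Measure.ofMeasurable_apply S hS

theorem scalarMeasure_eq_zero_iff (E : ProjectionValuedMeasure 𝓗) (ψ : 𝓗) {S : Set ℝ}
    (hS : MeasurableSet S) : E.scalarMeasure ψ S = 0 ↔ E.proj S ψ = 0 := by
  rw [E.scalarMeasure_apply ψ hS, ENNReal.ofReal_eq_zero]
  constructor
  · intro h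
    have : ‖E.proj S ψ‖ ^ 2 = 0 := le_antisymm h (by positivity)
    simpa using this
  · intro h
    simp [h]

/-- `E` is the spectral measure of the operator `H`, that is, `H = ∫ lam dE(lam)`:
the domain of `H` is `{ψ | ∫ lam² d(E(lam)ψ, ψ) < ∞}` and `(Hψ, ψ) = ∫ lam d(E(lam)ψ, ψ)` on it
(by polarization the quadratic form determines `H`). By the spectral theorem such an `E` exists if
and only if `H` is self-adjoint, and it is unique on Borel sets. -/
def IsSpectralMeasureOf (E : ProjectionValuedMeasure 𝓗) (H : 𝓗 →ₗ.[ℂ] 𝓗) : Prop :=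
  (∀ ψ : 𝓗, ψ ∈ H.domain ↔ ∫⁻ lam, ENNReal.ofReal (lam ^ 2) ∂(E.scalarMeasure ψ) < ⊤) ∧
  ∀ ψ : H.domain, ⟪(ψ : 𝓗), H ψ⟫_ℂ = ((∫ lam, lam ∂(E.scalarMeasure (ψ : 𝓗)) : ℝ) : ℂ)

open Classical in
/-- The operator `∫ f dE` for a bounded Borel function `f`: the bounded operator `T` (which exists and
is unique; the value `0` is never used for such `f`) with
`(Tψ, ψ) = ∫ f d(Eψ, ψ)` for all `ψ`. -/
noncomputable def integral (E : ProjectionValuedMeasure 𝓗) (f : ℝ → ℂ) : 𝓗 →L[ℂ] 𝓗 :=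
  if h : ∃ T : 𝓗 →L[ℂ] 𝓗, ∀ ψ, ⟪ψ, T ψ⟫_ℂ = ∫ lam, f lam ∂(E.scalarMeasure ψ) then h.choose else 0

/-- The defining property determines `∫ f dE`. -/
theorem integral_eq (E : ProjectionValuedMeasure 𝓗) {f : ℝ → ℂ} {T : 𝓗 →L[ℂ] 𝓗}
    (hT : ∀ ψ, ⟪ψ, T ψ⟫_ℂ = ∫ lam, f lam ∂(E.scalarMeasure ψ)) : E.integral f = T := by
  have h : ∃ T : 𝓗 →L[ℂ] 𝓗, ∀ ψ, ⟪ψ, T ψ⟫_ℂ = ∫ lam, f lam ∂(E.scalarMeasure ψ) := ⟨T, hT⟩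
  have hc : ∀ ψ, ⟪ψ, E.integral f ψ⟫_ℂ = ∫ lam, f lam ∂(E.scalarMeasure ψ) := by
    rw [integral, dif_pos h]
    exact h.choose_spec
  have key := (ext_inner_map (E.integral f : 𝓗 →ₗ[ℂ] 𝓗) (T : 𝓗 →ₗ[ℂ] 𝓗)).1 (fun ψ => by
    have h1 := (hc ψ).trans (hT ψ).symm
    have h2 := congrArg (starRingEnd ℂ) h1
    rwa [inner_conj_symm, inner_conj_symm] at h2)
  ext ψ
  exact congrArg (fun L : 𝓗 →ₗ[ℂ] 𝓗 => L ψ) key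

/-- `e^{i t H} = ∫ e^{i t lam} dE(lam)` for the operator `H` with spectral measure `E`. -/
noncomputable def expI (E : ProjectionValuedMeasure 𝓗) (t : ℝ) : 𝓗 →L[ℂ] 𝓗 :=
  E.integral fun lam => Complex.exp (Complex.I * t * lam)

/-- The subspace of absolute continuity: the vectors `ψ` whose spectral measure `(E(·)ψ, ψ)` is
absolutely continuous with respect to Lebesgue measure. -/
noncomputable def acSubspace (E : ProjectionValuedMeasure 𝓗) : Submodule ℂ 𝓗 where
  carrier := {ψ | E.scalarMeasure ψ ≪ volume}
  zero_mem' := by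
    refine Measure.AbsolutelyContinuous.mk fun S hS _ => ?_
    rw [E.scalarMeasure_eq_zero_iff 0 hS, map_zero]
  add_mem' := by
    intro ψ φ hψ hφ
    refine Measure.AbsolutelyContinuous.mk fun S hS h0 => ?_
    rw [E.scalarMeasure_eq_zero_iff _ hS, map_add, (E.scalarMeasure_eq_zero_iff ψ hS).1 (hψ h0),
      (E.scalarMeasure_eq_zero_iff φ hS).1 (hφ h0), add_zero]
  smul_mem' := by
    intro c ψ hψ
    refine Measure.AbsolutelyContinuous.mk fun S hS h0 => ?_
    rw [E.scalarMeasure_eq_zero_iff _ hS, map_smul, (E.scalarMeasure_eq_zero_iff ψ hS).1 (hψ h0),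
      smul_zero]

theorem isClosed_acSubspace (E : ProjectionValuedMeasure 𝓗) :
    IsClosed (E.acSubspace : Set 𝓗) := by
  have h : (E.acSubspace : Set 𝓗) =
      ⋂ (S : Set ℝ) (_ : MeasurableSet S) (_ : volume S = 0), {ψ | E.proj S ψ = 0} := by
    ext ψ
    simp only [mem_iInter, mem_ofPred_eq, SetLike.mem_coe]
    constructor
    · intro hψ S hS h0
      exact (E.scalarMeasure_eq_zero_iff ψ hS).1 (hψ h0)
    · intro hψ
      exact Measure.AbsolutelyContinuous.mk fun S hS h0 =>
        (E.scalarMeasure_eq_zero_iff ψ hS).2 (hψ S hS h0)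
  rw [h]
  exact isClosed_iInter fun S => isClosed_iInter fun _ => isClosed_iInter fun _ =>
    isClosed_eq (E.proj S).continuous continuous_const

instance (E : ProjectionValuedMeasure 𝓗) : E.acSubspace.HasOrthogonalProjection :=
  haveI : CompleteSpace E.acSubspace := E.isClosed_acSubspace.completeSpace_coe
  inferInstance

end ProjectionValuedMeasure

/-! ### Wave operators -/

/-- The two time directions `t → +∞` and `t → -∞`. -/
inductive TimeDirection
  | plus
  | minus

/-- The filter `t → +∞`, respectively `t → -∞`. -/
def TimeDirection.filter : TimeDirection → Filter ℝ
  | .plus => atTop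
  | .minus => atBot

/-- The sign `±1`. -/
def TimeDirection.sign : TimeDirection → ℝ
  | .plus => 1
  | .minus => -1

/-- `W = W_±(H₁, H₀) = s-lim_{t → ±∞} e^{i t H₁} e^{-i t H₀} P_ac(H₀)` (the strong limit exists and
is `W`), for the self-adjoint operators `H₁`, `H₀` with spectral measures `E₁`, `E₀`. -/
def IsWaveOperator {𝓗 : Type*} [NormedAddCommGroup 𝓗] [InnerProductSpace ℂ 𝓗] [CompleteSpace 𝓗]
    (E₁ E₀ : ProjectionValuedMeasure 𝓗) (d : TimeDirection) (W : 𝓗 →L[ℂ] 𝓗) : Prop :=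
  ∀ ψ, Tendsto (fun t : ℝ => E₁.expI t (E₀.expI (-t) (E₀.acSubspace.starProjection ψ)))
    d.filter (𝓝 (W ψ))

/-! ### The matrix Laplacian on the half line -/

/-- Lebesgue measure on `(0, ∞)`. -/
noncomputable abbrev halfLine : Measure ℝ := volume.restrict (Ioi 0)

/-- `L² = L²((0, ∞); ℂⁿ)`. -/
abbrev HalfLineL2 (n : ℕ) : Type := Lp (EuclideanSpace ℂ (Fin n)) 2 halfLine

/-- `φ` is the distributional derivative of `ψ` on `(0, ∞)`. -/
def IsWeakDeriv {n : ℕ} (ψ φ : HalfLineL2 n) : Prop :=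
  ∀ η : ℝ → ℝ, ContDiff ℝ ∞ η → HasCompactSupport η → tsupport η ⊆ Ioi 0 →
    ∫ x, deriv η x • ψ x ∂halfLine = -∫ x, η x • φ x ∂halfLine

/-- `a = ψ(0)`: the value at `0` of the representative of `ψ` that is continuous on `[0, ∞)`. -/
def HasBoundaryValue {n : ℕ} (ψ : HalfLineL2 n) (a : EuclideanSpace ℂ (Fin n)) : Prop :=
  ∃ u : ℝ → EuclideanSpace ℂ (Fin n), ContinuousOn u (Ici 0) ∧ u =ᵐ[halfLine] ψ ∧ u 0 = a

theorem integrable_smul_of_testFunction {n : ℕ} (ψ : HalfLineL2 n) {η : ℝ → ℝ}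
    (hη : Continuous η) (hc : HasCompactSupport η) :
    Integrable (fun x => η x • ψ x) halfLine := by
  have h1 : MemLp η 2 halfLine := hη.memLp_of_hasCompactSupport hc
  exact memLp_one_iff_integrable.1 ((Lp.memLp ψ).smul h1)

theorem IsWeakDeriv.add {n : ℕ} {ψ₁ ψ₂ φ₁ φ₂ : HalfLineL2 n} (h₁ : IsWeakDeriv ψ₁ φ₁)
    (h₂ : IsWeakDeriv ψ₂ φ₂) : IsWeakDeriv (ψ₁ + ψ₂) (φ₁ + φ₂) := by
  intro η hη hc hs
  have hd : Continuous (deriv η) := hη.continuous_deriv (by simp)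
  have e1 : ∫ x, deriv η x • (ψ₁ + ψ₂ : HalfLineL2 n) x ∂halfLine =
      ∫ x, (deriv η x • ψ₁ x + deriv η x • ψ₂ x) ∂halfLine := by
    refine integral_congr_ae ?_
    filter_upwards [Lp.coeFn_add ψ₁ ψ₂] with x hx
    rw [hx, Pi.add_apply, smul_add]
  have e2 : ∫ x, η x • (φ₁ + φ₂ : HalfLineL2 n) x ∂halfLine =
      ∫ x, (η x • φ₁ x + η x • φ₂ x) ∂halfLine := by
    refine integral_congr_ae ?_
    filter_upwards [Lp.coeFn_add φ₁ φ₂] with x hx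
    rw [hx, Pi.add_apply, smul_add]
  rw [e1, e2, integral_add (integrable_smul_of_testFunction ψ₁ hd hc.deriv)
    (integrable_smul_of_testFunction ψ₂ hd hc.deriv),
    integral_add (integrable_smul_of_testFunction φ₁ hη.continuous hc)
    (integrable_smul_of_testFunction φ₂ hη.continuous hc), h₁ η hη hc hs, h₂ η hη hc hs]
  abel

theorem IsWeakDeriv.const_smul {n : ℕ} {ψ φ : HalfLineL2 n} (c : ℂ) (h : IsWeakDeriv ψ φ) :
    IsWeakDeriv (c • ψ) (c • φ) := by
  intro η hη hc hs
  have e1 : ∫ x, deriv η x • (c • ψ : HalfLineL2 n) x ∂halfLine =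
      ∫ x, c • (deriv η x • ψ x) ∂halfLine := by
    refine integral_congr_ae ?_
    filter_upwards [Lp.coeFn_smul c ψ] with x hx
    rw [hx, Pi.smul_apply, smul_comm]
  have e2 : ∫ x, η x • (c • φ : HalfLineL2 n) x ∂halfLine =
      ∫ x, c • (η x • φ x) ∂halfLine := by
    refine integral_congr_ae ?_
    filter_upwards [Lp.coeFn_smul c φ] with x hx
    rw [hx, Pi.smul_apply, smul_comm]
  rw [e1, e2, integral_smul, integral_smul, h η hη hc hs, smul_neg]

theorem IsWeakDeriv.zero {n : ℕ} : IsWeakDeriv (0 : HalfLineL2 n) 0 := by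
  intro η _ _ _
  have e : ∀ g : ℝ → ℝ, ∫ x, g x • (0 : HalfLineL2 n) x ∂halfLine = 0 := by
    intro g
    refine integral_eq_zero_of_ae ?_
    filter_upwards [Lp.coeFn_zero (EuclideanSpace ℂ (Fin n)) 2 halfLine] with x hx
    rw [hx]
    simp
  rw [e, e, neg_zero]

theorem IsWeakDeriv.eq_zero {n : ℕ} {φ : HalfLineL2 n} (h : IsWeakDeriv 0 φ) : φ = 0 := by
  have hloc : LocallyIntegrableOn (φ : ℝ → EuclideanSpace ℂ (Fin n)) (Ioi 0) halfLine :=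
    ((Lp.memLp φ).locallyIntegrable (by norm_num)).locallyIntegrableOn _
  have key : ∀ᵐ x ∂halfLine, x ∈ Ioi (0 : ℝ) → φ x = 0 := by
    refine isOpen_Ioi.ae_eq_zero_of_integral_contDiff_smul_eq_zero hloc ?_
    intro η hη hc hs
    have h1 := h η hη hc hs
    have h2 : ∫ x, deriv η x • (0 : HalfLineL2 n) x ∂halfLine = 0 := by
      refine integral_eq_zero_of_ae ?_
      filter_upwards [Lp.coeFn_zero (EuclideanSpace ℂ (Fin n)) 2 halfLine] with x hx
      rw [hx]
      simp
    rw [h2] at h1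
    exact neg_eq_zero.1 h1.symm
  rw [Lp.eq_zero_iff_ae_eq_zero]
  filter_upwards [key, ae_restrict_mem measurableSet_Ioi] with x hx hx0 using hx hx0

theorem HasBoundaryValue.add {n : ℕ} {ψ φ : HalfLineL2 n} {a b : EuclideanSpace ℂ (Fin n)}
    (hψ : HasBoundaryValue ψ a) (hφ : HasBoundaryValue φ b) :
    HasBoundaryValue (ψ + φ) (a + b) := by
  obtain ⟨u, hu, huψ, rfl⟩ := hψ
  obtain ⟨v, hv, hvφ, rfl⟩ := hφ
  exact ⟨u + v, hu.add hv, (huψ.add hvφ).trans (Lp.coeFn_add ψ φ).symm, rfl⟩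

theorem HasBoundaryValue.const_smul {n : ℕ} {ψ : HalfLineL2 n} {a : EuclideanSpace ℂ (Fin n)}
    (c : ℂ) (hψ : HasBoundaryValue ψ a) : HasBoundaryValue (c • ψ) (c • a) := by
  obtain ⟨u, hu, huψ, rfl⟩ := hψ
  exact ⟨c • u, hu.const_smul c, (huψ.const_smul c).trans (Lp.coeFn_smul c ψ).symm, rfl⟩

theorem HasBoundaryValue.zero {n : ℕ} :
    HasBoundaryValue (0 : HalfLineL2 n) (0 : EuclideanSpace ℂ (Fin n)) :=
  ⟨0, continuousOn_const, (Lp.coeFn_zero _ _ _).symm, rfl⟩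

/-- The graph of `H_{0,A,B}`: the pairs `(ψ, -ψ'')` where `ψ` has distributional derivatives
`ψ', ψ''` in `L²` (that is, `ψ` is in the second Sobolev space) and satisfies the boundary condition
`-B† ψ(0) + A† ψ'(0) = 0`. -/
noncomputable def laplacianGraph {n : ℕ} (A B : Matrix (Fin n) (Fin n) ℂ) :
    Submodule ℂ (HalfLineL2 n × HalfLineL2 n) where
  carrier := {p | ∃ (dψ ddψ : HalfLineL2 n) (a b : EuclideanSpace ℂ (Fin n)),
    IsWeakDeriv p.1 dψ ∧ IsWeakDeriv dψ ddψ ∧ HasBoundaryValue p.1 a ∧ HasBoundaryValue dψ b ∧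
    -(B.conjTranspose.toEuclideanLin a) + A.conjTranspose.toEuclideanLin b = 0 ∧ p.2 = -ddψ}
  zero_mem' := ⟨0, 0, 0, 0, .zero, .zero, .zero, .zero, by simp, by simp⟩
  add_mem' := by
    rintro p q ⟨d₁, e₁, a₁, b₁, h₁, k₁, l₁, m₁, n₁, o₁⟩ ⟨d₂, e₂, a₂, b₂, h₂, k₂, l₂, m₂, n₂, o₂⟩
    refine ⟨d₁ + d₂, e₁ + e₂, a₁ + a₂, b₁ + b₂, h₁.add h₂, k₁.add k₂, l₁.add l₂, m₁.add m₂, ?_, ?_⟩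
    · rw [map_add, map_add, neg_add, add_add_add_comm, n₁, n₂, add_zero]
    · rw [Prod.snd_add, o₁, o₂, neg_add]
  smul_mem' := by
    rintro c p ⟨d₁, e₁, a₁, b₁, h₁, k₁, l₁, m₁, n₁, o₁⟩
    refine ⟨c • d₁, c • e₁, c • a₁, c • b₁, h₁.const_smul c, k₁.const_smul c, l₁.const_smul c,
      m₁.const_smul c, ?_, ?_⟩
    · rw [map_smul, map_smul, ← smul_neg, ← smul_add, n₁, smul_zero]
    · rw [Prod.smul_snd, o₁, smul_neg]

/-- The operator `H_{0,A,B} = -d²/dx²` in `L²` with the boundary condition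
`-B† ψ(0) + A† ψ'(0) = 0`. -/
noncomputable def matrixLaplacian {n : ℕ} (A B : Matrix (Fin n) (Fin n) ℂ) :
    HalfLineL2 n →ₗ.[ℂ] HalfLineL2 n :=
  (laplacianGraph A B).toLinearPMap

/-- `matrixLaplacian A B` has the graph by which it is defined. -/
theorem matrixLaplacian_graph {n : ℕ} (A B : Matrix (Fin n) (Fin n) ℂ) :
    (matrixLaplacian A B).graph = laplacianGraph A B := by
  refine Submodule.toLinearPMap_graph_eq _ ?_
  rintro ⟨ψ, χ⟩ ⟨d, e, _, _, h, k, _, _, _, o⟩ h0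
  simp only at h h0 o
  subst h0
  obtain rfl := h.eq_zero
  obtain rfl := k.eq_zero
  simpa using o

/-! ### Generalized Fourier maps -/

/-- The regular solution `φ_{0,A,B}(k, x) = cos(kx) A + (sin(kx)/k) B` (with `sin(kx)/k = x` at
`k = 0`) of `-φ'' = k² φ`, `φ(k, 0) = A`, `φ'(k, 0) = B`. -/
noncomputable def regularSolution {n : ℕ} (A B : Matrix (Fin n) (Fin n) ℂ) (k x : ℝ) :
    Matrix (Fin n) (Fin n) ℂ :=
  (Real.cos (k * x) : ℂ) • A + ((x * Real.sinc (k * x) : ℝ) : ℂ) • B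

/-- The Jost matrix `J_{0,A,B}(k) = f(-k, 0)† B - f'(-k, 0)† A = B - ikA` for real `k`, where
`f(k, x) = e^{ikx} I` is the Jost solution for zero potential. -/
noncomputable def jostMatrix {n : ℕ} (A B : Matrix (Fin n) (Fin n) ℂ) (k : ℝ) :
    Matrix (Fin n) (Fin n) ℂ :=
  B - (Complex.I * k) • A

/-- The physical solution `ψ_{0,A,B}(k, x) = -ik φ_{0,A,B}(k, x) J_{0,A,B}(k)⁻¹`, for real `k ≠ 0`
(where the Jost matrix is invertible). -/
noncomputable def physicalSolution {n : ℕ} (A B : Matrix (Fin n) (Fin n) ℂ) (k x : ℝ) :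
    Matrix (Fin n) (Fin n) ℂ :=
  (-(Complex.I * k)) • (regularSolution A B k x * (jostMatrix A B k)⁻¹)

/-- `ψ^±_{0,A,B}(k, x) = ψ_{0,A,B}(∓k, x)`. -/
noncomputable def physicalSolutionPM {n : ℕ} (A B : Matrix (Fin n) (Fin n) ℂ) (d : TimeDirection)
    (k x : ℝ) : Matrix (Fin n) (Fin n) ℂ :=
  physicalSolution A B (-d.sign * k) x

/-- `F` is the generalized Fourier map `F^±_{0,A,B}`: the bounded operator on `L²` (unique because
`L¹ ∩ L²` is dense) such that `(Fψ)(k) = √(2/π) ∫₀^∞ ψ^±_{0,A,B}(k, x)† ψ(x) dx` for all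
`ψ ∈ L¹ ∩ L²` and almost every `k > 0`. -/
def IsGeneralizedFourierMap {n : ℕ} (A B : Matrix (Fin n) (Fin n) ℂ) (d : TimeDirection)
    (F : HalfLineL2 n →L[ℂ] HalfLineL2 n) : Prop :=
  ∀ ψ : HalfLineL2 n, Integrable ψ halfLine →
    F ψ =ᵐ[halfLine] fun k => Real.sqrt (2 / Real.pi) •
      ∫ x, (physicalSolutionPM A B d k x).conjTranspose.toEuclideanLin (ψ x) ∂halfLine

/-! The matrix problem is a direct sum of scalar ones. Since A†B = B†A, the value det(A + iB) is
nonzero, so A + αB is invertible for some real α, and B(A + αB)⁻¹ is Hermitian. Diagonalizing it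
gives A = M diag(a) T and B = M diag(b) T with M unitary, T invertible and real pairs (a_j, b_j) ≠
(0, 0) (`exists_diagonal_boundary`). Along the columns of M the boundary condition becomes a_j ψ'(0)
= b_j ψ(0), and T cancels from the physical solution. The Neumann problem is diagonal in every
unitary basis, so both operators decouple in the same one.

The scalar problem is solved explicitly. Let C and S be the cosine and sine transforms, which are
symmetric involutions, and put r = √(b² + a²k²), c = ak/r, s = b/r. The map G = cC + sS satisfies
GG* = 1, because c² + s² = 1 and the cross terms cancel by Green's formula (`robin_cross_term`,
`robinG_robinGAdj`). The complementary projection P = 1 − G*G is onto ker G, where f' = (b/a) f: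
this is the possible bound state, of energy −(b/a)². The operator is exactly G* k² G − (b/a)² P
(`isRobin_iff`). This yields the functional calculus, the spectral measures and the absolutely
continuous subspace ker P without an abstract spectral theorem.

The Fourier map is F = pG with p unimodular, so F* is an isometry with range ker P and it
intertwines e^{itH} with multiplication by e^{itk²}. Hence the error e^{itH} e^{−itH₀} ψ − F*Cψ has
the norm of (C − F*) e^{−itk²} Cψ. The phase p is such that C − F* = (C ∓ iS)θ for a bounded
multiplier θ (`robin_wave_identity`), and C ∓ iS has kernel √(2/π) e^{∓ikx}. For t → ±∞ the phase kx
+ |t|k² has no stationary point with x, k > 0, so the error tends to zero (`tendsto_expT_evol`).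
Existence, completeness and the formula for the wave operators then follow together. -/

/-! ### Test functions on the half line -/

/-- `L²((0, ∞); ℂ)`. -/
abbrev HalfLineC : Type := Lp ℂ 2 halfLine

/-- The complex test functions on `(0, ∞)`. -/
def halfLineTest : Submodule ℂ (ℝ → ℂ) where
  carrier := {η | ContDiff ℝ ∞ η ∧ HasCompactSupport η ∧ tsupport η ⊆ Ioi 0}
  zero_mem' := ⟨contDiff_const, HasCompactSupport.zero, by simp [tsupport]⟩
  add_mem' := fun ha hb => ⟨ha.1.add hb.1, ha.2.1.add hb.2.1,
    (tsupport_add _ _).trans (union_subset ha.2.2 hb.2.2)⟩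
  smul_mem' := fun c f hf => by
    have hs : tsupport (c • f) ⊆ tsupport f := tsupport_smul_subset_right (fun _ => c) f
    exact ⟨hf.1.const_smul c, hf.2.1.mono' (subset_closure.trans hs), hs.trans hf.2.2⟩

namespace halfLineTest

theorem continuous {η : ℝ → ℂ} (h : η ∈ halfLineTest) : Continuous η := h.1.continuous

theorem memLp {η : ℝ → ℂ} (h : η ∈ halfLineTest) : MemLp η 2 halfLine :=
  (continuous h).memLp_of_hasCompactSupport h.2.1

theorem integrable {η : ℝ → ℂ} (h : η ∈ halfLineTest) : Integrable η halfLine :=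
  (continuous h).integrable_of_hasCompactSupport h.2.1

theorem integrable_volume {η : ℝ → ℂ} (h : η ∈ halfLineTest) : Integrable η :=
  (continuous h).integrable_of_hasCompactSupport h.2.1

theorem eq_zero_of_nonpos {η : ℝ → ℂ} (h : η ∈ halfLineTest) {x : ℝ} (hx : x ≤ 0) : η x = 0 := by
  by_contra h0
  exact absurd (h.2.2 (subset_tsupport η h0)) (not_lt.2 hx)

theorem setIntegral_eq {η f : ℝ → ℂ} (h : η ∈ halfLineTest) :
    ∫ x, f x * η x ∂halfLine = ∫ x, f x * η x :=
  setIntegral_eq_integral_of_forall_compl_eq_zero fun x hx => by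
    rw [eq_zero_of_nonpos h (not_lt.1 hx), mul_zero]

theorem ofReal {η : ℝ → ℝ} (h : ContDiff ℝ ∞ η) (hc : HasCompactSupport η)
    (hs : tsupport η ⊆ Ioi 0) : (fun x => (η x : ℂ)) ∈ halfLineTest := by
  have hsub : tsupport (fun x => (η x : ℂ)) ⊆ tsupport η :=
    closure_mono fun x hx => by simpa using hx
  exact ⟨Complex.ofRealCLM.contDiff.comp h, hc.mono fun x hx => by simpa using hx,
    hsub.trans hs⟩

theorem deriv_mem {η : ℝ → ℂ} (h : η ∈ halfLineTest) : deriv η ∈ halfLineTest :=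
  ⟨((contDiff_infty_iff_deriv (𝕜 := ℝ)).1 h.1).2, h.2.1.deriv,
    (closure_minimal (support_deriv_subset) (isClosed_tsupport η)).trans h.2.2⟩

theorem mul_mem {η f : ℝ → ℂ} (h : η ∈ halfLineTest) (hf : ContDiff ℝ ∞ f) :
    (fun x => f x * η x) ∈ halfLineTest := by
  have hs : tsupport (fun x => f x * η x) ⊆ tsupport η := tsupport_mul_subset_right
  exact ⟨hf.mul h.1, h.2.1.mono' (subset_closure.trans hs), hs.trans h.2.2⟩

/-- The class of a test function in `L²`. -/
noncomputable def toL2 : halfLineTest →ₗ[ℂ] HalfLineC where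
  toFun η := (memLp η.2).toLp _
  map_add' _ _ := rfl
  map_smul' _ _ := rfl

theorem coe_toL2 (η : halfLineTest) : toL2 η =ᵐ[halfLine] (η : ℝ → ℂ) :=
  (memLp η.2).coeFn_toLp

end halfLineTest

theorem halfLineC_inner (f g : HalfLineC) :
    ⟪f, g⟫_ℂ = ∫ x, (starRingEnd ℂ) (f x) * g x ∂halfLine := by
  rw [L2.inner_def]
  simp [mul_comm]

theorem halfLineC_norm_sq (ψ : HalfLineC) : ‖ψ‖ ^ 2 = ∫ x, ‖ψ x‖ ^ 2 ∂halfLine := by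
  have h1 : ((‖ψ‖ ^ 2 : ℝ) : ℂ) = ((∫ x, ‖ψ x‖ ^ 2 ∂halfLine : ℝ) : ℂ) := by
    rw [← integral_complex_ofReal]
    have h2 := inner_self_eq_norm_sq_to_K (𝕜 := ℂ) ψ
    push_cast
    rw [L2.inner_def] at h2
    refine h2.symm.trans ?_
    simp [inner_self_eq_norm_sq_to_K]
  exact_mod_cast h1

theorem halfLineC_integrable_mul {f g : ℝ → ℂ} (hf : MemLp f 2 halfLine) (hg : MemLp g 2 halfLine) :
    Integrable (fun x => f x * g x) halfLine :=
  hf.integrable_mul hg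

/-- A locally integrable function that is orthogonal to the test functions vanishes. -/
theorem ae_eq_zero_of_forall_test {f : ℝ → ℂ} (hf : LocallyIntegrableOn f (Ioi 0) halfLine)
    (h : ∀ η : ℝ → ℝ, ContDiff ℝ ∞ η → HasCompactSupport η → tsupport η ⊆ Ioi 0 →
      ∫ x, (η x : ℂ) * f x ∂halfLine = 0) : f =ᵐ[halfLine] 0 := by
  have key : ∀ᵐ x ∂halfLine, x ∈ Ioi (0 : ℝ) → f x = 0 := by
    refine isOpen_Ioi.ae_eq_zero_of_integral_contDiff_smul_eq_zero hf fun η h1 h2 h3 => ?_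
    simpa using h η h1 h2 h3
  filter_upwards [key, ae_restrict_mem measurableSet_Ioi] with x hx hx0 using hx hx0

theorem halfLineTest.denseRange_toL2 : DenseRange halfLineTest.toL2 := by
  have h : (LinearMap.range halfLineTest.toL2).topologicalClosure = ⊤ := by
    rw [Submodule.topologicalClosure_eq_top_iff, Submodule.eq_bot_iff]
    intro g hg
    rw [Lp.eq_zero_iff_ae_eq_zero]
    refine ae_eq_zero_of_forall_test
      (((Lp.memLp g).locallyIntegrable (by norm_num)).locallyIntegrableOn _) fun η h1 h2 h3 => ?_
    have h4 := Submodule.inner_right_of_mem_orthogonal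
      (LinearMap.mem_range_self halfLineTest.toL2 ⟨_, halfLineTest.ofReal h1 h2 h3⟩) hg
    rw [halfLineC_inner] at h4
    rw [← h4]
    refine integral_congr_ae ?_
    filter_upwards [halfLineTest.coe_toL2 ⟨_, halfLineTest.ofReal h1 h2 h3⟩] with x hx
    simp [hx]
  have h2 : Dense ((LinearMap.range halfLineTest.toL2 : Submodule ℂ HalfLineC) : Set HalfLineC) := by
    rw [dense_iff_closure_eq, ← Submodule.topologicalClosure_coe, h, Submodule.top_coe]
  rwa [LinearMap.coe_range] at h2

/-! ### Self-inverse integral transforms on the half line -/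

theorem aestronglyMeasurable_kernel {κ : ℝ → ℝ → ℝ} (hκ : Continuous (Function.uncurry κ))
    {ψ : ℝ → ℂ} (hψ : Integrable ψ halfLine) :
    AEStronglyMeasurable (fun k => ∫ x, (κ k x : ℂ) * ψ x ∂halfLine) halfLine := by
  have h : AEStronglyMeasurable (fun p : ℝ × ℝ => (κ p.1 p.2 : ℂ) * ψ p.2)
      (halfLine.prod halfLine) :=
    (Complex.continuous_ofReal.comp hκ).aestronglyMeasurable.mul hψ.aestronglyMeasurable.comp_snd
  exact h.integral_prod_right'

theorem integrable_kernel_mul {κ : ℝ → ℝ → ℝ} (hκ : Continuous (Function.uncurry κ)) {M : ℝ}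
    (hb : ∀ k x, |κ k x| ≤ M) {ψ : ℝ → ℂ} (hψ : Integrable ψ halfLine) (k : ℝ) :
    Integrable (fun x => (κ k x : ℂ) * ψ x) halfLine := by
  refine hψ.bdd_mul (c := M) ?_ (ae_of_all _ fun x => by simpa using hb k x)
  exact (Complex.continuous_ofReal.comp
    (hκ.comp (by fun_prop : Continuous fun x => (k, x)))).aestronglyMeasurable

theorem norm_kernel_integral_le {κ : ℝ → ℝ → ℝ} {M : ℝ}
    (hb : ∀ k x, |κ k x| ≤ M) {ψ : ℝ → ℂ} (hψ : Integrable ψ halfLine) (k : ℝ) :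
    ‖∫ x, (κ k x : ℂ) * ψ x ∂halfLine‖ ≤ M * ∫ x, ‖ψ x‖ ∂halfLine := by
  rw [← integral_const_mul]
  refine norm_integral_le_of_norm_le (hψ.norm.const_mul M) (ae_of_all _ fun x => ?_)
  rw [norm_mul]
  gcongr
  simpa using hb k x

/-- Fubini on the quadrant. Integrability of both functions, rather than square integrability, makes
the double integral absolutely convergent for a merely bounded kernel. -/
theorem integral_kernel_symm {κ : ℝ → ℝ → ℝ} (hκ : Continuous (Function.uncurry κ)) {M : ℝ}
    (hb : ∀ k x, |κ k x| ≤ M) (hs : ∀ k x, κ k x = κ x k) {ψ φ : ℝ → ℂ}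
    (hψ : Integrable ψ halfLine) (hφ : Integrable φ halfLine) :
    ∫ k, (starRingEnd ℂ) (∫ x, (κ k x : ℂ) * ψ x ∂halfLine) * φ k ∂halfLine =
      ∫ x, (starRingEnd ℂ) (ψ x) * (∫ k, (κ x k : ℂ) * φ k ∂halfLine) ∂halfLine := by
  have h1 : ∀ k, (starRingEnd ℂ) (∫ x, (κ k x : ℂ) * ψ x ∂halfLine) * φ k =
      ∫ x, (κ k x : ℂ) * ((starRingEnd ℂ) (ψ x) * φ k) ∂halfLine := by
    intro k
    rw [← integral_conj, ← integral_mul_const]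
    simp [mul_assoc]
  have h2 : ∀ x, (starRingEnd ℂ) (ψ x) * (∫ k, (κ x k : ℂ) * φ k ∂halfLine) =
      ∫ k, (κ k x : ℂ) * ((starRingEnd ℂ) (ψ x) * φ k) ∂halfLine := by
    intro x
    rw [← integral_const_mul]
    refine integral_congr_ae (ae_of_all _ fun k => ?_)
    simp only [hs x k]
    ring
  simp_rw [h1, h2]
  rw [integral_integral_swap]
  have h3 : Integrable (fun p : ℝ × ℝ => (starRingEnd ℂ) (ψ p.2) * φ p.1)
      (halfLine.prod halfLine) := by
    have h4 := hφ.mul_prod (hψ.mono (f := fun x => (starRingEnd ℂ) (ψ x))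
      (RCLike.continuous_conj.comp_aestronglyMeasurable hψ.aestronglyMeasurable)
      (ae_of_all _ fun x => by simp))
    exact h4.congr (ae_of_all _ fun p => mul_comm _ _)
  exact h3.bdd_mul (c := M) (Complex.continuous_ofReal.comp hκ).aestronglyMeasurable
    (ae_of_all _ fun p => by simpa using hb p.1 p.2)

/-- A bounded continuous symmetric real kernel that is isometric on test functions defines a
self-adjoint unitary operator on `L²`, given on `L¹ ∩ L²` by the integral. -/
theorem exists_kernelTransform {κ : ℝ → ℝ → ℝ} (hκ : Continuous (Function.uncurry κ)) {M : ℝ}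
    (hb : ∀ k x, |κ k x| ≤ M) (hs : ∀ k x, κ k x = κ x k)
    (hm : ∀ η ∈ halfLineTest, MemLp (fun k => ∫ x, (κ k x : ℂ) * η x ∂halfLine) 2 halfLine)
    (hn : ∀ η ∈ halfLineTest,
      ∫ k, ‖∫ x, (κ k x : ℂ) * η x ∂halfLine‖ ^ 2 ∂halfLine = ∫ x, ‖η x‖ ^ 2 ∂halfLine) :
    ∃ T : HalfLineC →L[ℂ] HalfLineC, (∀ f g, ⟪T f, g⟫_ℂ = ⟪f, T g⟫_ℂ) ∧ (∀ f, T (T f) = f) ∧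
      ∀ ψ : HalfLineC, Integrable ψ halfLine →
        T ψ =ᵐ[halfLine] fun k => ∫ x, (κ k x : ℂ) * ψ x ∂halfLine := by
  let f : halfLineTest →ₗ[ℂ] HalfLineC :=
    { toFun := fun η => (hm η η.2).toLp _
      map_add' := by
        intro η ζ
        rw [← MemLp.toLp_add]
        refine MemLp.toLp_congr _ _ (ae_of_all _ fun k => ?_)
        rw [Pi.add_apply, ← integral_add
          (integrable_kernel_mul hκ hb (halfLineTest.integrable η.2) k)
          (integrable_kernel_mul hκ hb (halfLineTest.integrable ζ.2) k)]
        simp [mul_add]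
      map_smul' := by
        intro c η
        rw [← MemLp.toLp_const_smul]
        refine MemLp.toLp_congr _ _ (ae_of_all _ fun k => ?_)
        rw [Pi.smul_apply, ← integral_smul]
        simp [mul_left_comm] }
  have hf : ∀ η, (f η : ℝ → ℂ) =ᵐ[halfLine] fun k => ∫ x, (κ k x : ℂ) * (η : ℝ → ℂ) x ∂halfLine :=
    fun η => (hm η η.2).coeFn_toLp
  have hnorm : ∀ η, ‖f η‖ = ‖halfLineTest.toL2 η‖ := by
    intro η
    rw [← sq_eq_sq₀ (norm_nonneg _) (norm_nonneg _), halfLineC_norm_sq, halfLineC_norm_sq]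
    rw [integral_congr_ae (g := fun k => ‖∫ x, (κ k x : ℂ) * (η : ℝ → ℂ) x ∂halfLine‖ ^ 2)
      ((hf η).mono fun x hx => by simp only [hx]), hn _ η.2]
    exact integral_congr_ae ((halfLineTest.coe_toL2 η).mono fun x hx => by simp only [hx])
  have hd := halfLineTest.denseRange_toL2
  have hbd : ∃ C, ∀ x, ‖f x‖ ≤ C * ‖halfLineTest.toL2 x‖ := ⟨1, fun x => by rw [hnorm, one_mul]⟩
  set T := f.extendOfNorm halfLineTest.toL2 with hT
  have hTe : ∀ η, T (halfLineTest.toL2 η) = f η := LinearMap.extendOfNorm_eq hd hbd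
  have hsymm0 : ∀ (η : halfLineTest) (ψ : HalfLineC), Integrable ψ halfLine →
      ⟪f η, ψ⟫_ℂ = ∫ x, (starRingEnd ℂ) ((η : ℝ → ℂ) x) *
        (∫ k, (κ x k : ℂ) * ψ k ∂halfLine) ∂halfLine := by
    intro η ψ hψ
    rw [halfLineC_inner, ← integral_kernel_symm hκ hb hs (halfLineTest.integrable η.2) hψ]
    exact integral_congr_ae ((hf η).mono fun x hx => by simp only [hx])
  have hint : ∀ η, Integrable (halfLineTest.toL2 η) halfLine := fun η =>
    (halfLineTest.integrable η.2).congr (halfLineTest.coe_toL2 η).symm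
  have hsymm1 : ∀ η ζ, ⟪T (halfLineTest.toL2 η), halfLineTest.toL2 ζ⟫_ℂ =
      ⟪halfLineTest.toL2 η, T (halfLineTest.toL2 ζ)⟫_ℂ := by
    intro η ζ
    rw [hTe, hTe, hsymm0 _ _ (hint ζ), halfLineC_inner]
    refine integral_congr_ae ?_
    filter_upwards [halfLineTest.coe_toL2 η, hf ζ] with x h1 h2
    rw [h1, h2]
    congr 1
    exact integral_congr_ae ((halfLineTest.coe_toL2 ζ).mono fun k hk => by simp only [hk])
  have hsymm : ∀ f g, ⟪T f, g⟫_ℂ = ⟪f, T g⟫_ℂ := by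
    intro f g
    refine hd.induction_on (p := fun f => ⟪T f, g⟫_ℂ = ⟪f, T g⟫_ℂ) f
      (isClosed_eq (by fun_prop) (by fun_prop)) fun η => ?_
    exact hd.induction_on
      (p := fun g => ⟪T (halfLineTest.toL2 η), g⟫_ℂ = ⟪halfLineTest.toL2 η, T g⟫_ℂ) g
      (isClosed_eq (by fun_prop) (by fun_prop)) fun ζ => hsymm1 η ζ
  have hiso : ∀ f, ‖T f‖ = ‖f‖ := fun f =>
    hd.induction_on (p := fun f => ‖T f‖ = ‖f‖) f
      (isClosed_eq (by fun_prop) (by fun_prop)) fun η => by rw [hTe, hnorm]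
  refine ⟨T, hsymm, fun f => ?_, fun ψ hψ => ?_⟩
  -- A symmetric isometry is an involution: ⟪T(Tf), g⟫ = ⟪Tf, Tg⟫ = ⟪f, g⟫.
  · let V : HalfLineC →ₗᵢ[ℂ] HalfLineC := ⟨T, hiso⟩
    refine ext_inner_right ℂ fun g => ?_
    rw [hsymm]
    exact V.inner_map_map f g
  -- The integral is only known to be bounded in k, not square integrable, so it is compared with Tψ
  -- weakly, by pairing the difference with test functions.
  · have hloc : LocallyIntegrableOn
        (fun k => T ψ k - ∫ x, (κ k x : ℂ) * ψ x ∂halfLine) (Ioi 0) halfLine := by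
      refine LocallyIntegrable.locallyIntegrableOn ?_ _
      refine ((Lp.memLp (T ψ)).locallyIntegrable (by norm_num)).sub ?_
      refine MemLp.locallyIntegrable (p := ⊤) ?_ (by norm_num)
      exact memLp_top_of_bound (aestronglyMeasurable_kernel hκ hψ) _
        (ae_of_all _ fun k => norm_kernel_integral_le hb hψ k)
    have h0 := ae_eq_zero_of_forall_test hloc fun η h1 h2 h3 => by
      have h4 := hsymm0 ⟨_, halfLineTest.ofReal h1 h2 h3⟩ ψ hψ
      rw [← hTe, hsymm, halfLineC_inner] at h4
      have h5 := halfLineTest.coe_toL2 ⟨_, halfLineTest.ofReal h1 h2 h3⟩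
      have hmem := halfLineTest.memLp (halfLineTest.ofReal h1 h2 h3)
      have h6 : Integrable (fun x => (η x : ℂ) * T ψ x) halfLine :=
        halfLineC_integrable_mul hmem (Lp.memLp _)
      have h7 : Integrable (fun x => (η x : ℂ) * ∫ k, (κ x k : ℂ) * ψ k ∂halfLine) halfLine :=
        (halfLineTest.integrable (halfLineTest.ofReal h1 h2 h3)).mul_bdd
          (aestronglyMeasurable_kernel hκ hψ)
          (ae_of_all _ fun k => norm_kernel_integral_le hb hψ k)
      simp_rw [mul_sub]
      rw [integral_sub h6 h7, sub_eq_zero]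
      simp only [Complex.conj_ofReal] at h4
      rw [← h4]
      exact integral_congr_ae (h5.mono fun x hx => by simp [hx])
    filter_upwards [h0] with k hk
    simpa [sub_eq_zero] using hk

/-! ### The cosine and sine transforms -/

open scoped FourierTransform in
theorem halfLineTest.plancherel_reflect {η : ℝ → ℂ} (hη : η ∈ halfLineTest) {σ : ℂ}
    (hσ : σ = 1 ∨ σ = -1) {t : ℝ → ℂ}
    (ht : ∀ k : ℝ, t k = ∫ x, (Complex.exp (-(k * x * Complex.I)) +
      σ * Complex.exp (k * x * Complex.I)) * η x ∂halfLine) :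
    MemLp t 2 halfLine ∧
      ∫ k, ‖t k‖ ^ 2 ∂halfLine = 2 * Real.pi * ∫ x, ‖η x‖ ^ 2 ∂halfLine := by
  have hpi := Real.pi_pos
  have hneg : ContDiff ℝ ∞ (fun x : ℝ => η (-x)) := hη.1.comp contDiff_neg
  have hcneg : HasCompactSupport (fun x : ℝ => η (-x)) :=
    hη.2.1.comp_homeomorph (Homeomorph.neg ℝ)
  have he1 : ContDiff ℝ ∞ (fun x => η x + σ * η (-x)) := hη.1.add (contDiff_const.mul hneg)
  have he2 : HasCompactSupport (fun x => η x + σ * η (-x)) := hη.2.1.add hcneg.mul_left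
  -- The even (σ = 1) or odd (σ = −1) extension of η to the line. Plancherel for it gives the claim
  -- after halving both sides by symmetry.
  set e := he2.toSchwartzMap he1 with he
  have hex : ∀ x, e x = η x + σ * η (-x) := fun x => rfl
  -- The Fourier transform has phase −2πxξ; the substitution ξ = k/(2π) produces the factor 2π in
  -- the conclusion.
  have hF : ∀ k, (𝓕 e : SchwartzMap ℝ ℂ) (k / (2 * Real.pi)) = t k := by
    intro k
    rw [SchwartzMap.fourier_coe, Real.fourier_real_eq_integral_exp_smul, ht,
      halfLineTest.setIntegral_eq hη]
    have hi : ∀ s : ℝ, Integrable (fun x : ℝ => Complex.exp (s * x * Complex.I) * η x) :=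
      fun s => (halfLineTest.integrable_volume hη).bdd_mul (c := 1)
        (by fun_prop) (ae_of_all _ fun x => by
          rw [show (s * x * Complex.I : ℂ) = ((s * x : ℝ) : ℂ) * Complex.I by push_cast; ring,
            Complex.norm_exp_ofReal_mul_I])
    have h1 : ∀ v : ℝ, Complex.exp (↑(-2 * Real.pi * v * (k / (2 * Real.pi))) * Complex.I) • e v =
        Complex.exp (((-k : ℝ) : ℂ) * v * Complex.I) * η v +
          σ * (Complex.exp ((k : ℂ) * ((-v : ℝ) : ℂ) * Complex.I) * η (-v)) := by
      intro v
      rw [hex, smul_eq_mul]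
      have h2 : ((-2 * Real.pi * v * (k / (2 * Real.pi)) : ℝ) : ℂ) = -(k * v) := by
        have : -2 * Real.pi * v * (k / (2 * Real.pi)) = -(k * v) := by field_simp
        rw [this]; push_cast; ring
      rw [h2, show (((-k : ℝ) : ℂ) * v * Complex.I) = -(k * v) * Complex.I by push_cast; ring,
        show ((k : ℂ) * ((-v : ℝ) : ℂ) * Complex.I) = -(k * v) * Complex.I by push_cast; ring]
      ring
    simp_rw [h1]
    rw [integral_add (hi (-k)) (((hi k).comp_neg).const_mul σ), integral_const_mul,
      integral_neg_eq_self (fun v : ℝ => Complex.exp ((k : ℂ) * (v : ℂ) * Complex.I) * η v) volume,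
      ← integral_const_mul, ← integral_add (hi (-k)) ((hi k).const_mul σ)]
    refine integral_congr_ae (ae_of_all _ fun x => ?_)
    simp only [Complex.ofReal_neg, neg_mul]
    ring
  have hsq : Integrable (fun ξ => ‖(𝓕 e : SchwartzMap ℝ ℂ) ξ‖ ^ 2) :=
    ((𝓕 e : SchwartzMap ℝ ℂ).memLp 2).integrable_norm_pow (by norm_num)
  have hteq : t = fun k => (𝓕 e : SchwartzMap ℝ ℂ) (k / (2 * Real.pi)) := funext fun k => (hF k).symm
  have hti : Integrable (fun k => ‖t k‖ ^ 2) := by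
    simp_rw [hteq]
    exact hsq.comp_div (by positivity)
  have htm : Continuous t := by
    rw [hteq]
    exact (𝓕 e : SchwartzMap ℝ ℂ).continuous.comp (by fun_prop)
  refine ⟨((memLp_two_iff_integrable_sq_norm htm.aestronglyMeasurable).2 hti).restrict _, ?_⟩
  have heven : ∀ k, ‖t (-k)‖ = ‖t k‖ := by
    have : ∀ k, t (-k) = σ * t k := by
      intro k
      rw [ht, ht, ← integral_const_mul]
      refine integral_congr_ae (ae_of_all _ fun x => ?_)
      have h2 : σ * σ = 1 := by rcases hσ with h | h <;> simp [h]
      simp only [Complex.ofReal_neg, neg_mul, neg_neg]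
      linear_combination (-Complex.exp (k * x * Complex.I) * η x) * h2
    intro k
    rw [this, norm_mul]
    rcases hσ with h | h <;> simp [h]
  have h1 : ∫ k, ‖t k‖ ^ 2 = 2 * ∫ k, ‖t k‖ ^ 2 ∂halfLine := by
    rw [← integral_comp_abs (f := fun k => ‖t k‖ ^ 2)]
    refine integral_congr_ae (ae_of_all _ fun k => ?_)
    rcases abs_choice k with h | h <;> simp [h, heven]
  have h2 : ∫ x, ‖e x‖ ^ 2 = 2 * ∫ x, ‖η x‖ ^ 2 ∂halfLine := by
    rw [← integral_comp_abs (f := fun x => ‖η x‖ ^ 2)]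
    refine integral_congr_ae (ae_of_all _ fun x => ?_)
    simp only [hex]
    rcases le_total 0 x with h | h
    · rw [abs_of_nonneg h, halfLineTest.eq_zero_of_nonpos hη (neg_nonpos.2 h), mul_zero, add_zero]
    · rw [abs_of_nonpos h, halfLineTest.eq_zero_of_nonpos hη h, zero_add, norm_mul]
      rcases hσ with h | h <;> simp [h]
  have h3 : ∫ k, ‖t k‖ ^ 2 = 2 * Real.pi * ∫ x, ‖e x‖ ^ 2 := by
    rw [← SchwartzMap.integral_norm_sq_fourier]
    simp_rw [hteq]
    rw [Measure.integral_comp_div (fun ξ => ‖(𝓕 e : SchwartzMap ℝ ℂ) ξ‖ ^ 2), smul_eq_mul,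
      abs_of_pos (by positivity)]
  rw [h1, h2] at h3
  linarith

/-- The kernel of the cosine transform. -/
noncomputable def cosKernel (k x : ℝ) : ℝ := Real.sqrt (2 / Real.pi) * Real.cos (k * x)

/-- The kernel of the sine transform. -/
noncomputable def sinKernel (k x : ℝ) : ℝ := Real.sqrt (2 / Real.pi) * Real.sin (k * x)

theorem continuous_cosKernel : Continuous (Function.uncurry cosKernel) := by
  unfold cosKernel Function.uncurry; fun_prop

theorem continuous_sinKernel : Continuous (Function.uncurry sinKernel) := by
  unfold sinKernel Function.uncurry; fun_prop

theorem abs_cosKernel_le (k x : ℝ) : |cosKernel k x| ≤ Real.sqrt (2 / Real.pi) := by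
  rw [cosKernel, abs_mul, abs_of_nonneg (Real.sqrt_nonneg _)]
  exact mul_le_of_le_one_right (Real.sqrt_nonneg _) (Real.abs_cos_le_one _)

theorem abs_sinKernel_le (k x : ℝ) : |sinKernel k x| ≤ Real.sqrt (2 / Real.pi) := by
  rw [sinKernel, abs_mul, abs_of_nonneg (Real.sqrt_nonneg _)]
  exact mul_le_of_le_one_right (Real.sqrt_nonneg _) (Real.abs_sin_le_one _)

theorem cosKernel_comm (k x : ℝ) : cosKernel k x = cosKernel x k := by
  rw [cosKernel, cosKernel, mul_comm k]

theorem sinKernel_comm (k x : ℝ) : sinKernel k x = sinKernel x k := by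
  rw [sinKernel, sinKernel, mul_comm k]

theorem halfLineTest.plancherel_of_kernel {η : ℝ → ℂ} (hη : η ∈ halfLineTest) {σ c : ℂ}
    (hσ : σ = 1 ∨ σ = -1) (hc : ‖c‖ ^ 2 = 2 / Real.pi) {κ : ℝ → ℝ → ℝ}
    (hκ : ∀ k x : ℝ, (κ k x : ℂ) = c * ((Complex.exp (-(k * x * Complex.I)) +
      σ * Complex.exp (k * x * Complex.I)) / 2)) :
    MemLp (fun k => ∫ x, (κ k x : ℂ) * η x ∂halfLine) 2 halfLine ∧
      ∫ k, ‖∫ x, (κ k x : ℂ) * η x ∂halfLine‖ ^ 2 ∂halfLine = ∫ x, ‖η x‖ ^ 2 ∂halfLine := by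
  obtain ⟨h1, h2⟩ := halfLineTest.plancherel_reflect hη hσ (t := fun k => ∫ x,
    (Complex.exp (-(k * x * Complex.I)) + σ * Complex.exp (k * x * Complex.I)) * η x ∂halfLine)
    fun k => rfl
  have h3 : ∀ k : ℝ, ∫ x, (κ k x : ℂ) * η x ∂halfLine = (c / 2) • ∫ x,
      (Complex.exp (-(k * x * Complex.I)) + σ * Complex.exp (k * x * Complex.I)) * η x ∂halfLine := by
    intro k
    rw [← integral_smul]
    refine integral_congr_ae (ae_of_all _ fun x => ?_)
    simp only [hκ, smul_eq_mul]
    ring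
  simp_rw [h3]
  refine ⟨h1.const_smul (c / 2), ?_⟩
  simp_rw [norm_smul, mul_pow]
  rw [integral_const_mul, h2, norm_div, div_pow, hc]
  have := Real.pi_pos
  simp only [Complex.norm_ofNat]
  field_simp

theorem exists_cosTransform : ∃ T : HalfLineC →L[ℂ] HalfLineC,
    (∀ f g, ⟪T f, g⟫_ℂ = ⟪f, T g⟫_ℂ) ∧ (∀ f, T (T f) = f) ∧
      ∀ ψ : HalfLineC, Integrable ψ halfLine →
        T ψ =ᵐ[halfLine] fun k => ∫ x, (cosKernel k x : ℂ) * ψ x ∂halfLine := by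
  have key : ∀ η ∈ halfLineTest, _ := fun η hη =>
    halfLineTest.plancherel_of_kernel hη (σ := 1) (c := (Real.sqrt (2 / Real.pi) : ℝ)) (Or.inl rfl)
      (by rw [Complex.norm_real, Real.norm_eq_abs, sq_abs, Real.sq_sqrt (by positivity)])
      (κ := cosKernel) fun k x => by
        rw [cosKernel]
        push_cast
        rw [Complex.cos]
        simp only [neg_mul, one_mul]
        ring
  exact exists_kernelTransform continuous_cosKernel abs_cosKernel_le cosKernel_comm
    (fun η hη => (key η hη).1) (fun η hη => (key η hη).2)

theorem exists_sinTransform : ∃ T : HalfLineC →L[ℂ] HalfLineC,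
    (∀ f g, ⟪T f, g⟫_ℂ = ⟪f, T g⟫_ℂ) ∧ (∀ f, T (T f) = f) ∧
      ∀ ψ : HalfLineC, Integrable ψ halfLine →
        T ψ =ᵐ[halfLine] fun k => ∫ x, (sinKernel k x : ℂ) * ψ x ∂halfLine := by
  have key : ∀ η ∈ halfLineTest, _ := fun η hη =>
    halfLineTest.plancherel_of_kernel hη (σ := -1)
      (c := (Real.sqrt (2 / Real.pi) : ℝ) * Complex.I) (Or.inr rfl)
      (by rw [norm_mul, Complex.norm_I, mul_one, Complex.norm_real, Real.norm_eq_abs, sq_abs,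
        Real.sq_sqrt (by positivity)])
      (κ := sinKernel) fun k x => by
        rw [sinKernel]
        push_cast
        rw [Complex.sin]
        simp only [neg_mul, one_mul]
        ring
  exact exists_kernelTransform continuous_sinKernel abs_sinKernel_le sinKernel_comm
    (fun η hη => (key η hη).1) (fun η hη => (key η hη).2)

/-- The cosine transform on `L²((0, ∞); ℂ)`. -/
noncomputable def cosT : HalfLineC →L[ℂ] HalfLineC := exists_cosTransform.choose

/-- The sine transform on `L²((0, ∞); ℂ)`. -/
noncomputable def sinT : HalfLineC →L[ℂ] HalfLineC := exists_sinTransform.choose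

theorem cosT_inner (f g : HalfLineC) : ⟪cosT f, g⟫_ℂ = ⟪f, cosT g⟫_ℂ :=
  exists_cosTransform.choose_spec.1 f g

theorem sinT_inner (f g : HalfLineC) : ⟪sinT f, g⟫_ℂ = ⟪f, sinT g⟫_ℂ :=
  exists_sinTransform.choose_spec.1 f g

theorem cosT_cosT (f : HalfLineC) : cosT (cosT f) = f := exists_cosTransform.choose_spec.2.1 f

theorem sinT_sinT (f : HalfLineC) : sinT (sinT f) = f := exists_sinTransform.choose_spec.2.1 f

theorem cosT_ae {ψ : HalfLineC} (h : Integrable ψ halfLine) :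
    cosT ψ =ᵐ[halfLine] fun k => ∫ x, (cosKernel k x : ℂ) * ψ x ∂halfLine :=
  exists_cosTransform.choose_spec.2.2 ψ h

theorem sinT_ae {ψ : HalfLineC} (h : Integrable ψ halfLine) :
    sinT ψ =ᵐ[halfLine] fun k => ∫ x, (sinKernel k x : ℂ) * ψ x ∂halfLine :=
  exists_sinTransform.choose_spec.2.2 ψ h

/-! ### Multiplication operators -/

/-- Bounded measurable functions. -/
def IsBddMeasurable (m : ℝ → ℂ) : Prop := Measurable m ∧ ∃ C, ∀ x, ‖m x‖ ≤ C

namespace IsBddMeasurable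

variable {m m' : ℝ → ℂ}

theorem memLp_mul (h : IsBddMeasurable m) {f : ℝ → ℂ} (hf : MemLp f 2 halfLine) :
    MemLp (fun x => m x * f x) 2 halfLine := by
  obtain ⟨h1, C, h2⟩ := h
  exact hf.of_le_mul (c := C) (h1.aestronglyMeasurable.mul hf.1) (ae_of_all _ fun x => by
    rw [norm_mul]
    gcongr
    exact h2 x)

theorem mul (h : IsBddMeasurable m) (h' : IsBddMeasurable m') :
    IsBddMeasurable (fun x => m x * m' x) := by
  obtain ⟨h1, C, h2⟩ := h
  obtain ⟨h1', C', h2'⟩ := h'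
  exact ⟨h1.mul h1', C * C', fun x => by
    rw [norm_mul]
    exact mul_le_mul (h2 x) (h2' x) (norm_nonneg _) ((norm_nonneg _).trans (h2 x))⟩

theorem add (h : IsBddMeasurable m) (h' : IsBddMeasurable m') :
    IsBddMeasurable (fun x => m x + m' x) := by
  obtain ⟨h1, C, h2⟩ := h
  obtain ⟨h1', C', h2'⟩ := h'
  exact ⟨h1.add h1', C + C', fun x => (norm_add_le _ _).trans (add_le_add (h2 x) (h2' x))⟩

theorem conj (h : IsBddMeasurable m) : IsBddMeasurable (fun x => (starRingEnd ℂ) (m x)) := by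
  obtain ⟨h1, C, h2⟩ := h
  exact ⟨RCLike.continuous_conj.measurable.comp h1, C, fun x => by simpa using h2 x⟩

theorem const (c : ℂ) : IsBddMeasurable (fun _ => c) :=
  ⟨measurable_const, ‖c‖, fun _ => le_rfl⟩

theorem comp (h : IsBddMeasurable m) {g : ℝ → ℝ} (hg : Measurable g) :
    IsBddMeasurable (fun x => m (g x)) := by
  obtain ⟨h1, C, h2⟩ := h
  exact ⟨h1.comp hg, C, fun x => h2 _⟩

end IsBddMeasurable

open Classical in
/-- Multiplication by the bounded measurable function `m` on `L²`; `0` if `m` is not such. -/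
noncomputable def mulOp (m : ℝ → ℂ) : HalfLineC →L[ℂ] HalfLineC :=
  if h : IsBddMeasurable m then
    LinearMap.mkContinuousOfExistsBound
      { toFun := fun ψ => (h.memLp_mul (Lp.memLp ψ)).toLp _
        map_add' := by
          intro ψ φ
          rw [← MemLp.toLp_add]
          refine MemLp.toLp_congr _ _ ?_
          filter_upwards [Lp.coeFn_add ψ φ] with x hx
          rw [hx]
          exact mul_add _ _ _
        map_smul' := by
          intro c ψ
          rw [← MemLp.toLp_const_smul]
          refine MemLp.toLp_congr _ _ ?_
          filter_upwards [Lp.coeFn_smul c ψ] with x hx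
          rw [hx]
          exact mul_left_comm _ _ _ }
      (by
        obtain ⟨C, hC⟩ := h.2
        refine ⟨C, fun ψ => Lp.norm_le_mul_norm_of_ae_le_mul ?_⟩
        filter_upwards [(h.memLp_mul (Lp.memLp ψ)).coeFn_toLp] with x hx
        simp only [LinearMap.coe_mk, AddHom.coe_mk]
        rw [hx, norm_mul]
        gcongr
        exact hC x)
  else 0

variable {m m' : ℝ → ℂ}

theorem mulOp_ae (h : IsBddMeasurable m) (ψ : HalfLineC) :
    mulOp m ψ =ᵐ[halfLine] fun x => m x * ψ x := by
  rw [mulOp, dif_pos h]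
  exact (h.memLp_mul (Lp.memLp ψ)).coeFn_toLp

theorem mulOp_mulOp (h : IsBddMeasurable m) (h' : IsBddMeasurable m') (ψ : HalfLineC) :
    mulOp m (mulOp m' ψ) = mulOp (fun x => m x * m' x) ψ := by
  refine Lp.ext ?_
  filter_upwards [mulOp_ae h (mulOp m' ψ), mulOp_ae h' ψ, mulOp_ae (h.mul h') ψ] with x h1 h2 h3
  rw [h1, h2, h3, mul_assoc]

theorem mulOp_comm (h : IsBddMeasurable m) (h' : IsBddMeasurable m') (ψ : HalfLineC) :
    mulOp m (mulOp m' ψ) = mulOp m' (mulOp m ψ) := by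
  rw [mulOp_mulOp h h', mulOp_mulOp h' h]
  simp_rw [mul_comm]

theorem mulOp_const (c : ℂ) (ψ : HalfLineC) : mulOp (fun _ => c) ψ = c • ψ := by
  refine Lp.ext ?_
  filter_upwards [mulOp_ae (IsBddMeasurable.const c) ψ, Lp.coeFn_smul c ψ] with x h1 h2
  rw [h1, h2]
  rfl

theorem mulOp_congr (h : IsBddMeasurable m) (h' : IsBddMeasurable m')
    (hmm : ∀ x, 0 < x → m x = m' x) : mulOp m = mulOp m' := by
  ext1 ψ
  refine Lp.ext ?_
  filter_upwards [mulOp_ae h ψ, mulOp_ae h' ψ, ae_restrict_mem measurableSet_Ioi] with x h1 h2 h3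
  rw [h1, h2, hmm x h3]

theorem mulOp_inner (h : IsBddMeasurable m) (f g : HalfLineC) :
    ⟪mulOp (fun x => (starRingEnd ℂ) (m x)) f, g⟫_ℂ = ⟪f, mulOp m g⟫_ℂ := by
  rw [halfLineC_inner, halfLineC_inner]
  refine integral_congr_ae ?_
  filter_upwards [mulOp_ae h g, mulOp_ae h.conj f] with x h1 h2
  rw [h1, h2]
  simp
  ring

/-! ### Primitives and weak derivatives on the half line -/

/-- The primitive of `f` vanishing at `0`. -/
noncomputable def halfPrim (f : ℝ → ℂ) (x : ℝ) : ℂ := ∫ t in Ioc 0 x, f t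

theorem halfPrim_of_nonpos (f : ℝ → ℂ) {x : ℝ} (hx : x ≤ 0) : halfPrim f x = 0 := by
  simp [halfPrim, Ioc_eq_empty (not_lt.2 hx)]

theorem halfPrim_eq_interval (f : ℝ → ℂ) (x : ℝ) :
    halfPrim f x = ∫ t in (0 : ℝ)..x, (Ioi 0).indicator f t := by
  rcases le_total 0 x with h | h
  · rw [intervalIntegral.integral_of_le h, halfPrim]
    exact setIntegral_congr_fun measurableSet_Ioc fun t ht => by simp [ht.1]
  · rw [halfPrim_of_nonpos f h, intervalIntegral.integral_of_ge h]
    rw [setIntegral_congr_fun (g := fun _ => 0) measurableSet_Ioc fun t ht => by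
      simp [not_lt.2 ht.2]]
    simp

theorem halfLineC_integrableOn (φ : HalfLineC) (R : ℝ) : IntegrableOn φ (Ioc 0 R) := by
  have h1 : MemLp φ 2 (volume.restrict (Ioc 0 R)) :=
    (Lp.memLp φ).mono_measure (Measure.restrict_mono Ioc_subset_Ioi_self le_rfl)
  exact h1.integrable (by norm_num)

theorem continuous_halfPrim (φ : HalfLineC) : Continuous (halfPrim φ) := by
  have h : ∀ a b, IntervalIntegrable ((Ioi (0 : ℝ)).indicator φ) volume a b := by
    intro a b
    have h1 : LocallyIntegrable ((Ioi (0 : ℝ)).indicator φ) volume :=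
      (((memLp_indicator_iff_restrict measurableSet_Ioi).2 (Lp.memLp φ))).locallyIntegrable
        (by norm_num)
    exact (h1.integrableOn_isCompact isCompact_uIcc).intervalIntegrable
  rw [show halfPrim φ = _ from funext (halfPrim_eq_interval φ)]
  exact intervalIntegral.continuous_primitive h 0

/-- Integration by parts for merely integrable functions, by Fubini: the two terms are the integrals
of f(x)g(t) over the halves t ≤ x and x < t of the square (0, R]². -/
theorem integral_halfPrim_mul {f g : ℝ → ℂ} {R : ℝ} (hf : IntegrableOn f (Ioc 0 R))
    (hg : IntegrableOn g (Ioc 0 R)) :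
    (∫ x in Ioc 0 R, f x * halfPrim g x) + ∫ x in Ioc 0 R, halfPrim f x * g x =
      halfPrim f R * halfPrim g R := by
  set μ := volume.restrict (Ioc (0 : ℝ) R) with hμ
  have hF : Integrable (fun p : ℝ × ℝ => f p.1 * g p.2) (μ.prod μ) := hf.mul_prod hg
  have hprim : ∀ u : ℝ → ℂ, ∀ᵐ x ∂μ, halfPrim u x = ∫ t, (Iic x).indicator u t ∂μ := by
    intro u
    filter_upwards [ae_restrict_mem measurableSet_Ioc] with x hx
    rw [integral_indicator measurableSet_Iic, hμ, Measure.restrict_restrict measurableSet_Iic,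
      halfPrim]
    congr 2
    ext t
    simp only [mem_inter_iff, mem_Ioc, mem_Iic]
    constructor
    · rintro ⟨h1, h2⟩
      exact ⟨h2, h1, h2.trans hx.2⟩
    · rintro ⟨h1, h2, _⟩
      exact ⟨h2, h1⟩
  have e1 : ∫ x, f x * halfPrim g x ∂μ =
      ∫ x, ∫ t, {p : ℝ × ℝ | p.2 ≤ p.1}.indicator (fun p => f p.1 * g p.2) (x, t) ∂μ ∂μ := by
    refine integral_congr_ae ?_
    filter_upwards [hprim g] with x hx
    rw [hx, ← integral_const_mul]
    refine integral_congr_ae (ae_of_all _ fun t => ?_)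
    by_cases h : t ≤ x <;> simp [indicator, h]
  have e2 : ∫ x, halfPrim f x * g x ∂μ =
      ∫ x, ∫ t, {p : ℝ × ℝ | p.1 < p.2}.indicator (fun p => f p.1 * g p.2) (x, t) ∂μ ∂μ := by
    rw [integral_integral_swap (f := fun x t => {p : ℝ × ℝ | p.1 < p.2}.indicator
      (fun p => f p.1 * g p.2) (x, t)) (hF.indicator (measurableSet_lt measurable_fst measurable_snd))]
    refine integral_congr_ae ?_
    filter_upwards [hprim f] with x hx
    rw [hx, ← integral_mul_const]
    refine integral_congr_ae ?_
    have hne : ∀ᵐ t ∂μ, t ≠ x := ae_restrict_of_ae (by simp [ae_iff])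
    filter_upwards [hne] with t ht
    rcases lt_or_gt_of_ne ht with h | h
    · simp [indicator, h, h.le]
    · simp [indicator, not_lt.2 h.le, not_le.2 h]
  have hi1 := hF.indicator (measurableSet_le measurable_snd measurable_fst)
  have hi2 := hF.indicator (measurableSet_lt measurable_fst measurable_snd)
  rw [e1, e2, ← integral_prod _ hi1, ← integral_prod _ hi2, ← integral_add hi1 hi2]
  have e3 : halfPrim f R * halfPrim g R = ∫ p, f p.1 * g p.2 ∂(μ.prod μ) :=
    (integral_prod_mul f g).symm
  rw [e3]
  refine integral_congr_ae (ae_of_all _ fun p => ?_)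
  by_cases h : p.2 ≤ p.1
  · simp [indicator, h, not_lt.2 h]
  · simp [indicator, h, not_le.1 h]

/-- `φ` is the distributional derivative of `ψ` on `(0, ∞)`. -/
def IsWeakDerivC (ψ φ : HalfLineC) : Prop :=
  ∀ η : ℝ → ℝ, ContDiff ℝ ∞ η → HasCompactSupport η → tsupport η ⊆ Ioi 0 →
    ∫ x, ((deriv η x : ℝ) : ℂ) * ψ x ∂halfLine = -∫ x, (η x : ℂ) * φ x ∂halfLine

/-- `a` is the value at `0` of the continuous representative of `ψ`. -/
def HasBoundaryValueC (ψ : HalfLineC) (a : ℂ) : Prop :=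
  ∃ u : ℝ → ℂ, ContinuousOn u (Ici 0) ∧ u =ᵐ[halfLine] ψ ∧ u 0 = a

/-- A locally integrable function with vanishing distributional derivative is constant. -/
theorem exists_ae_eq_const_of_weakDeriv_zero {f : ℝ → ℂ} (hf : LocallyIntegrable f halfLine)
    (h : ∀ η : ℝ → ℝ, ContDiff ℝ ∞ η → HasCompactSupport η → tsupport η ⊆ Ioi 0 →
      ∫ x, ((deriv η x : ℝ) : ℂ) * f x ∂halfLine = 0) : ∃ c, f =ᵐ[halfLine] fun _ => c := by
  -- A bump of mass one supported in [1, 3], hence inside the open half line.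
  let b : ContDiffBump (2 : ℝ) := ⟨1 / 2, 1, by norm_num, by norm_num⟩
  set ρ : ℝ → ℝ := b.normed volume with hρ
  have hρ1 : ContDiff ℝ ∞ ρ := b.contDiff_normed
  have hρ2 : HasCompactSupport ρ := b.hasCompactSupport_normed
  have hρ3 : tsupport ρ ⊆ Ioi 0 := by
    rw [hρ, b.tsupport_normed_eq]
    intro x hx
    rw [Metric.mem_closedBall, Real.dist_eq] at hx
    have h0 : |x - 2| ≤ 1 := hx
    have := (abs_le.1 h0).1
    exact mem_Ioi.2 (by linarith)
  have hρi : ∫ x, ρ x = 1 := b.integral_normed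
  have hint : ∀ ζ : ℝ → ℝ, Continuous ζ → HasCompactSupport ζ →
      Integrable (fun x => (ζ x : ℂ) * f x) halfLine := fun ζ h1 h2 =>
    hf.integrable_smul_left_of_hasCompactSupport (g := fun x => (ζ x : ℂ))
      (Complex.continuous_ofReal.comp h1) (h2.comp_left (g := fun r : ℝ => (r : ℂ)) (by simp))
  set c := ∫ x, (ρ x : ℂ) * f x ∂halfLine with hc
  refine ⟨c, ?_⟩
  have h0 : (fun x => f x - c) =ᵐ[halfLine] 0 := by
    refine ae_eq_zero_of_forall_test ((hf.sub (locallyIntegrable_const c)).locallyIntegrableOn _) ?_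
    intro ζ hζ1 hζ2 hζ3
    set I := ∫ x, ζ x with hI
    -- Removing the mean makes the primitive of θ compactly supported in (0, ∞), so θ is the
    -- derivative of an admissible test function.
    set θ : ℝ → ℝ := fun x => ζ x - I * ρ x with hθ
    have hθ1 : ContDiff ℝ ∞ θ := hζ1.sub (contDiff_const.mul hρ1)
    have hθi : ∫ x, θ x = 0 := by
      rw [hθ, integral_sub (hζ1.continuous.integrable_of_hasCompactSupport hζ2)
        ((hρ1.continuous.integrable_of_hasCompactSupport hρ2).const_mul I), integral_const_mul, hρi,
        mul_one, sub_self]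
    have hK : IsCompact (tsupport ζ ∪ tsupport ρ) := hζ2.isCompact.union hρ2.isCompact
    have hKne : (tsupport ζ ∪ tsupport ρ).Nonempty := by
      refine ⟨2, Or.inr ?_⟩
      rw [hρ, b.tsupport_normed_eq]
      exact Metric.mem_closedBall_self b.rOut_pos.le
    obtain ⟨p, hp1, hp2⟩ := hK.exists_isLeast hKne
    obtain ⟨q, hq1, hq2⟩ := hK.exists_isGreatest hKne
    have hp0 : 0 < p := union_subset hζ3 hρ3 hp1
    have hout : ∀ x, x ∉ Icc p q → θ x = 0 := by
      intro x hx
      have h1 : x ∉ tsupport ζ ∪ tsupport ρ := fun hm => hx ⟨hp2 hm, hq2 hm⟩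
      rw [mem_union, not_or] at h1
      simp [hθ, image_eq_zero_of_notMem_tsupport h1.1, image_eq_zero_of_notMem_tsupport h1.2]
    set η : ℝ → ℝ := fun x => ∫ t in (0 : ℝ)..x, θ t with hη
    have hηd : ∀ x, HasDerivAt η (θ x) x := fun x =>
      intervalIntegral.integral_hasDerivAt_right (hθ1.continuous.intervalIntegrable _ _)
        hθ1.continuous.stronglyMeasurable.stronglyMeasurableAtFilter hθ1.continuous.continuousAt
    have hηd' : deriv η = θ := funext fun x => (hηd x).deriv
    have hη1 : ContDiff ℝ ∞ η :=
      contDiff_infty_iff_deriv.2 ⟨fun x => (hηd x).differentiableAt, by rw [hηd']; exact hθ1⟩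
    have hηout : ∀ x, x ∉ Icc p q → η x = 0 := by
      intro x hx
      rw [mem_Icc, not_and_or, not_le, not_le] at hx
      rcases hx with hx | hx
      · refine (intervalIntegral.integral_congr (g := fun _ => (0 : ℝ)) fun t ht => ?_).trans
          (by simp)
        refine hout t fun hm => ?_
        rcases mem_uIcc.1 ht with h | h <;> linarith [hm.1, h.2]
      · have hq : 0 ≤ x := (hp0.le.trans (hq2 hp1)).trans hx.le
        refine Eq.trans (intervalIntegral.integral_of_le hq) (Eq.trans ?_ hθi)
        refine setIntegral_eq_integral_of_forall_compl_eq_zero fun t ht => hout t fun hm => ht ?_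
        exact ⟨hp0.trans_le hm.1, hm.2.trans hx.le⟩
    have hηs : tsupport η ⊆ Icc p q :=
      closure_minimal (fun x hx => by_contra fun h => hx (hηout x h)) isClosed_Icc
    have hη2 : HasCompactSupport η := HasCompactSupport.of_support_subset_isCompact isCompact_Icc
      ((subset_tsupport η).trans hηs)
    have h1 := h η hη1 hη2 (hηs.trans fun x hx => hp0.trans_le hx.1)
    rw [hηd'] at h1
    have h2 : ∫ x, (θ x : ℂ) * f x ∂halfLine =
        (∫ x, (ζ x : ℂ) * f x ∂halfLine) - I * c := by
      rw [hc, ← integral_const_mul, ← integral_sub (hint ζ hζ1.continuous hζ2)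
        ((hint ρ hρ1.continuous hρ2).const_mul _)]
      refine integral_congr_ae (ae_of_all _ fun x => ?_)
      simp only [hθ]
      push_cast
      ring
    have h3 : ∫ x, (ζ x : ℂ) ∂halfLine = I := by
      rw [hI, ← integral_complex_ofReal]
      have h4 := halfLineTest.setIntegral_eq (f := fun _ => 1) (halfLineTest.ofReal hζ1 hζ2 hζ3)
      simpa using h4
    simp_rw [mul_sub]
    rw [integral_sub (hint ζ hζ1.continuous hζ2)
      ((halfLineTest.integrable (halfLineTest.ofReal hζ1 hζ2 hζ3)).mul_const c),
      integral_mul_const, h3, ← h2, h1]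
  filter_upwards [h0] with x hx
  simpa [sub_eq_zero] using hx

/-- This identifies φ as the weak derivative of its primitive. The primitive need not lie in L², so
`IsWeakDerivC` cannot express it. -/
theorem integral_deriv_mul_halfPrim {η : ℝ → ℂ} (hη : η ∈ halfLineTest) (φ : HalfLineC) :
    ∫ x, deriv η x * halfPrim φ x ∂halfLine = -∫ x, η x * φ x ∂halfLine := by
  obtain ⟨q, hq⟩ := hη.2.1.isCompact.bddAbove
  set R := max q 0 + 1 with hR
  have hR0 : 0 < R := by positivity
  have hout : ∀ x, R ≤ x → η x = 0 := fun x hx => image_eq_zero_of_notMem_tsupport fun hm => by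
    have := hq hm
    have h2 := le_max_left q 0
    linarith
  have hout' : ∀ x, R ≤ x → deriv η x = 0 := fun x hx => by
    refine image_eq_zero_of_notMem_tsupport (f := deriv η) fun hm => ?_
    have := hq (closure_minimal (support_deriv_subset) (isClosed_tsupport η) hm)
    have h2 := le_max_left q 0
    linarith
  have hηd := halfLineTest.deriv_mem hη
  have hprim : ∀ x, 0 ≤ x → halfPrim (deriv η) x = η x := by
    intro x hx
    rw [halfPrim, ← intervalIntegral.integral_of_le hx,
      intervalIntegral.integral_deriv_eq_sub
        (fun y _ => (hη.1.differentiable (by norm_num)).differentiableAt)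
        ((halfLineTest.continuous hηd).intervalIntegrable _ _),
      halfLineTest.eq_zero_of_nonpos hη le_rfl, sub_zero]
  have hcut : ∀ f : ℝ → ℂ, (∀ x, R ≤ x → f x = 0) →
      ∫ x, f x ∂halfLine = ∫ x in Ioc 0 R, f x := fun f hf =>
    (setIntegral_eq_of_subset_of_forall_sdiff_eq_zero measurableSet_Ioi Ioc_subset_Ioi_self
      fun x hx => hf x (le_of_lt (by
        by_contra h
        exact hx.2 ⟨hx.1, not_lt.1 h⟩)))
  have key := integral_halfPrim_mul (f := deriv η) (g := φ) (R := R)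
    ((halfLineTest.integrable_volume hηd).integrableOn) (halfLineC_integrableOn φ R)
  rw [hprim R hR0.le, hout R le_rfl, zero_mul] at key
  rw [hcut (fun x => deriv η x * halfPrim φ x) fun x hx => by simp [hout' x hx],
    hcut (fun x => η x * φ x) fun x hx => by simp [hout x hx],
    eq_neg_iff_add_eq_zero, ← key]
  congr 1
  exact setIntegral_congr_fun measurableSet_Ioc fun x hx => by simp only [hprim x hx.1.le]

namespace IsWeakDerivC

variable {ψ φ : HalfLineC}

/-- The difference of ψ and the primitive of φ has vanishing weak derivative, hence is constant. -/
theorem exists_ae_eq (h : IsWeakDerivC ψ φ) :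
    ∃ α, ψ =ᵐ[halfLine] fun x => α + halfPrim φ x := by
  have hl1 : LocallyIntegrable ψ halfLine := (Lp.memLp ψ).locallyIntegrable (by norm_num)
  have hl2 : LocallyIntegrable (halfPrim φ) halfLine := (continuous_halfPrim φ).locallyIntegrable
  obtain ⟨c, hc⟩ := exists_ae_eq_const_of_weakDeriv_zero (hl1.sub hl2) fun η h1 h2 h3 => by
    have hη := halfLineTest.ofReal h1 h2 h3
    have hd : deriv (fun x => (η x : ℂ)) = fun x => ((deriv η x : ℝ) : ℂ) := funext fun x =>
      ((h1.differentiable (by norm_num)).differentiableAt.hasDerivAt.ofReal_comp).deriv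
    have h4 := integral_deriv_mul_halfPrim hη φ
    rw [hd] at h4
    have hd' := halfLineTest.deriv_mem hη
    rw [hd] at hd'
    simp only [Pi.sub_apply, mul_sub]
    rw [integral_sub, h η h1 h2 h3, h4, sub_self]
    · exact halfLineC_integrable_mul (halfLineTest.memLp hd') (Lp.memLp ψ)
    · exact hl2.integrable_smul_left_of_hasCompactSupport (halfLineTest.continuous hd') hd'.2.1
  refine ⟨c, ?_⟩
  filter_upwards [hc] with x hx
  rw [← hx]
  simp

theorem exists_boundaryValue (h : IsWeakDerivC ψ φ) : ∃ a, HasBoundaryValueC ψ a := by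
  obtain ⟨α, hα⟩ := h.exists_ae_eq
  exact ⟨_, fun x => α + halfPrim φ x,
    (continuous_const.add (continuous_halfPrim φ)).continuousOn, hα.symm, rfl⟩

/-- Two continuous representatives agree on all of [0, ∞), so the integration constant is the
boundary value. -/
theorem ae_eq (h : IsWeakDerivC ψ φ) {a : ℂ} (ha : HasBoundaryValueC ψ a) :
    ψ =ᵐ[halfLine] fun x => a + halfPrim φ x := by
  obtain ⟨α, hα⟩ := h.exists_ae_eq
  obtain ⟨u, hu, huψ, rfl⟩ := ha
  have h1 : u =ᵐ[volume.restrict (Ici 0)] fun x => α + halfPrim φ x := by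
    rw [Measure.restrict_congr_set Ioi_ae_eq_Ici.symm]
    exact huψ.trans hα
  have h2 : EqOn u (fun x => α + halfPrim φ x) (Ici 0) :=
    Measure.eqOn_of_ae_eq h1 hu (continuous_const.add (continuous_halfPrim φ)).continuousOn
      (by rw [interior_Ici, closure_Ioi])
  have h3 : u 0 = α := by
    rw [h2 self_mem_Ici]
    simp [halfPrim_of_nonpos]
  rw [h3]
  exact hα

end IsWeakDerivC

theorem halfPrim_conj (f : ℝ → ℂ) (x : ℝ) :
    halfPrim (fun t => (starRingEnd ℂ) (f t)) x = (starRingEnd ℂ) (halfPrim f x) :=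
  integral_conj

/-- Green's formula on the half line. -/
theorem IsWeakDerivC.green {ψ₁ φ₁ ψ₂ φ₂ : HalfLineC} (h₁ : IsWeakDerivC ψ₁ φ₁)
    (h₂ : IsWeakDerivC ψ₂ φ₂) {a₁ a₂ : ℂ} (ha₁ : HasBoundaryValueC ψ₁ a₁)
    (ha₂ : HasBoundaryValueC ψ₂ a₂) :
    ⟪φ₁, ψ₂⟫_ℂ + ⟪ψ₁, φ₂⟫_ℂ = -((starRingEnd ℂ) a₁ * a₂) := by
  set cj := starRingEnd ℂ
  have e₁ := h₁.ae_eq ha₁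
  have e₂ := h₂.ae_eq ha₂
  have hcm : ∀ f : HalfLineC, MemLp (fun x => cj (f x)) 2 halfLine := fun f =>
    (Lp.memLp f).star
  have hi1 : Integrable (fun x => cj (φ₁ x) * (a₂ + halfPrim φ₂ x)) halfLine :=
    (halfLineC_integrable_mul (hcm φ₁) (Lp.memLp ψ₂)).congr (e₂.mono fun x hx => by simp only [hx])
  have hi2 : Integrable (fun x => (cj a₁ + cj (halfPrim φ₁ x)) * φ₂ x) halfLine :=
    (halfLineC_integrable_mul (hcm ψ₁) (Lp.memLp φ₂)).congr
      (e₁.mono fun x hx => by simp only [hx, map_add])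
  have hi3 : Integrable (fun x => (cj a₁ + cj (halfPrim φ₁ x)) * (a₂ + halfPrim φ₂ x)) halfLine := by
    refine (halfLineC_integrable_mul (hcm ψ₁) (Lp.memLp ψ₂)).congr ?_
    filter_upwards [e₁, e₂] with x h1 h2
    rw [h1, h2, map_add]
  have hI1 : ⟪φ₁, ψ₂⟫_ℂ = ∫ x, cj (φ₁ x) * (a₂ + halfPrim φ₂ x) ∂halfLine := by
    rw [halfLineC_inner]
    exact integral_congr_ae (e₂.mono fun x hx => by simp only [hx, cj])
  have hI2 : ⟪ψ₁, φ₂⟫_ℂ = ∫ x, (cj a₁ + cj (halfPrim φ₁ x)) * φ₂ x ∂halfLine := by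
    rw [halfLineC_inner]
    exact integral_congr_ae (e₁.mono fun x hx => by simp only [hx, map_add, cj])
  -- The formula on (0, R], where the boundary term at R still appears.
  have hcut : ∀ R, 0 ≤ R → (∫ x in (0 : ℝ)..R, cj (φ₁ x) * (a₂ + halfPrim φ₂ x)) +
      (∫ x in (0 : ℝ)..R, (cj a₁ + cj (halfPrim φ₁ x)) * φ₂ x) =
      (cj a₁ + cj (halfPrim φ₁ R)) * (a₂ + halfPrim φ₂ R) - cj a₁ * a₂ := by
    intro R hR
    rw [intervalIntegral.integral_of_le hR, intervalIntegral.integral_of_le hR]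
    have hc1 : IntegrableOn (fun x => cj (φ₁ x)) (Ioc 0 R) :=
      Integrable.mono (halfLineC_integrableOn φ₁ R)
        (RCLike.continuous_conj.comp_aestronglyMeasurable
          (halfLineC_integrableOn φ₁ R).aestronglyMeasurable) (ae_of_all _ fun x => by simp [cj])
    have hc2 := halfLineC_integrableOn φ₂ R
    have key := integral_halfPrim_mul hc1 hc2
    have hcc : ∀ x, halfPrim (fun t => cj (φ₁ t)) x = cj (halfPrim φ₁ x) := halfPrim_conj φ₁
    simp_rw [hcc] at key
    have j1 : IntegrableOn (fun x => cj (φ₁ x) * (a₂ + halfPrim φ₂ x)) (Ioc 0 R) :=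
      IntegrableOn.mono_set (t := Ioi 0) hi1 Ioc_subset_Ioi_self
    have j2 : IntegrableOn (fun x => (cj a₁ + cj (halfPrim φ₁ x)) * φ₂ x) (Ioc 0 R) :=
      IntegrableOn.mono_set (t := Ioi 0) hi2 Ioc_subset_Ioi_self
    have k1 : ∫ x in Ioc 0 R, cj (φ₁ x) * halfPrim φ₂ x =
        (∫ x in Ioc 0 R, cj (φ₁ x) * (a₂ + halfPrim φ₂ x)) - cj (halfPrim φ₁ R) * a₂ := by
      rw [← hcc R, halfPrim, ← integral_mul_const, ← integral_sub j1 (hc1.mul_const a₂)]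
      exact integral_congr_ae (ae_of_all _ fun x => by ring)
    have k2 : ∫ x in Ioc 0 R, cj (halfPrim φ₁ x) * φ₂ x =
        (∫ x in Ioc 0 R, (cj a₁ + cj (halfPrim φ₁ x)) * φ₂ x) - cj a₁ * halfPrim φ₂ R := by
      rw [halfPrim, ← integral_const_mul, ← integral_sub j2 (hc2.const_mul (cj a₁))]
      exact integral_congr_ae (ae_of_all _ fun x => by ring)
    rw [k1, k2] at key
    linear_combination key
  have hlim : Tendsto (fun R => (cj a₁ + cj (halfPrim φ₁ R)) * (a₂ + halfPrim φ₂ R)) atTop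
      (𝓝 (⟪φ₁, ψ₂⟫_ℂ + ⟪ψ₁, φ₂⟫_ℂ + cj a₁ * a₂)) := by
    rw [hI1, hI2]
    refine (((intervalIntegral_tendsto_integral_Ioi 0 hi1 tendsto_id).add
      (intervalIntegral_tendsto_integral_Ioi 0 hi2 tendsto_id)).add_const (cj a₁ * a₂)).congr' ?_
    filter_upwards [eventually_ge_atTop 0] with R hR
    simp only [id]
    rw [hcut R hR, sub_add_cancel]
  -- The boundary term at R is a product of L² functions, hence integrable, and it has a limit; the
  -- limit of an integrable function at infinity can only be zero.
  have h0 := IntegrableAtFilter.eq_zero_of_tendsto (μ := halfLine) (hi3.integrableAtFilter atTop)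
    (fun s hs => by
      obtain ⟨b, hb⟩ := mem_atTop_sets.1 hs
      refine top_le_iff.1 ?_
      calc (⊤ : ENNReal) = volume (Ioi (max b 0)) := by simp
        _ = halfLine (Ioi (max b 0)) := by
          rw [Measure.restrict_apply measurableSet_Ioi, inter_eq_self_of_subset_left
            (Ioi_subset_Ioi (le_max_right b 0))]
        _ ≤ halfLine s := measure_mono fun x hx => hb x ((le_max_left b 0).trans (le_of_lt hx)))
    hlim
  exact eq_neg_of_add_eq_zero_left h0

theorem IsWeakDerivC.add {ψ₁ ψ₂ φ₁ φ₂ : HalfLineC} (h₁ : IsWeakDerivC ψ₁ φ₁)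
    (h₂ : IsWeakDerivC ψ₂ φ₂) : IsWeakDerivC (ψ₁ + ψ₂) (φ₁ + φ₂) := by
  intro η hη hc hs
  have hm := halfLineTest.memLp (halfLineTest.ofReal hη hc hs)
  have hd : MemLp (fun x => ((deriv η x : ℝ) : ℂ)) 2 halfLine :=
    (Complex.continuous_ofReal.comp (hη.continuous_deriv (by simp))).memLp_of_hasCompactSupport
      (hc.deriv.comp_left (g := fun r : ℝ => (r : ℂ)) (by simp))
  have e : ∀ {f : ℝ → ℂ}, MemLp f 2 halfLine → ∀ u v : HalfLineC,
      ∫ x, f x * (u + v : HalfLineC) x ∂halfLine =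
        (∫ x, f x * u x ∂halfLine) + ∫ x, f x * v x ∂halfLine := by
    intro f hf u v
    rw [← integral_add (halfLineC_integrable_mul hf (Lp.memLp u))
      (halfLineC_integrable_mul hf (Lp.memLp v))]
    refine integral_congr_ae ?_
    filter_upwards [Lp.coeFn_add u v] with x hx
    rw [hx, Pi.add_apply, mul_add]
  rw [e hd, e hm, h₁ η hη hc hs, h₂ η hη hc hs]
  abel

theorem IsWeakDerivC.const_smul {ψ φ : HalfLineC} (c : ℂ) (h : IsWeakDerivC ψ φ) :
    IsWeakDerivC (c • ψ) (c • φ) := by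
  intro η hη hc hs
  have e : ∀ (f : ℝ → ℂ) (u : HalfLineC),
      ∫ x, f x * (c • u : HalfLineC) x ∂halfLine = c * ∫ x, f x * u x ∂halfLine := by
    intro f u
    rw [← integral_const_mul]
    refine integral_congr_ae ?_
    filter_upwards [Lp.coeFn_smul c u] with x hx
    rw [hx, Pi.smul_apply, smul_eq_mul, mul_left_comm]
  rw [e, e, h η hη hc hs, mul_neg]

theorem HasBoundaryValueC.add {ψ φ : HalfLineC} {a b : ℂ} (hψ : HasBoundaryValueC ψ a)
    (hφ : HasBoundaryValueC φ b) : HasBoundaryValueC (ψ + φ) (a + b) := by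
  obtain ⟨u, hu, huψ, rfl⟩ := hψ
  obtain ⟨v, hv, hvφ, rfl⟩ := hφ
  exact ⟨u + v, hu.add hv, (huψ.add hvφ).trans (Lp.coeFn_add ψ φ).symm, rfl⟩

theorem HasBoundaryValueC.const_smul {ψ : HalfLineC} {a : ℂ} (c : ℂ)
    (hψ : HasBoundaryValueC ψ a) : HasBoundaryValueC (c • ψ) (c * a) := by
  obtain ⟨u, hu, huψ, rfl⟩ := hψ
  exact ⟨c • u, hu.const_smul c, (huψ.const_smul c).trans (Lp.coeFn_smul c ψ).symm, rfl⟩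

/-! ### The transforms and differentiation -/

/-- `g₁(k) = k g(k)`. -/
def IsMulVar (g g₁ : HalfLineC) : Prop := g₁ =ᵐ[halfLine] fun k => (k : ℂ) * g k

theorem IsMulVar.mulOp {g g₁ : HalfLineC} (h : IsMulVar g g₁) {m : ℝ → ℂ} (hm : IsBddMeasurable m) :
    IsMulVar (mulOp m g) (mulOp m g₁) := by
  unfold IsMulVar at *
  filter_upwards [h, mulOp_ae hm g, mulOp_ae hm g₁] with k h1 h2 h3
  rw [h3, h1, h2, mul_left_comm]

/-- The arithmetic-geometric mean inequality bounds |g| by (1 + k²)⁻¹ + (1 + k²)|g|². Integrability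
makes the transforms of g continuous up to 0, with explicit boundary values. -/
theorem IsMulVar.integrable {g g₁ : HalfLineC} (h : IsMulVar g g₁) : Integrable g halfLine := by
  have h1 : Integrable (fun k : ℝ => (1 + k ^ 2)⁻¹ + (‖g k‖ ^ 2 + ‖g₁ k‖ ^ 2)) halfLine := by
    refine (integrable_inv_one_add_sq.restrict).add (Integrable.add ?_ ?_)
    · exact (Lp.memLp g).integrable_norm_pow (by norm_num)
    · exact (Lp.memLp g₁).integrable_norm_pow (by norm_num)
  refine h1.mono' (Lp.memLp g).1 ?_
  filter_upwards [h] with k hk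
  rw [hk, norm_mul, Complex.norm_real, mul_pow, Real.norm_eq_abs, sq_abs]
  have h2 : (0 : ℝ) < 1 + k ^ 2 := by positivity
  have h3 : ‖g k‖ = (1 + k ^ 2)⁻¹ * ((1 + k ^ 2) * ‖g k‖) := by field_simp
  have h4 : (1 + k ^ 2)⁻¹ * (1 + k ^ 2) = 1 := inv_mul_cancel₀ h2.ne'
  have h5 : 0 < (1 + k ^ 2)⁻¹ := by positivity
  nlinarith [mul_nonneg h5.le (sq_nonneg (1 - (1 + k ^ 2) * ‖g k‖)), sq_nonneg ‖g k‖,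
    mul_nonneg h2.le (sq_nonneg ‖g k‖)]

theorem halfLineTest.integral_deriv_mul {η : ℝ → ℂ} (hη : η ∈ halfLineTest) {f f' : ℝ → ℂ}
    (hf : ∀ x, HasDerivAt f (f' x) x) (hf' : Continuous f') :
    ∫ x, f x * deriv η x ∂halfLine = -∫ x, f' x * η x ∂halfLine := by
  have hd := halfLineTest.deriv_mem hη
  have hfc : Continuous f := continuous_iff_continuousAt.2 fun x => (hf x).continuousAt
  rw [halfLineTest.setIntegral_eq hd, halfLineTest.setIntegral_eq hη]
  refine integral_mul_deriv_eq_deriv_mul_of_integrable (fun x _ => hf x)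
    (fun x _ => (hη.1.differentiable (by norm_num)).differentiableAt.hasDerivAt) ?_ ?_ ?_
  · exact (hfc.mul (halfLineTest.continuous hd)).integrable_of_hasCompactSupport
      (hd.2.1.mul_left)
  · exact (hf'.mul (halfLineTest.continuous hη)).integrable_of_hasCompactSupport
      (hη.2.1.mul_left)
  · exact (hfc.mul (halfLineTest.continuous hη)).integrable_of_hasCompactSupport
      (hη.2.1.mul_left)

/-- The derivative of a test function as a test function. -/
noncomputable def halfLineTest.derivTest (η : halfLineTest) : halfLineTest :=
  ⟨deriv η, halfLineTest.deriv_mem η.2⟩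

theorem halfLineTest.integrable_toL2 (η : halfLineTest) :
    Integrable (halfLineTest.toL2 η) halfLine :=
  (halfLineTest.integrable η.2).congr (halfLineTest.coe_toL2 η).symm

theorem halfLineTest.cosT_ae (η : halfLineTest) : cosT (halfLineTest.toL2 η) =ᵐ[halfLine]
    fun k => ∫ x, (cosKernel k x : ℂ) * (η : ℝ → ℂ) x ∂halfLine := by
  filter_upwards [_root_.cosT_ae (halfLineTest.integrable_toL2 η)] with k hk
  rw [hk]
  exact integral_congr_ae ((halfLineTest.coe_toL2 η).mono fun x hx => by simp only [hx])

theorem halfLineTest.sinT_ae (η : halfLineTest) : sinT (halfLineTest.toL2 η) =ᵐ[halfLine]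
    fun k => ∫ x, (sinKernel k x : ℂ) * (η : ℝ → ℂ) x ∂halfLine := by
  filter_upwards [_root_.sinT_ae (halfLineTest.integrable_toL2 η)] with k hk
  rw [hk]
  exact integral_congr_ae ((halfLineTest.coe_toL2 η).mono fun x hx => by simp only [hx])

theorem hasDerivAt_cosKernel (k x : ℝ) :
    HasDerivAt (fun x => (cosKernel k x : ℂ)) (-(k * sinKernel k x : ℂ)) x := by
  have h : HasDerivAt (fun x => cosKernel k x) (Real.sqrt (2 / Real.pi) *
      (-Real.sin (k * x) * (k * 1))) x :=
    (((hasDerivAt_id x).const_mul k).cos).const_mul _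
  convert h.ofReal_comp using 1
  rw [sinKernel]
  push_cast
  ring

theorem hasDerivAt_sinKernel (k x : ℝ) :
    HasDerivAt (fun x => (sinKernel k x : ℂ)) (k * cosKernel k x : ℂ) x := by
  have h : HasDerivAt (fun x => sinKernel k x) (Real.sqrt (2 / Real.pi) *
      (Real.cos (k * x) * (k * 1))) x :=
    (((hasDerivAt_id x).const_mul k).sin).const_mul _
  convert h.ofReal_comp using 1
  rw [cosKernel]
  push_cast
  ring

/-- Integration by parts exchanges the two transforms; there is no boundary term because η is
supported away from 0. -/
theorem cosT_derivTest (η : halfLineTest) : IsMulVar (sinT (halfLineTest.toL2 η))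
    (cosT (halfLineTest.toL2 (halfLineTest.derivTest η))) := by
  unfold IsMulVar
  filter_upwards [halfLineTest.sinT_ae η, halfLineTest.cosT_ae (halfLineTest.derivTest η)] with k h1 h2
  rw [h1, h2]
  have h3 := halfLineTest.integral_deriv_mul η.2 (hasDerivAt_cosKernel k)
    (by unfold sinKernel; fun_prop)
  refine h3.trans ?_
  rw [← integral_const_mul, ← integral_neg]
  exact integral_congr_ae (ae_of_all _ fun x => by ring)

theorem sinT_derivTest (η : halfLineTest) : IsMulVar (-cosT (halfLineTest.toL2 η))
    (sinT (halfLineTest.toL2 (halfLineTest.derivTest η))) := by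
  unfold IsMulVar
  filter_upwards [halfLineTest.cosT_ae η, halfLineTest.sinT_ae (halfLineTest.derivTest η), Lp.coeFn_neg (cosT (halfLineTest.toL2 η))]
    with k h1 h2 h0
  rw [h0, Pi.neg_apply, h1, h2]
  have h3 := halfLineTest.integral_deriv_mul η.2 (hasDerivAt_sinKernel k)
    (by unfold cosKernel; fun_prop)
  refine h3.trans ?_
  rw [mul_neg, ← integral_const_mul]
  congr 1
  exact integral_congr_ae (ae_of_all _ fun x => by ring)

theorem IsMulVar.inner_comm {f f₁ g g₁ : HalfLineC} (hf : IsMulVar f f₁) (hg : IsMulVar g g₁) :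
    ⟪f₁, g⟫_ℂ = ⟪f, g₁⟫_ℂ := by
  rw [halfLineC_inner, halfLineC_inner]
  refine integral_congr_ae ?_
  filter_upwards [hf, hg] with k h1 h2
  rw [h1, h2]
  simp
  ring

theorem IsWeakDerivC.of_inner {ψ φ : HalfLineC} (h : ∀ η : halfLineTest,
    ⟪halfLineTest.toL2 (halfLineTest.derivTest η), ψ⟫_ℂ = -⟪halfLineTest.toL2 η, φ⟫_ℂ) : IsWeakDerivC ψ φ := by
  intro η h1 h2 h3
  have hη := halfLineTest.ofReal h1 h2 h3
  have hd : deriv (fun x => (η x : ℂ)) = fun x => ((deriv η x : ℝ) : ℂ) := funext fun x =>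
    ((h1.differentiable (by norm_num)).differentiableAt.hasDerivAt.ofReal_comp).deriv
  have h4 := h ⟨_, hη⟩
  rw [halfLineC_inner, halfLineC_inner] at h4
  calc ∫ x, ((deriv η x : ℝ) : ℂ) * ψ x ∂halfLine = _ := ?_
    _ = _ := h4
    _ = _ := ?_
  · refine integral_congr_ae ?_
    filter_upwards [halfLineTest.coe_toL2 (halfLineTest.derivTest ⟨_, hη⟩)] with x hx
    rw [hx, halfLineTest.derivTest]
    simp only [hd, Complex.conj_ofReal]
  · congr 1
    refine integral_congr_ae ?_
    filter_upwards [halfLineTest.coe_toL2 ⟨_, hη⟩] with x hx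
    rw [hx]
    simp only [Complex.conj_ofReal]

/-- By duality: both transforms are symmetric, so differentiating the transform of g reduces to
transforming the derivative of a test function. -/
theorem IsMulVar.isWeakDerivC_cosT {g g₁ : HalfLineC} (h : IsMulVar g g₁) :
    IsWeakDerivC (cosT g) (-sinT g₁) :=
  .of_inner fun η => by
    rw [← cosT_inner, (cosT_derivTest η).inner_comm h, sinT_inner, inner_neg_right, neg_neg]

theorem IsMulVar.isWeakDerivC_sinT {g g₁ : HalfLineC} (h : IsMulVar g g₁) :
    IsWeakDerivC (sinT g) (cosT g₁) :=
  .of_inner fun η => by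
    rw [← sinT_inner, (sinT_derivTest η).inner_comm h, inner_neg_left, cosT_inner]

theorem continuous_kernel_integral {κ : ℝ → ℝ → ℝ} (hκ : Continuous (Function.uncurry κ)) {M : ℝ}
    (hb : ∀ k x, |κ k x| ≤ M) {ψ : ℝ → ℂ} (hψ : Integrable ψ halfLine) :
    Continuous fun k => ∫ x, (κ k x : ℂ) * ψ x ∂halfLine := by
  refine continuous_of_dominated (bound := fun x => M * ‖ψ x‖)
    (fun k => (integrable_kernel_mul hκ hb hψ k).1) (fun k => ae_of_all _ fun x => ?_)
    (hψ.norm.const_mul M) (ae_of_all _ fun x => ?_)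
  · rw [norm_mul]
    gcongr
    simpa using hb k x
  · exact (Complex.continuous_ofReal.comp
      (hκ.comp (by fun_prop : Continuous fun k => (k, x)))).mul continuous_const

theorem hasBoundaryValueC_cosT {g : HalfLineC} (h : Integrable g halfLine) :
    HasBoundaryValueC (cosT g) (Real.sqrt (2 / Real.pi) * ∫ k, g k ∂halfLine) :=
  ⟨_, (continuous_kernel_integral continuous_cosKernel abs_cosKernel_le h).continuousOn,
    (cosT_ae h).symm, by simp only [cosKernel, zero_mul, Real.cos_zero, mul_one, integral_const_mul]⟩

theorem hasBoundaryValueC_sinT {g : HalfLineC} (h : Integrable g halfLine) :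
    HasBoundaryValueC (sinT g) 0 :=
  ⟨_, (continuous_kernel_integral continuous_sinKernel abs_sinKernel_le h).continuousOn,
    (sinT_ae h).symm, by simp [sinKernel]⟩

/-! ### The scalar problem with boundary condition `a ψ'(0) = b ψ(0)` -/

/-- `√(b² + a² k²)`, the modulus of the scalar Jost function. -/
noncomputable def jostAbs (a b k : ℝ) : ℝ := Real.sqrt (b ^ 2 + a ^ 2 * k ^ 2)

theorem sq_jostAbs (a b k : ℝ) : jostAbs a b k ^ 2 = b ^ 2 + a ^ 2 * k ^ 2 :=
  Real.sq_sqrt (by positivity)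

theorem jostAbs_nonneg (a b k : ℝ) : 0 ≤ jostAbs a b k := Real.sqrt_nonneg _

theorem jostAbs_pos {a b : ℝ} (hab : a ≠ 0 ∨ b ≠ 0) {k : ℝ} (hk : 0 < k) : 0 < jostAbs a b k := by
  refine Real.sqrt_pos.2 ?_
  rcases hab with h | h <;> positivity

theorem continuous_jostAbs (a b : ℝ) : Continuous (jostAbs a b) := by
  unfold jostAbs; fun_prop

theorem abs_le_jostAbs (a b k : ℝ) : |b| ≤ jostAbs a b k :=
  Real.abs_le_sqrt (by nlinarith [mul_nonneg (sq_nonneg a) (sq_nonneg k)])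

theorem abs_mul_le_jostAbs (a b k : ℝ) : |a * k| ≤ jostAbs a b k :=
  Real.abs_le_sqrt (by nlinarith [sq_nonneg b])

/-- The coefficient of the cosine transform in the spectral representation. -/
noncomputable def cosCoef (a b k : ℝ) : ℂ := ((a * k / jostAbs a b k : ℝ) : ℂ)

/-- The coefficient of the sine transform in the spectral representation. -/
noncomputable def sinCoef (a b k : ℝ) : ℂ := ((b / jostAbs a b k : ℝ) : ℂ)

theorem cosCoef_bdd (a b : ℝ) : IsBddMeasurable (cosCoef a b) := by
  refine ⟨?_, 1, fun k => ?_⟩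
  · have := (continuous_jostAbs a b).measurable
    unfold cosCoef
    fun_prop
  · rw [cosCoef, Complex.norm_real, Real.norm_eq_abs, abs_div, abs_of_nonneg (jostAbs_nonneg a b k)]
    exact div_le_one_of_le₀ (abs_mul_le_jostAbs a b k) (jostAbs_nonneg a b k)

theorem sinCoef_bdd (a b : ℝ) : IsBddMeasurable (sinCoef a b) := by
  refine ⟨?_, 1, fun k => ?_⟩
  · have := (continuous_jostAbs a b).measurable
    unfold sinCoef
    fun_prop
  · rw [sinCoef, Complex.norm_real, Real.norm_eq_abs, abs_div, abs_of_nonneg (jostAbs_nonneg a b k)]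
    exact div_le_one_of_le₀ (abs_le_jostAbs a b k) (jostAbs_nonneg a b k)

theorem conj_cosCoef (a b k : ℝ) : (starRingEnd ℂ) (cosCoef a b k) = cosCoef a b k :=
  Complex.conj_ofReal _

theorem conj_sinCoef (a b k : ℝ) : (starRingEnd ℂ) (sinCoef a b k) = sinCoef a b k :=
  Complex.conj_ofReal _

theorem cosCoef_sq_add_sinCoef_sq {a b : ℝ} (hab : a ≠ 0 ∨ b ≠ 0) {k : ℝ} (hk : 0 < k) :
    cosCoef a b k * cosCoef a b k + sinCoef a b k * sinCoef a b k = 1 := by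
  have h := jostAbs_pos hab hk
  have h2 := sq_jostAbs a b k
  rw [cosCoef, sinCoef]
  norm_cast
  field_simp
  linarith

/-- The spectral representation of the scalar problem. -/
noncomputable def robinG (a b : ℝ) : HalfLineC →L[ℂ] HalfLineC :=
  mulOp (cosCoef a b) ∘L cosT + mulOp (sinCoef a b) ∘L sinT

/-- The adjoint of the spectral representation. -/
noncomputable def robinGAdj (a b : ℝ) : HalfLineC →L[ℂ] HalfLineC :=
  cosT ∘L mulOp (cosCoef a b) + sinT ∘L mulOp (sinCoef a b)

theorem robinG_apply (a b : ℝ) (f : HalfLineC) :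
    robinG a b f = mulOp (cosCoef a b) (cosT f) + mulOp (sinCoef a b) (sinT f) := rfl

theorem robinGAdj_apply (a b : ℝ) (f : HalfLineC) :
    robinGAdj a b f = cosT (mulOp (cosCoef a b) f) + sinT (mulOp (sinCoef a b) f) := rfl

theorem mulOp_inner_real {m : ℝ → ℂ} (h : IsBddMeasurable m)
    (hr : ∀ x, (starRingEnd ℂ) (m x) = m x) (f g : HalfLineC) :
    ⟪mulOp m f, g⟫_ℂ = ⟪f, mulOp m g⟫_ℂ := by
  rw [← mulOp_inner h]
  simp_rw [hr]

theorem robinGAdj_inner (a b : ℝ) (f g : HalfLineC) :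
    ⟪robinGAdj a b f, g⟫_ℂ = ⟪f, robinG a b g⟫_ℂ := by
  rw [robinG_apply, robinGAdj_apply, inner_add_left, inner_add_right, cosT_inner, sinT_inner,
    mulOp_inner_real (cosCoef_bdd a b) (conj_cosCoef a b),
    mulOp_inner_real (sinCoef_bdd a b) (conj_sinCoef a b)]

theorem robinG_inner (a b : ℝ) (f g : HalfLineC) :
    ⟪robinG a b f, g⟫_ℂ = ⟪f, robinGAdj a b g⟫_ℂ := by
  rw [← inner_conj_symm, ← robinGAdj_inner, inner_conj_symm]

/-- If a or b vanishes, so does one coefficient. Otherwise k/r and 1/r are both bounded, and S(f/r),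
S(g/r) have weak derivatives C(kf/r), C(kg/r) and boundary value zero. Green's formula for this
pair, multiplied by ab, is the claim. -/
theorem robin_cross_term (a b : ℝ) (f g : HalfLineC) :
    ⟪f, mulOp (cosCoef a b) (cosT (sinT (mulOp (sinCoef a b) g)))⟫_ℂ +
      ⟪f, mulOp (sinCoef a b) (sinT (cosT (mulOp (cosCoef a b) g)))⟫_ℂ = 0 := by
  by_cases ha : a = 0
  · have : cosCoef a b = fun _ => 0 := funext fun k => by simp [cosCoef, ha]
    rw [this, mulOp_const, mulOp_const]
    simp
  by_cases hb : b = 0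
  · have : sinCoef a b = fun _ => 0 := funext fun k => by simp [sinCoef, hb]
    rw [this, mulOp_const, mulOp_const]
    simp
  have hmr := (continuous_jostAbs a b).measurable
  have h1 : IsBddMeasurable fun k => (((jostAbs a b k)⁻¹ : ℝ) : ℂ) := by
    refine ⟨by fun_prop, |b|⁻¹, fun k => ?_⟩
    rw [Complex.norm_real, Real.norm_eq_abs, abs_inv, abs_of_nonneg (jostAbs_nonneg a b k)]
    exact inv_anti₀ (abs_pos.2 hb) (abs_le_jostAbs a b k)
  have h2 : IsBddMeasurable fun k => ((k / jostAbs a b k : ℝ) : ℂ) := by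
    refine ⟨by fun_prop, |a|⁻¹, fun k => ?_⟩
    rw [Complex.norm_real, Real.norm_eq_abs, abs_div, abs_of_nonneg (jostAbs_nonneg a b k)]
    refine div_le_of_le_mul₀ (jostAbs_nonneg a b k) (by positivity) ?_
    rw [inv_mul_eq_div, le_div_iff₀ (abs_pos.2 ha), mul_comm, ← abs_mul]
    exact abs_mul_le_jostAbs a b k
  have hv : ∀ w, IsMulVar (mulOp (fun k => (((jostAbs a b k)⁻¹ : ℝ) : ℂ)) w)
      (mulOp (fun k => ((k / jostAbs a b k : ℝ) : ℂ)) w) := by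
    intro w
    unfold IsMulVar
    filter_upwards [mulOp_ae h1 w, mulOp_ae h2 w] with k e1 e2
    rw [e1, e2]
    push_cast
    ring
  have hc : ∀ w, mulOp (cosCoef a b) w =
      (a : ℂ) • mulOp (fun k => ((k / jostAbs a b k : ℝ) : ℂ)) w := by
    intro w
    rw [← mulOp_const, mulOp_mulOp (.const _) h2]
    congr 2
    funext k
    rw [cosCoef]
    push_cast
    ring
  have hs : ∀ w, mulOp (sinCoef a b) w =
      (b : ℂ) • mulOp (fun k => (((jostAbs a b k)⁻¹ : ℝ) : ℂ)) w := by
    intro w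
    rw [← mulOp_const, mulOp_mulOp (.const _) h1]
    congr 2
    funext k
    rw [sinCoef]
    push_cast
    ring
  rw [← mulOp_inner_real (cosCoef_bdd a b) (conj_cosCoef a b),
    ← mulOp_inner_real (sinCoef_bdd a b) (conj_sinCoef a b), hc, hc, hs, hs]
  have key := (hv f).isWeakDerivC_sinT.green (hv g).isWeakDerivC_sinT
    (hasBoundaryValueC_sinT (hv f).integrable) (hasBoundaryValueC_sinT (hv g).integrable)
  rw [cosT_inner, sinT_inner] at key
  simp only [map_smul, inner_smul_left, inner_smul_right, Complex.conj_ofReal]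
  rw [map_zero, zero_mul, neg_zero] at key
  linear_combination (a * b : ℂ) * key

/-- Expanding the product, the diagonal terms give c² + s² = 1 since both transforms are
involutions, and the off-diagonal ones cancel by `robin_cross_term`. -/
theorem robinG_robinGAdj {a b : ℝ} (hab : a ≠ 0 ∨ b ≠ 0) (g : HalfLineC) :
    robinG a b (robinGAdj a b g) = g := by
  refine ext_inner_left ℂ fun f => ?_
  have key := robin_cross_term a b f g
  have hc := cosCoef_bdd a b
  have hs := sinCoef_bdd a b
  have h1 : mulOp (cosCoef a b) (mulOp (cosCoef a b) g) +
      mulOp (sinCoef a b) (mulOp (sinCoef a b) g) = g := by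
    rw [mulOp_mulOp hc hc, mulOp_mulOp hs hs]
    refine Lp.ext ?_
    filter_upwards [mulOp_ae (hc.mul hc) g, mulOp_ae (hs.mul hs) g,
      Lp.coeFn_add (mulOp (fun x => cosCoef a b x * cosCoef a b x) g)
        (mulOp (fun x => sinCoef a b x * sinCoef a b x) g),
      ae_restrict_mem measurableSet_Ioi] with k e1 e2 e3 e4
    rw [e3, Pi.add_apply, e1, e2, ← add_mul, cosCoef_sq_add_sinCoef_sq hab e4, one_mul]
  rw [robinG_apply, robinGAdj_apply]
  simp only [map_add, cosT_cosT, sinT_sinT, inner_add_right] at key ⊢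
  have h2 := congrArg (fun w => ⟪f, w⟫_ℂ) h1
  simp only [inner_add_right] at h2
  rw [← h2]
  linear_combination key

/-- The projection onto the kernel of the spectral representation. -/
noncomputable def robinP (a b : ℝ) : HalfLineC →L[ℂ] HalfLineC := 1 - robinGAdj a b ∘L robinG a b

theorem robinP_apply (a b : ℝ) (f : HalfLineC) :
    robinP a b f = f - robinGAdj a b (robinG a b f) := rfl

theorem robinG_robinP {a b : ℝ} (hab : a ≠ 0 ∨ b ≠ 0) (f : HalfLineC) :
    robinG a b (robinP a b f) = 0 := by
  rw [robinP_apply, map_sub, robinG_robinGAdj hab, sub_self]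

theorem robinP_robinGAdj {a b : ℝ} (hab : a ≠ 0 ∨ b ≠ 0) (f : HalfLineC) :
    robinP a b (robinGAdj a b f) = 0 := by
  rw [robinP_apply, robinG_robinGAdj hab, sub_self]

theorem robinP_robinP {a b : ℝ} (hab : a ≠ 0 ∨ b ≠ 0) (f : HalfLineC) :
    robinP a b (robinP a b f) = robinP a b f := by
  rw [robinP_apply a b (robinP a b f), robinG_robinP hab, map_zero, sub_zero]

theorem robinP_inner (a b : ℝ) (f g : HalfLineC) :
    ⟪robinP a b f, g⟫_ℂ = ⟪f, robinP a b g⟫_ℂ := by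
  rw [robinP_apply, robinP_apply, inner_sub_left, inner_sub_right, robinGAdj_inner, robinG_inner]

/-! ### The graph of the scalar operator -/

theorem IsWeakDerivC.unique {ψ φ φ' : HalfLineC} (h : IsWeakDerivC ψ φ)
    (h' : IsWeakDerivC ψ φ') : φ = φ' := by
  rw [← sub_eq_zero, Lp.eq_zero_iff_ae_eq_zero]
  refine ae_eq_zero_of_forall_test
    (((Lp.memLp _).locallyIntegrable (by norm_num)).locallyIntegrableOn _) fun η h1 h2 h3 => ?_
  have hm := halfLineTest.memLp (halfLineTest.ofReal h1 h2 h3)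
  have e := (h η h1 h2 h3).symm.trans (h' η h1 h2 h3)
  rw [neg_inj] at e
  rw [← sub_eq_zero, ← integral_sub (halfLineC_integrable_mul hm (Lp.memLp φ))
    (halfLineC_integrable_mul hm (Lp.memLp φ'))] at e
  rw [← e]
  refine integral_congr_ae ?_
  filter_upwards [Lp.coeFn_sub φ φ'] with x hx
  rw [hx, Pi.sub_apply, mul_sub]

/-- `(ψ, χ)` belongs to the graph of `-d²/dx²` with the boundary condition `a ψ'(0) = b ψ(0)`. -/
def IsRobin (a b : ℝ) (ψ χ : HalfLineC) : Prop :=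
  ∃ (dψ ddψ : HalfLineC) (α β : ℂ), IsWeakDerivC ψ dψ ∧ IsWeakDerivC dψ ddψ ∧
    HasBoundaryValueC ψ α ∧ HasBoundaryValueC dψ β ∧ -(b * α) + a * β = 0 ∧ χ = -ddψ

namespace IsRobin

variable {a b : ℝ} {ψ χ ψ' χ' : HalfLineC}

theorem add (h : IsRobin a b ψ χ) (h' : IsRobin a b ψ' χ') : IsRobin a b (ψ + ψ') (χ + χ') := by
  obtain ⟨d₁, e₁, a₁, b₁, h₁, k₁, l₁, m₁, n₁, o₁⟩ := h
  obtain ⟨d₂, e₂, a₂, b₂, h₂, k₂, l₂, m₂, n₂, o₂⟩ := h'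
  refine ⟨d₁ + d₂, e₁ + e₂, a₁ + a₂, b₁ + b₂, h₁.add h₂, k₁.add k₂, l₁.add l₂, m₁.add m₂, ?_, ?_⟩
  · linear_combination n₁ + n₂
  · rw [o₁, o₂, neg_add]

theorem unique (h : IsRobin a b ψ χ) (h' : IsRobin a b ψ χ') : χ = χ' := by
  obtain ⟨d₁, e₁, a₁, b₁, h₁, k₁, l₁, m₁, n₁, o₁⟩ := h
  obtain ⟨d₂, e₂, a₂, b₂, h₂, k₂, l₂, m₂, n₂, o₂⟩ := h'
  obtain rfl := h₁.unique h₂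
  rw [o₁, o₂, k₁.unique k₂]

/-- Two applications of Green's formula leave the Wronskian of the boundary data. It vanishes
because both boundary vectors are complex multiples of the real vector (a, b). -/
theorem inner_comm (hab : a ≠ 0 ∨ b ≠ 0) (h : IsRobin a b ψ χ) (h' : IsRobin a b ψ' χ') :
    ⟪χ, ψ'⟫_ℂ = ⟪ψ, χ'⟫_ℂ := by
  obtain ⟨d₁, e₁, a₁, b₁, h₁, k₁, l₁, m₁, n₁, o₁⟩ := h
  obtain ⟨d₂, e₂, a₂, b₂, h₂, k₂, l₂, m₂, n₂, o₂⟩ := h'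
  have g1 := k₁.green h₂ m₁ l₂
  have g2 := h₁.green k₂ l₁ m₂
  have n₁' := congrArg (starRingEnd ℂ) n₁
  simp only [map_add, map_neg, map_mul, Complex.conj_ofReal, map_zero] at n₁'
  have hb : (starRingEnd ℂ) b₁ * a₂ = (starRingEnd ℂ) a₁ * b₂ := by
    rcases hab with ha | hb
    · have ha' : (a : ℂ) ≠ 0 := by exact_mod_cast ha
      refine mul_left_cancel₀ ha' ?_
      linear_combination a₂ * n₁' - (starRingEnd ℂ) a₁ * n₂
    · have hb' : (b : ℂ) ≠ 0 := by exact_mod_cast hb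
      refine mul_left_cancel₀ hb' ?_
      linear_combination b₂ * n₁' - (starRingEnd ℂ) b₁ * n₂
  rw [o₁, o₂, inner_neg_left, inner_neg_right]
  linear_combination g2 - g1 + hb

end IsRobin

/-- Differentiate under the transforms. Only the cosine parts contribute at 0, and the boundary
condition reduces to the pointwise identity b c = a k s, which is what the choice of coefficients is
for. -/
theorem isRobin_robinGAdj (a b : ℝ) {g g₁ g₂ : HalfLineC} (h : IsMulVar g g₁)
    (h₁ : IsMulVar g₁ g₂) : IsRobin a b (robinGAdj a b g) (robinGAdj a b g₂) := by
  have hc := cosCoef_bdd a b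
  have hs := sinCoef_bdd a b
  refine ⟨-sinT (mulOp (cosCoef a b) g₁) + cosT (mulOp (sinCoef a b) g₁),
    (-1 : ℂ) • cosT (mulOp (cosCoef a b) g₂) + -sinT (mulOp (sinCoef a b) g₂), _,
    (-1 : ℂ) * 0 + Real.sqrt (2 / Real.pi) * ∫ k, mulOp (sinCoef a b) g₁ k ∂halfLine,
    (h.mulOp hc).isWeakDerivC_cosT.add (h.mulOp hs).isWeakDerivC_sinT, ?_,
    (hasBoundaryValueC_cosT (h.mulOp hc).integrable).add
      (hasBoundaryValueC_sinT (h.mulOp hs).integrable), ?_, ?_, ?_⟩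
  · rw [← neg_one_smul ℂ (sinT _)]
    exact ((h₁.mulOp hc).isWeakDerivC_sinT.const_smul (-1)).add (h₁.mulOp hs).isWeakDerivC_cosT
  · rw [← neg_one_smul ℂ (sinT _)]
    exact ((hasBoundaryValueC_sinT (h₁.mulOp hc).integrable).const_smul (-1)).add
      (hasBoundaryValueC_cosT (h₁.mulOp hs).integrable)
  · have e : (b : ℂ) * ∫ k, mulOp (cosCoef a b) g k ∂halfLine =
        a * ∫ k, mulOp (sinCoef a b) g₁ k ∂halfLine := by
      rw [← integral_const_mul, ← integral_const_mul]
      refine integral_congr_ae ?_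
      filter_upwards [mulOp_ae hc g, mulOp_ae hs g₁, h] with k e1 e2 e3
      rw [e1, e2, e3, cosCoef, sinCoef]
      push_cast
      ring
    linear_combination (-(Real.sqrt (2 / Real.pi) : ℂ)) * e
  · rw [robinGAdj_apply, neg_one_smul]
    abel

theorem robinG_eq_zero_of_left_eq_zero {b : ℝ} (hb : b ≠ 0) {f : HalfLineC}
    (h : robinG 0 b f = 0) : f = 0 := by
  have h1 : mulOp (sinCoef 0 b) (sinT f) = 0 := by
    have h2 : cosCoef 0 b = fun _ => 0 := funext fun k => by simp [cosCoef]
    rw [robinG_apply, h2, mulOp_const, zero_smul, zero_add] at h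
    exact h
  have h3 : sinT f = 0 := by
    have h4 : mulOp (sinCoef 0 b) (mulOp (sinCoef 0 b) (sinT f)) = sinT f := by
      have hs := sinCoef_bdd 0 b
      rw [mulOp_mulOp hs hs, mulOp_congr (hs.mul hs) (IsBddMeasurable.const 1) fun k hk => ?_,
        mulOp_const, one_smul]
      have := cosCoef_sq_add_sinCoef_sq (a := 0) (Or.inr hb) hk
      simpa [cosCoef] using this
    rw [← h4, h1, map_zero]
  rw [← sinT_sinT f, h3, map_zero]

/-- Vanishing of Gf means k·Cf = −(b/a)·Sf; applying the inverse transform turns this into f' =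
(b/a) f. Whether a nonzero such f exists in L² never has to be decided. -/
theorem isWeakDerivC_of_robinG_eq_zero {a b : ℝ} (ha : a ≠ 0) {f : HalfLineC}
    (h : robinG a b f = 0) : IsWeakDerivC f (((b / a : ℝ) : ℂ) • f) := by
  have hm : IsMulVar (cosT f) (-((b / a : ℝ) : ℂ) • sinT f) := by
    unfold IsMulVar
    rw [robinG_apply] at h
    have h0 := Lp.coeFn_zero ℂ 2 halfLine
    rw [← h] at h0
    filter_upwards [h0, Lp.coeFn_add (mulOp (cosCoef a b) (cosT f)) (mulOp (sinCoef a b) (sinT f)),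
      mulOp_ae (cosCoef_bdd a b) (cosT f), mulOp_ae (sinCoef_bdd a b) (sinT f),
      Lp.coeFn_smul (-((b / a : ℝ) : ℂ)) (sinT f),
      ae_restrict_mem measurableSet_Ioi] with k e0 e1 e2 e3 e4 hk
    rw [e1, Pi.add_apply, e2, e3, Pi.zero_apply, cosCoef, sinCoef] at e0
    rw [e4, Pi.smul_apply, smul_eq_mul]
    have hr : (jostAbs a b k : ℂ) ≠ 0 := by
      exact_mod_cast (jostAbs_pos (Or.inl ha) hk).ne'
    have ha' : (a : ℂ) ≠ 0 := by exact_mod_cast ha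
    push_cast at e0 ⊢
    field_simp at e0 ⊢
    linear_combination -e0
  have h1 := hm.isWeakDerivC_cosT
  rw [cosT_cosT, map_smul, sinT_sinT, neg_smul, neg_neg] at h1
  exact h1

/-- The kernel consists of eigenvectors of energy −(b/a)². For a = 0 the convention b/0 = 0 is
harmless, since the kernel is then trivial. -/
theorem isRobin_of_robinG_eq_zero {a b : ℝ} (hab : a ≠ 0 ∨ b ≠ 0) {f : HalfLineC}
    (h : robinG a b f = 0) : IsRobin a b f (((-(b / a) ^ 2 : ℝ) : ℂ) • f) := by
  by_cases ha : a = 0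
  · subst ha
    have hb : b ≠ 0 := by simpa using hab
    have h0 := robinG_eq_zero_of_left_eq_zero hb h
    subst h0
    have hz : IsMulVar 0 0 := by
      unfold IsMulVar
      filter_upwards [Lp.coeFn_zero ℂ 2 halfLine] with k hk
      rw [hk, Pi.zero_apply, mul_zero]
    have h2 := isRobin_robinGAdj 0 b hz hz
    simpa using h2
  · have h1 := isWeakDerivC_of_robinG_eq_zero ha h
    obtain ⟨α, hα⟩ := h1.exists_boundaryValue
    refine ⟨_, _, _, _, h1, h1.const_smul _, hα, hα.const_smul _, ?_, ?_⟩
    · have ha' : (a : ℂ) ≠ 0 := by exact_mod_cast ha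
      push_cast
      field_simp
      ring
    · rw [smul_smul, ← neg_smul]
      congr 1
      push_cast
      ring

/-- The first moment is controlled by |k| ≤ 1 + k². -/
theorem exists_isMulVar_of_sq {g g₂ : HalfLineC}
    (h : g₂ =ᵐ[halfLine] fun k => ((k ^ 2 : ℝ) : ℂ) * g k) :
    ∃ g₁, IsMulVar g g₁ ∧ IsMulVar g₁ g₂ := by
  have hm : MemLp (fun k : ℝ => (k : ℂ) * g k) 2 halfLine := by
    refine ((Lp.memLp g).norm.add (Lp.memLp g₂).norm).of_le
      ((Complex.continuous_ofReal.aestronglyMeasurable).mul (Lp.memLp g).1) ?_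
    filter_upwards [h] with k hk
    have e : ‖(k : ℂ) * g k‖ = |k| * ‖g k‖ := by
      rw [norm_mul, Complex.norm_real, Real.norm_eq_abs]
    have e2 : ‖g₂ k‖ = |k| ^ 2 * ‖g k‖ := by
      rw [hk, norm_mul, Complex.norm_real, Real.norm_eq_abs, abs_pow]
    rw [Pi.add_apply, e2, Real.norm_eq_abs, e]
    refine le_trans ?_ (le_abs_self _)
    nlinarith [norm_nonneg (g k), mul_nonneg (norm_nonneg (g k)) (sq_nonneg (|k| - 1)),
      mul_nonneg (norm_nonneg (g k)) (sq_nonneg |k|)]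
  refine ⟨hm.toLp _, hm.coeFn_toLp, ?_⟩
  unfold IsMulVar
  filter_upwards [h, hm.coeFn_toLp] with k h1 h2
  rw [h1, h2]
  push_cast
  ring

/-- The graph of the scalar operator in the spectral representation. -/
theorem isRobin_iff {a b : ℝ} (hab : a ≠ 0 ∨ b ≠ 0) {ψ χ : HalfLineC} :
    IsRobin a b ψ χ ↔ ∃ g₂ : HalfLineC,
      g₂ =ᵐ[halfLine] (fun k => ((k ^ 2 : ℝ) : ℂ) * robinG a b ψ k) ∧
      χ = robinGAdj a b g₂ + ((-(b / a) ^ 2 : ℝ) : ℂ) • robinP a b ψ := by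
  -- Split ψ = G*Gψ + Pψ: the first summand satisfies the boundary condition by its transform, the
  -- second as an eigenvector.
  have hof : ∀ {ψ g₂ : HalfLineC},
      g₂ =ᵐ[halfLine] (fun k => ((k ^ 2 : ℝ) : ℂ) * robinG a b ψ k) →
      IsRobin a b ψ (robinGAdj a b g₂ + ((-(b / a) ^ 2 : ℝ) : ℂ) • robinP a b ψ) := by
    intro ψ g₂ h
    obtain ⟨g₁, h1, h2⟩ := exists_isMulVar_of_sq h
    have h3 := (isRobin_robinGAdj a b h1 h2).add
      (isRobin_of_robinG_eq_zero hab (robinG_robinP hab ψ))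
    rwa [robinP_apply a b ψ, add_sub_cancel, ← robinP_apply] at h3
  refine ⟨fun h => ?_, fun ⟨g₂, h, e⟩ => e ▸ hof h⟩
  have hloc : LocallyIntegrableOn (fun k : ℝ => robinG a b χ k - ((k ^ 2 : ℝ) : ℂ) * robinG a b ψ k)
      (Ioi 0) halfLine := by
    have h1 : ∀ u : HalfLineC, LocallyIntegrable u halfLine := fun u =>
      (Lp.memLp u).locallyIntegrable (by norm_num)
    refine (h1 _).locallyIntegrableOn (Ioi 0) |>.sub ?_
    exact ((h1 _).locallyIntegrableOn (Ioi 0)).continuousOn_mul (by fun_prop) isOpen_Ioi.isLocallyClosed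
  have h0 := ae_eq_zero_of_forall_test hloc fun η h1 h2 h3 => by
    have hη := halfLineTest.ofReal h1 h2 h3
    have hη1 := halfLineTest.mul_mem hη (f := fun k : ℝ => (k : ℂ)) Complex.ofRealCLM.contDiff
    have hη2 := halfLineTest.mul_mem hη1 (f := fun k : ℝ => (k : ℂ)) Complex.ofRealCLM.contDiff
    set E := halfLineTest.toL2 ⟨_, hη⟩ with hE
    set E1 := halfLineTest.toL2 ⟨_, hη1⟩ with hE1
    set E2 := halfLineTest.toL2 ⟨_, hη2⟩ with hE2
    have e0 := halfLineTest.coe_toL2 ⟨_, hη⟩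
    have e1 := halfLineTest.coe_toL2 ⟨_, hη1⟩
    have e2 := halfLineTest.coe_toL2 ⟨_, hη2⟩
    have m1 : IsMulVar E E1 := by
      unfold IsMulVar
      filter_upwards [e0, e1] with k i0 i1
      rw [hE, hE1, i0, i1]
    have m2 : IsMulVar E1 E2 := by
      unfold IsMulVar
      filter_upwards [e1, e2] with k i0 i1
      rw [hE1, hE2, i0, i1]
    -- Symmetry against the vectors G*η with η a test function says that Gχ and k²Gψ have the same
    -- pairing with η. Hence k²Gψ = Gχ lies in L².
    have key := (isRobin_robinGAdj a b m1 m2).inner_comm hab h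
    rw [robinGAdj_inner, robinGAdj_inner, halfLineC_inner, halfLineC_inner] at key
    have i1 : ∫ x, (starRingEnd ℂ) (E2 x) * robinG a b ψ x ∂halfLine =
        ∫ x, (η x : ℂ) * (((x ^ 2 : ℝ) : ℂ) * robinG a b ψ x) ∂halfLine := by
      refine integral_congr_ae ?_
      filter_upwards [e2] with k hk
      rw [hE2, hk]
      simp only [map_mul, Complex.conj_ofReal]
      push_cast
      ring
    have i2 : ∫ x, (starRingEnd ℂ) (E x) * robinG a b χ x ∂halfLine =
        ∫ x, (η x : ℂ) * robinG a b χ x ∂halfLine := by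
      refine integral_congr_ae ?_
      filter_upwards [e0] with k hk
      rw [hE, hk]
      simp only [Complex.conj_ofReal]
    rw [i1, i2] at key
    simp_rw [mul_sub]
    rw [integral_sub, key, sub_self]
    · exact halfLineC_integrable_mul (halfLineTest.memLp hη) (Lp.memLp _)
    · refine (halfLineC_integrable_mul (halfLineTest.memLp hη2) (Lp.memLp (robinG a b ψ))).congr
        (ae_of_all _ fun k => ?_)
      simp only
      push_cast
      ring
  have hg : robinG a b χ =ᵐ[halfLine] (fun k => ((k ^ 2 : ℝ) : ℂ) * robinG a b ψ k) := by
    filter_upwards [h0] with k hk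
    simpa [sub_eq_zero] using hk
  refine ⟨_, hg, ?_⟩
  -- The converse direction gives a second graph element over the same ψ, and the second component
  -- is unique.
  have h5 := hof hg
  exact h.unique h5

/-! ### The functional calculus of the scalar problem -/

/-- `m(H)` for the scalar operator `H`. -/
noncomputable def robinCalc (a b : ℝ) (m : ℝ → ℂ) : HalfLineC →L[ℂ] HalfLineC :=
  robinGAdj a b ∘L mulOp (fun k => m (k ^ 2)) ∘L robinG a b + m (-(b / a) ^ 2) • robinP a b

theorem robinCalc_apply (a b : ℝ) (m : ℝ → ℂ) (f : HalfLineC) :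
    robinCalc a b m f = robinGAdj a b (mulOp (fun k => m (k ^ 2)) (robinG a b f)) +
      m (-(b / a) ^ 2) • robinP a b f := rfl

theorem IsBddMeasurable.comp_sq {m : ℝ → ℂ} (h : IsBddMeasurable m) :
    IsBddMeasurable (fun k => m (k ^ 2)) :=
  h.comp (by fun_prop)

/-- The relations GG* = 1, GP = 0, PG* = 0 and P² = P eliminate all mixed terms. -/
theorem robinCalc_robinCalc {a b : ℝ} (hab : a ≠ 0 ∨ b ≠ 0) {m m' : ℝ → ℂ}
    (h : IsBddMeasurable m) (h' : IsBddMeasurable m') (f : HalfLineC) :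
    robinCalc a b m (robinCalc a b m' f) = robinCalc a b (fun x => m x * m' x) f := by
  rw [robinCalc_apply a b m', robinCalc_apply, robinCalc_apply, map_add, map_smul,
    robinG_robinGAdj hab, robinG_robinP hab, smul_zero, add_zero, mulOp_mulOp h.comp_sq h'.comp_sq,
    map_add, map_smul, robinP_robinGAdj hab, robinP_robinP hab, zero_add, smul_smul]

theorem robinCalc_one (a b : ℝ) (f : HalfLineC) : robinCalc a b (fun _ => 1) f = f := by
  rw [robinCalc_apply, mulOp_const, one_smul, one_smul, robinP_apply, add_sub_cancel]

theorem robinCalc_robinGAdj {a b : ℝ} (hab : a ≠ 0 ∨ b ≠ 0) (m : ℝ → ℂ) (f : HalfLineC) :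
    robinCalc a b m (robinGAdj a b f) = robinGAdj a b (mulOp (fun k => m (k ^ 2)) f) := by
  rw [robinCalc_apply, robinG_robinGAdj hab, robinP_robinGAdj hab, smul_zero, add_zero]

theorem robinCalc_inner {a b : ℝ} {m : ℝ → ℂ} (h : IsBddMeasurable m) (f g : HalfLineC) :
    ⟪robinCalc a b (fun x => (starRingEnd ℂ) (m x)) f, g⟫_ℂ = ⟪f, robinCalc a b m g⟫_ℂ := by
  rw [robinCalc_apply, robinCalc_apply, inner_add_left, inner_add_right, robinGAdj_inner,
    mulOp_inner h.comp_sq, robinG_inner, inner_smul_left, inner_smul_right, robinP_inner,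
    Complex.conj_conj]

/-- `e^{i t λ}`. -/
noncomputable def evol (t lam : ℝ) : ℂ := Complex.exp (Complex.I * t * lam)

theorem evol_eq (t lam : ℝ) : evol t lam = Complex.exp ((t * lam : ℝ) * Complex.I) := by
  rw [evol]; congr 1; push_cast; ring

theorem norm_evol (t lam : ℝ) : ‖evol t lam‖ = 1 := by
  rw [evol_eq, Complex.norm_exp_ofReal_mul_I]

theorem evol_bdd (t : ℝ) : IsBddMeasurable (evol t) :=
  ⟨by unfold evol; fun_prop, 1, fun lam => (norm_evol t lam).le⟩

theorem conj_evol (t lam : ℝ) : (starRingEnd ℂ) (evol t lam) = evol (-t) lam := by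
  rw [evol, evol, ← Complex.exp_conj]
  simp

theorem evol_mul_evol_neg (t lam : ℝ) : evol t lam * evol (-t) lam = 1 := by
  rw [evol, evol, ← Complex.exp_add]
  simp

theorem robinCalc_evol_neg {a b : ℝ} (hab : a ≠ 0 ∨ b ≠ 0) (t : ℝ) (f : HalfLineC) :
    robinCalc a b (evol t) (robinCalc a b (evol (-t)) f) = f := by
  rw [robinCalc_robinCalc hab (evol_bdd t) (evol_bdd (-t))]
  simp_rw [evol_mul_evol_neg]
  exact robinCalc_one a b f

theorem norm_robinCalc_evol {a b : ℝ} (hab : a ≠ 0 ∨ b ≠ 0) (t : ℝ) (f : HalfLineC) :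
    ‖robinCalc a b (evol t) f‖ = ‖f‖ := by
  have h : ⟪robinCalc a b (evol t) f, robinCalc a b (evol t) f⟫_ℂ = ⟪f, f⟫_ℂ := by
    rw [← robinCalc_inner (evol_bdd t)]
    have h1 := robinCalc_evol_neg hab (-t) f
    rw [neg_neg] at h1
    simp_rw [conj_evol]
    have e : (fun x => evol (-t) x) = evol (-t) := rfl
    rw [e, h1]
  rw [inner_self_eq_norm_sq_to_K, inner_self_eq_norm_sq_to_K] at h
  exact (sq_eq_sq₀ (norm_nonneg _) (norm_nonneg _)).1 (by exact_mod_cast h)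

/-! ### Free evolution of outgoing and incoming waves -/

theorem norm_eq_of_inner_involution {T : HalfLineC →L[ℂ] HalfLineC}
    (h : ∀ f g, ⟪T f, g⟫_ℂ = ⟪f, T g⟫_ℂ) (h2 : ∀ f, T (T f) = f) (f : HalfLineC) :
    ‖T f‖ = ‖f‖ := by
  have e : ⟪T f, T f⟫_ℂ = ⟪f, f⟫_ℂ := by rw [h, h2]
  rw [inner_self_eq_norm_sq_to_K, inner_self_eq_norm_sq_to_K] at e
  exact (sq_eq_sq₀ (norm_nonneg _) (norm_nonneg _)).1 (by exact_mod_cast e)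

theorem norm_cosT (f : HalfLineC) : ‖cosT f‖ = ‖f‖ :=
  norm_eq_of_inner_involution cosT_inner cosT_cosT f

theorem norm_sinT (f : HalfLineC) : ‖sinT f‖ = ‖f‖ :=
  norm_eq_of_inner_involution sinT_inner sinT_sinT f

theorem norm_mulOp_le {m : ℝ → ℂ} (h : IsBddMeasurable m) (h1 : ∀ x, ‖m x‖ ≤ 1) (f : HalfLineC) :
    ‖mulOp m f‖ ≤ ‖f‖ := by
  refine Lp.norm_le_norm_of_ae_le ?_
  filter_upwards [mulOp_ae h f] with x hx
  rw [hx, norm_mul]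
  exact mul_le_of_le_one_left (norm_nonneg _) (h1 x)

theorem TimeDirection.sign_sq (d : TimeDirection) : d.sign * d.sign = 1 := by
  cases d <;> simp [TimeDirection.sign]

theorem TimeDirection.abs_sign (d : TimeDirection) : |d.sign| = 1 := by
  cases d <;> simp [TimeDirection.sign]

theorem TimeDirection.tendsto_sign_mul (d : TimeDirection) :
    Tendsto (fun t => d.sign * t) d.filter atTop := by
  cases d
  · simp only [TimeDirection.sign, TimeDirection.filter, one_mul]
    exact tendsto_id
  · simpa [TimeDirection.sign, TimeDirection.filter] using tendsto_neg_atBot_atTop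

/-- The half-line Fourier transform with kernel `√(2/π) e^{∓ikx}`. -/
noncomputable def expT (d : TimeDirection) : HalfLineC →L[ℂ] HalfLineC :=
  cosT - (Complex.I * d.sign) • sinT

theorem expT_apply (d : TimeDirection) (f : HalfLineC) :
    expT d f = cosT f - (Complex.I * d.sign) • sinT f := rfl

theorem norm_expT_le (d : TimeDirection) (f : HalfLineC) : ‖expT d f‖ ≤ 2 * ‖f‖ := by
  rw [expT_apply]
  refine (norm_sub_le _ _).trans ?_
  rw [norm_smul, norm_mul, Complex.norm_I, Complex.norm_real, Real.norm_eq_abs, d.abs_sign,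
    norm_cosT, norm_sinT]
  linarith

/-- Non-stationary phase estimate for the phase `k x + s k²`. -/
theorem halfLineTest.norm_oscillatory_le {η : ℝ → ℂ} (hη : η ∈ halfLineTest) {δ : ℝ} (hδ : 0 < δ)
    (hs : ∀ k ∈ tsupport η, δ ≤ k) {σ : ℝ} (hσ : |σ| = 1) {s x : ℝ} (hs0 : 0 < s) (hx : 0 < x) :
    ‖∫ k, Complex.exp (-(σ * (k * x + s * k ^ 2) : ℝ) * Complex.I) * η k‖ ≤
      ((∫ k, ‖deriv η k‖) + δ⁻¹ * ∫ k, ‖η k‖) / (x + 2 * s * δ) := by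
  have hd := halfLineTest.deriv_mem hη
  have hds : ∀ k ∈ tsupport (deriv η), δ ≤ k := fun k hk =>
    hs k (closure_minimal support_deriv_subset (isClosed_tsupport η) hk)
  have hA : 0 < x + 2 * s * δ := by positivity
  have hP : ∀ k, δ ≤ k → x + 2 * s * δ ≤ x + 2 * s * k := fun k hk => by gcongr
  set e : ℝ → ℂ := fun k => Complex.exp (-(σ * (k * x + s * k ^ 2) : ℝ) * Complex.I) with he
  have hen : ∀ k, ‖e k‖ = 1 := fun k => by
    rw [he]
    simp only
    rw [← Complex.ofReal_neg, Complex.norm_exp_ofReal_mul_I]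
  have hem : Continuous e := by rw [he]; fun_prop
  have hed : ∀ k, HasDerivAt e (-(σ * (x + 2 * s * k) : ℝ) * Complex.I * e k) k := by
    intro k
    have h1 : HasDerivAt (fun k : ℝ => -(σ * (k * x + s * k ^ 2))) (-(σ * (x + 2 * s * k))) k := by
      have := (((hasDerivAt_id k).mul_const x).add (((hasDerivAt_id k).pow 2).const_mul s)).const_mul σ
      exact this.neg.congr_deriv (by simp only [id]; push_cast; ring)
    have h2 := (h1.ofReal_comp.mul_const Complex.I).cexp
    convert h2 using 1
    · funext y; simp [he]
    · simp [he]; ring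
  have hpd : ∀ k, HasDerivAt (fun k : ℝ => ((x + 2 * s * k : ℝ) : ℂ)) ((2 * s : ℝ) : ℂ) k := by
    intro k
    have h1 : HasDerivAt (fun k : ℝ => x + 2 * s * k) (2 * s) k := by
      simpa using ((hasDerivAt_id k).const_mul (2 * s)).const_add x
    exact h1.ofReal_comp
  -- Dividing by the phase derivative x + 2sk gives u' = −iσe + w, so one integration by parts
  -- expresses the oscillatory integral by u and w.
  set u : ℝ → ℂ := fun k => e k / ((x + 2 * s * k : ℝ) : ℂ) with hu
  set w : ℝ → ℂ := fun k => -((2 * s : ℝ) : ℂ) * e k / ((x + 2 * s * k : ℝ) : ℂ) ^ 2 with hw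
  set u' : ℝ → ℂ := fun k => -σ * Complex.I * e k + w k with hu'
  have hum : Measurable u := by
    have := hem.measurable
    rw [hu]; fun_prop
  have hwm : Measurable w := by
    have := hem.measurable
    rw [hw]; fun_prop
  have hud : ∀ k ∈ tsupport η, HasDerivAt u (u' k) k := by
    intro k hk
    have hne : ((x + 2 * s * k : ℝ) : ℂ) ≠ 0 := by
      exact_mod_cast (hA.trans_le (hP k (hs k hk))).ne'
    have h1 := (hed k).div (hpd k) hne
    refine h1.congr_deriv ?_
    rw [hu', hw]
    field_simp
    push_cast
    ring
  have hub : ∀ k, δ ≤ k → ‖u k‖ ≤ (x + 2 * s * δ)⁻¹ := by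
    intro k hk
    have h2 : 0 < x + 2 * s * k := hA.trans_le (hP k hk)
    rw [hu]
    simp only
    rw [norm_div, hen, Complex.norm_real, Real.norm_eq_abs, abs_of_pos h2, one_div]
    exact inv_anti₀ hA (hP k hk)
  -- One factor of the squared denominator is at least x + 2sδ; the other is at least 2sδ, which
  -- absorbs the numerator 2s uniformly in s.
  have hwb : ∀ k, δ ≤ k → ‖w k‖ ≤ (x + 2 * s * δ)⁻¹ * δ⁻¹ := by
    intro k hk
    have h2 : 0 < x + 2 * s * k := hA.trans_le (hP k hk)
    rw [hw]
    simp only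
    rw [norm_div, norm_mul, hen, norm_neg, Complex.norm_real, norm_pow, Complex.norm_real,
      Real.norm_eq_abs, Real.norm_eq_abs, abs_of_pos h2, abs_of_pos (by positivity), mul_one,
      ← mul_inv, ← one_div, div_le_div_iff₀ (by positivity) (by positivity), one_mul]
    have h3 : 2 * s * δ ≤ x + 2 * s * k := by nlinarith
    nlinarith [hP k hk, mul_le_mul h3 (hP k hk) hA.le h2.le]
  have hbd : ∀ {f g : ℝ → ℂ} {C : ℝ}, AEStronglyMeasurable f volume → g ∈ halfLineTest →
      (∀ k ∈ tsupport g, δ ≤ k) → (∀ k, δ ≤ k → ‖f k‖ ≤ C) →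
      Integrable (fun k => f k * g k) ∧ ‖∫ k, f k * g k‖ ≤ C * ∫ k, ‖g k‖ := by
    intro f g C hf hg hgs hfb
    have hb : ∀ k, ‖f k * g k‖ ≤ C * ‖g k‖ := by
      intro k
      by_cases hk : k ∈ tsupport g
      · rw [norm_mul]
        gcongr
        exact hfb k (hgs k hk)
      · simp [image_eq_zero_of_notMem_tsupport hk]
    have hi := ((halfLineTest.integrable_volume hg).norm.const_mul C)
    refine ⟨hi.mono' (hf.mul (halfLineTest.integrable_volume hg).1) (ae_of_all _ hb), ?_⟩
    rw [← integral_const_mul]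
    exact norm_integral_le_of_norm_le hi (ae_of_all _ hb)
  have b1 := hbd hum.aestronglyMeasurable hd hds hub
  have b2 := hbd hwm.aestronglyMeasurable hη hs hwb
  have b3 := hbd hem.aestronglyMeasurable hη hs (C := 1) fun k _ => (hen k).le
  have b4 := hbd hum.aestronglyMeasurable hη hs hub
  have b5 : Integrable (fun k => u' k * η k) := by
    have := (b3.1.const_mul (-σ * Complex.I)).add b2.1
    refine this.congr (ae_of_all _ fun k => ?_)
    simp only [hu', Pi.add_apply]
    ring
  have key := integral_mul_deriv_eq_deriv_mul_of_integrable (u := u) (v := η) hud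
    (fun k _ => (hη.1.differentiable (by norm_num)).differentiableAt.hasDerivAt) b1.1 b5 b4.1
  have e5 : ∫ k, u' k * η k = -σ * Complex.I * (∫ k, e k * η k) + ∫ k, w k * η k := by
    rw [← integral_const_mul, ← integral_add (b3.1.const_mul _) b2.1]
    refine integral_congr_ae (ae_of_all _ fun k => ?_)
    simp only [hu']
    ring
  rw [e5] at key
  have e6 : (σ * Complex.I) * (∫ k, e k * η k) = (∫ k, u k * deriv η k) + ∫ k, w k * η k := by
    linear_combination -key
  have e7 : ‖∫ k, e k * η k‖ = ‖(σ * Complex.I) * (∫ k, e k * η k)‖ := by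
    rw [norm_mul, norm_mul, Complex.norm_I, Complex.norm_real, Real.norm_eq_abs, hσ, one_mul,
      one_mul]
  rw [e7, e6]
  refine (norm_add_le _ _).trans ((add_le_add b1.2 b2.2).trans_eq ?_)
  field_simp

theorem integral_exp_mul_eq {η : ℝ → ℂ} (hη : η ∈ halfLineTest) (σ x : ℝ) :
    (∫ k, (cosKernel x k : ℂ) * η k ∂halfLine) -
      (Complex.I * σ) * ∫ k, (sinKernel x k : ℂ) * η k ∂halfLine =
    Real.sqrt (2 / Real.pi) * ∫ k, (Real.cos (x * k) - Complex.I * σ * Real.sin (x * k)) * η k := by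
  have h1 := integrable_kernel_mul continuous_cosKernel abs_cosKernel_le
    (halfLineTest.integrable hη) x
  have h2 := integrable_kernel_mul continuous_sinKernel abs_sinKernel_le
    (halfLineTest.integrable hη) x
  rw [← halfLineTest.setIntegral_eq hη, ← integral_const_mul, ← integral_const_mul,
    ← integral_sub h1 (h2.const_mul _)]
  refine integral_congr_ae (ae_of_all _ fun k => ?_)
  simp only [cosKernel, sinKernel]
  push_cast
  ring

theorem exists_norm_expT_evol_le (d : TimeDirection) (η : halfLineTest) :
    ∃ K δ : ℝ, 0 < δ ∧ ∀ t : ℝ, 0 < d.sign * t →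
      ∀ᵐ x ∂halfLine, ‖expT d (mulOp (fun k => evol (-t) (k ^ 2)) (halfLineTest.toL2 η)) x‖ ≤
        K / (x + 2 * (d.sign * t) * δ) := by
  -- The support is compact in the open half line, so the frequencies stay away from 0.
  obtain ⟨δ, hδ, hs⟩ : ∃ δ, 0 < δ ∧ ∀ k ∈ tsupport (η : ℝ → ℂ), δ ≤ k := by
    rcases (tsupport (η : ℝ → ℂ)).eq_empty_or_nonempty with h | h
    · exact ⟨1, one_pos, by simp [h]⟩
    · obtain ⟨p, hp1, hp2⟩ := η.2.2.1.isCompact.exists_isLeast h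
      exact ⟨p, η.2.2.2 hp1, fun k hk => hp2 hk⟩
  refine ⟨Real.sqrt (2 / Real.pi) *
    ((∫ k, ‖deriv (η : ℝ → ℂ) k‖) + δ⁻¹ * ∫ k, ‖(η : ℝ → ℂ) k‖), δ, hδ, fun t ht => ?_⟩
  have hev : ContDiff ℝ ∞ fun k : ℝ => evol (-t) (k ^ 2) := by
    unfold evol
    exact ((contDiff_const.mul (Complex.ofRealCLM.contDiff.comp (contDiff_id.pow 2)))).cexp
  set ζ : halfLineTest := ⟨_, halfLineTest.mul_mem η.2 hev⟩ with hζ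
  have hz : mulOp (fun k => evol (-t) (k ^ 2)) (halfLineTest.toL2 η) = halfLineTest.toL2 ζ := by
    refine Lp.ext ?_
    filter_upwards [mulOp_ae (evol_bdd (-t)).comp_sq (halfLineTest.toL2 η),
      halfLineTest.coe_toL2 η, halfLineTest.coe_toL2 ζ] with k h1 h2 h3
    rw [h1, h2, h3]
  rw [hz, expT_apply]
  filter_upwards [halfLineTest.cosT_ae ζ, halfLineTest.sinT_ae ζ,
    Lp.coeFn_sub (cosT (halfLineTest.toL2 ζ)) ((Complex.I * d.sign) • sinT (halfLineTest.toL2 ζ)),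
    Lp.coeFn_smul (Complex.I * (d.sign : ℂ)) (sinT (halfLineTest.toL2 ζ)),
    ae_restrict_mem measurableSet_Ioi] with x h1 h2 h3 h4 hx
  rw [h3, Pi.sub_apply, h4, Pi.smul_apply, h1, h2, smul_eq_mul, integral_exp_mul_eq ζ.2, norm_mul,
    Complex.norm_real, Real.norm_eq_abs, abs_of_nonneg (Real.sqrt_nonneg _), mul_div_assoc]
  gcongr
  refine le_trans (le_of_eq ?_)
    (halfLineTest.norm_oscillatory_le η.2 hδ hs d.abs_sign ht hx)
  congr 1
  refine integral_congr_ae (ae_of_all _ fun k => ?_)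
  simp only [hζ]
  rw [← mul_assoc]
  congr 1
  have e1 : ((Real.cos (x * k) : ℂ) - Complex.I * d.sign * Real.sin (x * k)) =
      Complex.exp ((-(d.sign * (x * k)) : ℝ) * Complex.I) := by
    rw [Complex.exp_mul_I, ← Complex.ofReal_cos, ← Complex.ofReal_sin]
    cases d
    · simp [TimeDirection.sign]; ring
    · simp [TimeDirection.sign]; ring
  rw [e1, evol, ← Complex.exp_add]
  congr 1
  -- Writing t = σ·(σt) with σt > 0 pulls the same sign out of kx and tk², so the two phases add up
  -- instead of competing.
  have e2 := d.sign_sq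
  have e3 : -t * k ^ 2 = -(d.sign * (d.sign * t) * k ^ 2) := by rw [← mul_assoc, e2]; ring
  have e4 : Complex.I * ((-t : ℝ) : ℂ) * ((k ^ 2 : ℝ) : ℂ) =
      ((-(d.sign * (d.sign * t) * k ^ 2) : ℝ) : ℂ) * Complex.I := by
    rw [← e3]; push_cast; ring
  rw [e4]
  push_cast
  ring

/-- The pointwise bound K/(x + A), with A = 2|t|δ, has vanishing L² norm as A → ∞. This is made
explicit by a fixed L² weight times a power of A. -/
theorem tendsto_expT_evol_test (d : TimeDirection) (η : halfLineTest) :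
    Tendsto (fun t => expT d (mulOp (fun k => evol (-t) (k ^ 2)) (halfLineTest.toL2 η))) d.filter
      (𝓝 0) := by
  obtain ⟨K, δ, hδ, hK⟩ := exists_norm_expT_evol_le d η
  have hw : MemLp (fun x : ℝ => (x + 1) ^ (-(3 / 4) : ℝ)) 2 halfLine := by
    rw [memLp_two_iff_integrable_sq]
    · have h1 := integrableOn_add_rpow_Ioi_of_lt (a := -(3 / 2)) (c := 0) (m := 1) (by norm_num)
        (by norm_num)
      refine IntegrableOn.congr_fun h1 (fun x hx => ?_) measurableSet_Ioi
      have hx' : (0 : ℝ) ≤ x + 1 := by have := mem_Ioi.1 hx; linarith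
      rw [← Real.rpow_natCast, ← Real.rpow_mul hx']
      norm_num
    · exact (Measurable.pow_const (by fun_prop) _).aestronglyMeasurable
  refine squeeze_zero_norm' (a := fun t => (|K| * (2 * (d.sign * t) * δ) ^ (-(1 / 4) : ℝ)) *
    ‖hw.toLp _‖) ?_ ?_
  · have h1 : ∀ᶠ t in d.filter, 1 ≤ 2 * (d.sign * t) * δ :=
      (((d.tendsto_sign_mul).const_mul_atTop two_pos).atTop_mul_const hδ).eventually_ge_atTop 1
    filter_upwards [h1] with t ht
    have hpos : 0 < d.sign * t := by
      by_contra h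
      have := mul_nonpos_of_nonpos_of_nonneg (not_lt.1 h) hδ.le
      linarith
    refine Lp.norm_le_mul_norm_of_ae_le_mul ?_
    filter_upwards [hK t hpos, hw.coeFn_toLp, ae_restrict_mem measurableSet_Ioi] with x h2 h3 hx
    rw [h3]
    refine h2.trans ?_
    set A := 2 * (d.sign * t) * δ with hA
    have hx0 : 0 < x := hx
    have hA0 : 0 < A := one_pos.trans_le ht
    -- Uses A ≥ 1. The exponent 3/4 exceeds 1/2, so (x + 1)^(−3/4) is square integrable, and 1/4
    -- remains for the decay in A.
    have h4 : A ^ (1 / 4 : ℝ) * (x + 1) ^ (3 / 4 : ℝ) ≤ x + A := by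
      calc A ^ (1 / 4 : ℝ) * (x + 1) ^ (3 / 4 : ℝ)
          ≤ (x + A) ^ (1 / 4 : ℝ) * (x + A) ^ (3 / 4 : ℝ) := by
            gcongr
            linarith
        _ = x + A := by
            rw [← Real.rpow_add (by positivity)]
            norm_num
    have h5 : (0 : ℝ) ≤ (x + 1) ^ (-(3 / 4) : ℝ) := by positivity
    rw [Real.norm_eq_abs, abs_of_nonneg h5, Real.rpow_neg hA0.le,
      Real.rpow_neg (by positivity), mul_assoc, ← mul_inv, ← div_eq_mul_inv]
    exact div_le_div₀ (abs_nonneg _) (le_abs_self _) (by positivity) h4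
  · have h1 : Tendsto (fun t => 2 * (d.sign * t) * δ) d.filter atTop :=
      ((d.tendsto_sign_mul).const_mul_atTop two_pos).atTop_mul_const hδ
    have h2 := ((tendsto_rpow_neg_atTop (y := 1 / 4) (by norm_num)).comp h1)
    simpa using (h2.const_mul |K|).mul_const ‖hw.toLp _‖

/-- Outgoing waves leave the half line under the free evolution. -/
theorem tendsto_expT_evol (d : TimeDirection) (g : HalfLineC) :
    Tendsto (fun t => expT d (mulOp (fun k => evol (-t) (k ^ 2)) g)) d.filter (𝓝 0) := by
  rw [Metric.tendsto_nhds]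
  intro ε hε
  -- The operators are bounded by 2 uniformly in t, so an error ε/4 contributes at most ε/2.
  obtain ⟨η, hη⟩ := halfLineTest.denseRange_toL2.exists_dist_lt g (ε := ε / 4) (by positivity)
  have h1 := (Metric.tendsto_nhds.1 (tendsto_expT_evol_test d η)) (ε / 2) (by positivity)
  filter_upwards [h1] with t ht
  rw [dist_zero_right] at ht ⊢
  have h2 : expT d (mulOp (fun k => evol (-t) (k ^ 2)) g) =
      expT d (mulOp (fun k => evol (-t) (k ^ 2)) (halfLineTest.toL2 η)) +
      expT d (mulOp (fun k => evol (-t) (k ^ 2)) (g - halfLineTest.toL2 η)) := by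
    rw [← map_add, ← map_add, add_sub_cancel]
  rw [h2]
  refine (norm_add_le _ _).trans_lt ?_
  have h3 := (norm_expT_le d (mulOp (fun k => evol (-t) (k ^ 2)) (g - halfLineTest.toL2 η)))
  have h4 := norm_mulOp_le (evol_bdd (-t)).comp_sq (fun k => (norm_evol (-t) _).le)
    (g - halfLineTest.toL2 η)
  rw [dist_eq_norm] at hη
  linarith

/-! ### The scalar Fourier maps and wave operators -/

/-- The unimodular factor relating the generalized Fourier maps to the spectral representation. -/
noncomputable def jostPhase (a b : ℝ) (d : TimeDirection) (k : ℝ) : ℂ :=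
  -(Complex.I * d.sign * jostAbs a b k) / (b - Complex.I * d.sign * k * a)

theorem norm_scalarJost (a b : ℝ) (d : TimeDirection) (k : ℝ) :
    ‖(b - Complex.I * d.sign * k * a : ℂ)‖ = jostAbs a b k := by
  rw [jostAbs, Complex.norm_def]
  congr 1
  have e : (b - Complex.I * d.sign * k * a : ℂ) = Complex.mk b (-(d.sign * k * a)) := by
    apply Complex.ext <;> simp
  rw [e, Complex.normSq_mk]
  linear_combination (k ^ 2 * a ^ 2) * d.sign_sq

theorem scalarJost_ne_zero {a b : ℝ} (hab : a ≠ 0 ∨ b ≠ 0) (d : TimeDirection) {k : ℝ}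
    (hk : 0 < k) : (b - Complex.I * d.sign * k * a : ℂ) ≠ 0 := by
  rw [← norm_ne_zero_iff, norm_scalarJost]
  exact (jostAbs_pos hab hk).ne'

theorem norm_jostPhase_eq (a b : ℝ) (d : TimeDirection) (k : ℝ) :
    ‖jostPhase a b d k‖ = jostAbs a b k / jostAbs a b k := by
  rw [jostPhase, norm_div, norm_scalarJost, norm_neg, norm_mul, norm_mul, Complex.norm_I,
    Complex.norm_real, Complex.norm_real, Real.norm_eq_abs, Real.norm_eq_abs, d.abs_sign,
    abs_of_nonneg (jostAbs_nonneg a b k), one_mul, one_mul]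

theorem jostPhase_bdd (a b : ℝ) (d : TimeDirection) : IsBddMeasurable (jostPhase a b d) := by
  refine ⟨?_, 1, fun k => ?_⟩
  · have := (continuous_jostAbs a b).measurable
    unfold jostPhase
    fun_prop
  · rw [norm_jostPhase_eq]
    exact div_self_le_one _

theorem jostPhase_mul_conj {a b : ℝ} (hab : a ≠ 0 ∨ b ≠ 0) (d : TimeDirection) {k : ℝ}
    (hk : 0 < k) : jostPhase a b d k * (starRingEnd ℂ) (jostPhase a b d k) = 1 := by
  rw [Complex.mul_conj, Complex.normSq_eq_norm_sq, norm_jostPhase_eq,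
    div_self (jostAbs_pos hab hk).ne']
  simp

/-- The scalar generalized Fourier map. -/
noncomputable def robinF (a b : ℝ) (d : TimeDirection) : HalfLineC →L[ℂ] HalfLineC :=
  mulOp (jostPhase a b d) ∘L robinG a b

/-- The adjoint of the scalar generalized Fourier map. -/
noncomputable def robinFAdj (a b : ℝ) (d : TimeDirection) : HalfLineC →L[ℂ] HalfLineC :=
  robinGAdj a b ∘L mulOp (fun k => (starRingEnd ℂ) (jostPhase a b d k))

theorem robinF_apply (a b : ℝ) (d : TimeDirection) (f : HalfLineC) :
    robinF a b d f = mulOp (jostPhase a b d) (robinG a b f) := rfl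

theorem robinFAdj_apply (a b : ℝ) (d : TimeDirection) (f : HalfLineC) : robinFAdj a b d f =
    robinGAdj a b (mulOp (fun k => (starRingEnd ℂ) (jostPhase a b d k)) f) := rfl

theorem robinFAdj_inner (a b : ℝ) (d : TimeDirection) (f g : HalfLineC) :
    ⟪robinFAdj a b d f, g⟫_ℂ = ⟪f, robinF a b d g⟫_ℂ := by
  rw [robinF_apply, robinFAdj_apply, robinGAdj_inner, mulOp_inner (jostPhase_bdd a b d)]

theorem robinF_robinFAdj {a b : ℝ} (hab : a ≠ 0 ∨ b ≠ 0) (d : TimeDirection) (f : HalfLineC) :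
    robinF a b d (robinFAdj a b d f) = f := by
  have h := jostPhase_bdd a b d
  rw [robinF_apply, robinFAdj_apply, robinG_robinGAdj hab, mulOp_mulOp h h.conj,
    mulOp_congr (h.mul h.conj) (.const 1) fun k hk => jostPhase_mul_conj hab d hk, mulOp_const,
    one_smul]

theorem robinFAdj_robinF {a b : ℝ} (hab : a ≠ 0 ∨ b ≠ 0) (d : TimeDirection) (f : HalfLineC) :
    robinFAdj a b d (robinF a b d f) = f - robinP a b f := by
  have h := jostPhase_bdd a b d
  rw [robinF_apply, robinFAdj_apply, mulOp_comm h.conj h, mulOp_mulOp h h.conj,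
    mulOp_congr (h.mul h.conj) (.const 1) fun k hk => jostPhase_mul_conj hab d hk, mulOp_const,
    one_smul, robinP_apply, sub_sub_cancel]

theorem robinP_robinFAdj {a b : ℝ} (hab : a ≠ 0 ∨ b ≠ 0) (d : TimeDirection) (f : HalfLineC) :
    robinP a b (robinFAdj a b d f) = 0 :=
  robinP_robinGAdj hab _

theorem norm_robinFAdj {a b : ℝ} (hab : a ≠ 0 ∨ b ≠ 0) (d : TimeDirection) (f : HalfLineC) :
    ‖robinFAdj a b d f‖ = ‖f‖ := by
  have e : ⟪robinFAdj a b d f, robinFAdj a b d f⟫_ℂ = ⟪f, f⟫_ℂ := by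
    rw [robinFAdj_inner, robinF_robinFAdj hab]
  rw [inner_self_eq_norm_sq_to_K, inner_self_eq_norm_sq_to_K] at e
  exact (sq_eq_sq₀ (norm_nonneg _) (norm_nonneg _)).1 (by exact_mod_cast e)

/-! The Neumann problem -/

theorem mulOp_cosCoef_neumann (f : HalfLineC) : mulOp (cosCoef (-1) 0) f = -f := by
  rw [mulOp_congr (cosCoef_bdd _ _) (.const (-1)) fun k hk => ?_, mulOp_const, neg_one_smul]
  have h : jostAbs (-1) 0 k = k := by
    rw [jostAbs, show ((0 : ℝ) ^ 2 + (-1) ^ 2 * k ^ 2) = k ^ 2 by ring, Real.sqrt_sq hk.le]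
  rw [cosCoef, h, neg_one_mul, neg_div, div_self hk.ne']
  simp

theorem mulOp_sinCoef_neumann (f : HalfLineC) : mulOp (sinCoef (-1) 0) f = 0 := by
  have h : sinCoef (-1) 0 = fun _ => 0 := funext fun k => by simp [sinCoef]
  rw [h, mulOp_const, zero_smul]

theorem robinG_neumann (f : HalfLineC) : robinG (-1) 0 f = -cosT f := by
  rw [robinG_apply, mulOp_cosCoef_neumann, mulOp_sinCoef_neumann, add_zero]

theorem robinGAdj_neumann (f : HalfLineC) : robinGAdj (-1) 0 f = -cosT f := by
  rw [robinGAdj_apply, mulOp_cosCoef_neumann, mulOp_sinCoef_neumann, map_zero, add_zero, map_neg]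

theorem robinP_neumann (f : HalfLineC) : robinP (-1) 0 f = 0 := by
  rw [robinP_apply, robinGAdj_neumann, robinG_neumann, map_neg, neg_neg, cosT_cosT, sub_self]

/-- Both the cosine coefficient and the phase equal −1 for (a, b) = (−1, 0); the signs cancel, in
either time direction. -/
theorem robinF_neumann (d : TimeDirection) (f : HalfLineC) : robinF (-1) 0 d f = cosT f := by
  rw [robinF_apply, robinG_neumann, mulOp_congr (jostPhase_bdd _ _ d) (.const (-1)) fun k hk => ?_,
    mulOp_const, neg_one_smul, neg_neg]
  have h : jostAbs (-1) 0 k = k := by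
    rw [jostAbs, show ((0 : ℝ) ^ 2 + (-1) ^ 2 * k ^ 2) = k ^ 2 by ring, Real.sqrt_sq hk.le]
  have h2 := scalarJost_ne_zero (a := -1) (b := 0) (Or.inl (by norm_num)) d hk
  rw [jostPhase, h, div_eq_iff h2]
  push_cast
  ring

theorem robinCalc_neumann (m : ℝ → ℂ) (f : HalfLineC) :
    robinCalc (-1) 0 m f = cosT (mulOp (fun k => m (k ^ 2)) (cosT f)) := by
  rw [robinCalc_apply, robinP_neumann, smul_zero, add_zero, robinGAdj_neumann, robinG_neumann,
    map_neg, map_neg, neg_neg]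

/-- With p the phase and σ the sign of the time direction, C − F* = Cθ − S(s p̄) for θ = 1 − c p̄.
The point is that s p̄ = iσθ, as both equal iσb/(b + iσka); so only waves of one direction of travel
remain. -/
theorem robin_wave_identity {a b : ℝ} (hab : a ≠ 0 ∨ b ≠ 0) (d : TimeDirection) (g : HalfLineC) :
    cosT g - robinFAdj a b d g =
      expT d (mulOp (fun k => 1 - cosCoef a b k * (starRingEnd ℂ) (jostPhase a b d k)) g) := by
  have hc := cosCoef_bdd a b
  have hs := sinCoef_bdd a b
  have hp := (jostPhase_bdd a b d).conj
  have hθ : IsBddMeasurable fun k => 1 - cosCoef a b k * (starRingEnd ℂ) (jostPhase a b d k) := by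
    have h1 := (IsBddMeasurable.const 1).add ((IsBddMeasurable.const (-1)).mul (hc.mul hp))
    simpa only [neg_one_mul, ← sub_eq_add_neg] using h1
  have e1 : mulOp (fun k => 1 - cosCoef a b k * (starRingEnd ℂ) (jostPhase a b d k)) g =
      g - mulOp (fun k => cosCoef a b k * (starRingEnd ℂ) (jostPhase a b d k)) g := by
    refine Lp.ext ?_
    filter_upwards [mulOp_ae hθ g, mulOp_ae (hc.mul hp) g,
      Lp.coeFn_sub g (mulOp (fun k => cosCoef a b k * (starRingEnd ℂ) (jostPhase a b d k)) g)]
      with k h1 h2 h3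
    rw [h3, Pi.sub_apply, h1, h2]
    ring
  have e2 : (Complex.I * d.sign) •
      mulOp (fun k => 1 - cosCoef a b k * (starRingEnd ℂ) (jostPhase a b d k)) g =
      mulOp (fun k => sinCoef a b k * (starRingEnd ℂ) (jostPhase a b d k)) g := by
    rw [← mulOp_const, mulOp_mulOp (.const _) hθ]
    congr 1
    refine mulOp_congr ((IsBddMeasurable.const _).mul hθ) (hs.mul hp) fun k hk => ?_
    have hr : (jostAbs a b k : ℂ) ≠ 0 := by exact_mod_cast (jostAbs_pos hab hk).ne'
    have hj := (map_ne_zero (starRingEnd ℂ)).2 (scalarJost_ne_zero hab d hk)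
    rw [cosCoef, sinCoef, jostPhase, map_div₀]
    simp only [map_neg, map_mul, map_sub, Complex.conj_I, Complex.conj_ofReal] at hj ⊢
    generalize hD : (b - -Complex.I * d.sign * k * a : ℂ) = D at hj ⊢
    push_cast
    field_simp
    linear_combination (-d.sign : ℂ) * hD
  rw [robinFAdj_apply, robinGAdj_apply, mulOp_mulOp hc hp, mulOp_mulOp hs hp, expT_apply, e1,
    map_sub, ← map_smul, ← e1, e2]
  abel

/-- The scalar wave operators. -/
theorem tendsto_robin_wave {a b : ℝ} (hab : a ≠ 0 ∨ b ≠ 0) (d : TimeDirection) (ψ : HalfLineC) :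
    Tendsto (fun t => robinCalc a b (evol t) (robinCalc (-1) 0 (evol (-t)) ψ)) d.filter
      (𝓝 (robinFAdj a b d (cosT ψ))) := by
  set θ : ℝ → ℂ := fun k => 1 - cosCoef a b k * (starRingEnd ℂ) (jostPhase a b d k) with hθ
  have hθb : IsBddMeasurable θ := by
    have h1 := (IsBddMeasurable.const 1).add ((IsBddMeasurable.const (-1)).mul
      ((cosCoef_bdd a b).mul (jostPhase_bdd a b d).conj))
    simpa only [neg_one_mul, ← sub_eq_add_neg] using h1
  rw [tendsto_iff_norm_sub_tendsto_zero]
  have h0 := (tendsto_expT_evol d (mulOp θ (cosT ψ))).norm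
  rw [norm_zero] at h0
  refine h0.congr fun t => ?_
  have he := (evol_bdd (-t)).comp_sq
  -- Intertwining writes the time-independent limit as e^{itH} applied to a moving vector, so that
  -- the unitary e^{itH} can be dropped from the norm.
  have h1 : robinFAdj a b d (cosT ψ) = robinCalc a b (evol t)
      (robinFAdj a b d (mulOp (fun k => evol (-t) (k ^ 2)) (cosT ψ))) := by
    rw [robinFAdj_apply, robinFAdj_apply, robinCalc_robinGAdj hab,
      mulOp_comm (jostPhase_bdd a b d).conj he, mulOp_mulOp (evol_bdd t).comp_sq he]
    simp_rw [evol_mul_evol_neg]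
    rw [mulOp_const, one_smul]
  rw [h1, ← map_sub, norm_robinCalc_evol hab, robinCalc_neumann, robin_wave_identity hab,
    mulOp_comm he hθb]

/-- The scalar physical solution. -/
noncomputable def scalarPhysical (a b κ x : ℝ) : ℂ :=
  -(Complex.I * κ) * ((Real.cos (κ * x) : ℂ) * a + ((x * Real.sinc (κ * x) : ℝ) : ℂ) * b) *
    (b - Complex.I * κ * a)⁻¹

theorem conj_scalarPhysical {a b : ℝ} (hab : a ≠ 0 ∨ b ≠ 0) (d : TimeDirection) {k : ℝ}
    (hk : 0 < k) (x : ℝ) : (starRingEnd ℂ) (scalarPhysical a b (-d.sign * k) x) =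
      jostPhase a b d k *
        (cosCoef a b k * Real.cos (k * x) + sinCoef a b k * Real.sin (k * x)) := by
  have hr : (jostAbs a b k : ℂ) ≠ 0 := by exact_mod_cast (jostAbs_pos hab hk).ne'
  have hj := scalarJost_ne_zero hab d hk
  have hcos : Real.cos (-d.sign * k * x) = Real.cos (k * x) := by
    cases d <;> simp [TimeDirection.sign]
  -- `Real.sinc` is even, so the sign of the frequency drops out.
  have hsin : k * (x * Real.sinc (-d.sign * k * x)) = Real.sin (k * x) := by
    have h1 : Real.sinc (-d.sign * k * x) = Real.sinc (k * x) := by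
      cases d <;> simp [TimeDirection.sign, Real.sinc_neg]
    rw [h1]
    rcases eq_or_ne x 0 with h | h
    · simp [h]
    · rw [Real.sinc_of_ne_zero (mul_ne_zero hk.ne' h)]
      have := hk.ne'
      field_simp
  rw [scalarPhysical, hcos, jostPhase, cosCoef, sinCoef, ← hsin]
  simp only [map_mul, map_add, map_sub, map_neg, map_inv₀, Complex.conj_I, Complex.conj_ofReal]
  push_cast
  have hj2 : (b : ℂ) - -Complex.I * (-d.sign * k) * a ≠ 0 := by
    convert hj using 2; ring
  rw [show (b : ℂ) - -Complex.I * (-d.sign * k) * a = b - Complex.I * d.sign * k * a by ring]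
  field_simp

theorem robinF_ae {a b : ℝ} (hab : a ≠ 0 ∨ b ≠ 0) (d : TimeDirection) {ψ : HalfLineC}
    (hψ : Integrable ψ halfLine) : robinF a b d ψ =ᵐ[halfLine] fun k => Real.sqrt (2 / Real.pi) *
      ∫ x, (starRingEnd ℂ) (scalarPhysical a b (-d.sign * k) x) * ψ x ∂halfLine := by
  rw [robinF_apply, robinG_apply]
  filter_upwards [mulOp_ae (jostPhase_bdd a b d)
      (mulOp (cosCoef a b) (cosT ψ) + mulOp (sinCoef a b) (sinT ψ)),
    Lp.coeFn_add (mulOp (cosCoef a b) (cosT ψ)) (mulOp (sinCoef a b) (sinT ψ)),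
    mulOp_ae (cosCoef_bdd a b) (cosT ψ), mulOp_ae (sinCoef_bdd a b) (sinT ψ), cosT_ae hψ,
    sinT_ae hψ, ae_restrict_mem measurableSet_Ioi] with k h1 h2 h3 h4 h5 h6 hk
  rw [h1, h2, Pi.add_apply, h3, h4, h5, h6]
  have i1 := integrable_kernel_mul continuous_cosKernel abs_cosKernel_le hψ k
  have i2 := integrable_kernel_mul continuous_sinKernel abs_sinKernel_le hψ k
  rw [← integral_const_mul, ← integral_const_mul, ← integral_add (i1.const_mul _) (i2.const_mul _),
    ← integral_const_mul, ← integral_const_mul]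
  refine integral_congr_ae (ae_of_all _ fun x => ?_)
  simp only [conj_scalarPhysical hab d hk, cosKernel, sinKernel]
  push_cast
  ring

/-! ### Spectral measures of the scalar problem -/

theorem halfLineC_integrable_norm_sq (f : HalfLineC) :
    Integrable (fun k => ‖f k‖ ^ 2) halfLine :=
  (Lp.memLp f).integrable_norm_pow (by norm_num)

/-- Dominated convergence for multiplication operators. -/
theorem tendsto_mulOp {ι : Type*} {l : Filter ι} [l.IsCountablyGenerated] {m : ι → ℝ → ℂ}
    {m₀ : ℝ → ℂ} {C : ℝ} (hm : ∀ i, Measurable (m i)) (hm₀ : Measurable m₀)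
    (hC : ∀ i x, ‖m i x‖ ≤ C) (hC₀ : ∀ x, ‖m₀ x‖ ≤ C)
    (h : ∀ x, Tendsto (fun i => m i x) l (𝓝 (m₀ x))) (g : HalfLineC) :
    Tendsto (fun i => mulOp (m i) g) l (𝓝 (mulOp m₀ g)) := by
  rw [tendsto_iff_norm_sub_tendsto_zero]
  have h1 : ∀ i, ‖mulOp (m i) g - mulOp m₀ g‖ ^ 2 =
      ∫ x, (‖m i x - m₀ x‖ * ‖g x‖) ^ 2 ∂halfLine := by
    intro i
    rw [halfLineC_norm_sq]
    refine integral_congr_ae ?_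
    filter_upwards [mulOp_ae ⟨hm i, C, hC i⟩ g, mulOp_ae ⟨hm₀, C, hC₀⟩ g,
      Lp.coeFn_sub (mulOp (m i) g) (mulOp m₀ g)] with x e1 e2 e3
    rw [e3, Pi.sub_apply, e1, e2, ← sub_mul, norm_mul]
  have h2 : Tendsto (fun i => ∫ x, (‖m i x - m₀ x‖ * ‖g x‖) ^ 2 ∂halfLine) l
      (𝓝 (∫ _, (0 : ℝ) ∂halfLine)) := by
    refine tendsto_integral_filter_of_dominated_convergence (fun x => (2 * C) ^ 2 * ‖g x‖ ^ 2)
      (Eventually.of_forall fun i => ?_) (Eventually.of_forall fun i => ae_of_all _ fun x => ?_)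
      ((halfLineC_integrable_norm_sq g).const_mul _) (ae_of_all _ fun x => ?_)
    · exact ((((hm i).sub hm₀).norm.aestronglyMeasurable).mul (Lp.memLp g).1.norm).pow 2
    · rw [Real.norm_eq_abs, abs_of_nonneg (by positivity), mul_pow]
      gcongr
      have := (norm_sub_le (m i x) (m₀ x)).trans (add_le_add (hC i x) (hC₀ x))
      linarith
    · have h3 := (tendsto_iff_norm_sub_tendsto_zero.1 (h x)).mul_const ‖g x‖
      simpa using h3.pow 2
  rw [integral_zero] at h2
  have h3 : Tendsto (fun i => ‖mulOp (m i) g - mulOp m₀ g‖ ^ 2) l (𝓝 0) := by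
    simp_rw [h1]
    exact h2
  have h4 := h3.sqrt
  simpa [Real.sqrt_sq] using h4

/-- The indicator function of `S` with complex values. -/
noncomputable def indC (S : Set ℝ) : ℝ → ℂ := S.indicator fun _ => 1

theorem indC_bdd {S : Set ℝ} (hS : MeasurableSet S) : IsBddMeasurable (indC S) :=
  ⟨measurable_const.indicator hS, 1, fun x => by
    by_cases h : x ∈ S <;> simp [indC, h]⟩

theorem conj_indC (S : Set ℝ) (x : ℝ) : (starRingEnd ℂ) (indC S x) = indC S x := by
  by_cases h : x ∈ S <;> simp [indC, h]

theorem indC_mul_indC (S T : Set ℝ) (x : ℝ) : indC S x * indC T x = indC (S ∩ T) x := by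
  by_cases h : x ∈ S <;> by_cases h' : x ∈ T <;> simp [indC, h, h']

theorem sum_indC {S : ℕ → Set ℝ} (hd : Pairwise (Function.onFun Disjoint S)) (s : Finset ℕ)
    (x : ℝ) : ∑ i ∈ s, indC (S i) x = indC (⋃ i ∈ s, S i) x := by
  rw [indC, Finset.indicator_biUnion_apply s S (fun i _ j _ hij => hd hij)]
  rfl

theorem tendsto_indC_biUnion (S : ℕ → Set ℝ) (x : ℝ) :
    Tendsto (fun s : Finset ℕ => indC (⋃ i ∈ s, S i) x) atTop (𝓝 (indC (⋃ i, S i) x)) := by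
  refine tendsto_const_nhds.congr' ?_
  by_cases h : x ∈ ⋃ i, S i
  · obtain ⟨i, hi⟩ := mem_iUnion.1 h
    filter_upwards [eventually_ge_atTop {i}] with s hs
    have h2 : x ∈ ⋃ i ∈ s, S i := mem_biUnion (Finset.singleton_subset_iff.1 hs) hi
    simp only [indC, indicator_of_mem h, indicator_of_mem h2]
  · refine Eventually.of_forall fun s => ?_
    have h2 : x ∉ ⋃ i ∈ s, S i := fun hm => h (iUnion₂_subset_iUnion _ _ hm)
    simp only [indC, indicator_of_notMem h, indicator_of_notMem h2]

theorem mulOp_sum {ι : Type*} (s : Finset ι) {m : ι → ℝ → ℂ} (h : ∀ i, IsBddMeasurable (m i))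
    (g : HalfLineC) : IsBddMeasurable (fun x => ∑ i ∈ s, m i x) ∧
      ∑ i ∈ s, mulOp (m i) g = mulOp (fun x => ∑ i ∈ s, m i x) g := by
  classical
  induction s using Finset.induction_on with
  | empty => simp [IsBddMeasurable.const, mulOp_const]
  | insert i s hi ih =>
    have e : (fun x => ∑ j ∈ insert i s, m j x) = fun x => m i x + ∑ j ∈ s, m j x :=
      funext fun x => Finset.sum_insert hi
    rw [e, Finset.sum_insert hi, ih.2]
    refine ⟨(h i).add ih.1, Lp.ext ?_⟩
    filter_upwards [Lp.coeFn_add (mulOp (m i) g) (mulOp (fun x => ∑ j ∈ s, m j x) g),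
      mulOp_ae (h i) g, mulOp_ae ih.1 g, mulOp_ae ((h i).add ih.1) g] with x e1 e2 e3 e4
    rw [e1, Pi.add_apply, e2, e3, e4, add_mul]

theorem hasSum_robinCalc (a b : ℝ) {S : ℕ → Set ℝ} (hS : ∀ i, MeasurableSet (S i))
    (hd : Pairwise (Function.onFun Disjoint S)) (f : HalfLineC) :
    HasSum (fun i => robinCalc a b (indC (S i)) f) (robinCalc a b (indC (⋃ i, S i)) f) := by
  simp_rw [robinCalc_apply]
  refine ((robinGAdj a b).hasSum ?_).add (HasSum.smul_const ?_ _)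
  · rw [HasSum]
    simp only [SummationFilter.unconditional_filter]
    simp_rw [fun s : Finset ℕ => (mulOp_sum s (fun i => (indC_bdd (hS i)).comp_sq)
      (robinG a b f)).2, fun (s : Finset ℕ) (x : ℝ) => sum_indC hd s (x ^ 2)]
    have hb : ∀ T x, ‖indC T x‖ ≤ 1 := fun T x => by
      by_cases h : x ∈ T <;> simp [indC, h]
    exact tendsto_mulOp (C := 1) (fun s =>
      (indC_bdd (Finset.measurableSet_biUnion s fun i _ => hS i)).comp_sq.1)
      (indC_bdd (MeasurableSet.iUnion hS)).comp_sq.1 (fun s x => hb _ _) (fun x => hb _ _)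
      (fun x => tendsto_indC_biUnion S _) _
  · rw [HasSum]
    simp only [SummationFilter.unconditional_filter]
    simp_rw [fun s : Finset ℕ => sum_indC hd s (-(b / a) ^ 2)]
    exact tendsto_indC_biUnion S _

/-- The spectral measure of `ψ` for the scalar problem. -/
noncomputable def robinMeasure (a b : ℝ) (ψ : HalfLineC) : Measure ℝ :=
  (halfLine.withDensity fun k => ENNReal.ofReal (‖robinG a b ψ k‖ ^ 2)).map (fun k => k ^ 2) +
    ENNReal.ofReal (‖robinP a b ψ‖ ^ 2) • Measure.dirac (-(b / a) ^ 2)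

theorem aemeasurable_density (f : HalfLineC) :
    AEMeasurable (fun k => ENNReal.ofReal (‖f k‖ ^ 2)) halfLine :=
  (((Lp.memLp f).1.norm.aemeasurable).pow_const 2).ennreal_ofReal

/-- Finiteness makes bounded functions integrable, and also the identity once its square is. -/
instance (a b : ℝ) (ψ : HalfLineC) : IsFiniteMeasure (robinMeasure a b ψ) := by
  have h1 : IsFiniteMeasure
      (halfLine.withDensity fun k => ENNReal.ofReal (‖robinG a b ψ k‖ ^ 2)) :=
    isFiniteMeasure_withDensity_ofReal (halfLineC_integrable_norm_sq _).2
  have h2 : IsFiniteMeasure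
      (ENNReal.ofReal (‖robinP a b ψ‖ ^ 2) • Measure.dirac (-(b / a) ^ 2)) :=
    Measure.smul_finite _ ENNReal.ofReal_ne_top
  unfold robinMeasure
  infer_instance

theorem lintegral_robinMeasure (a b : ℝ) (ψ : HalfLineC) {F : ℝ → ENNReal} (hF : Measurable F) :
    ∫⁻ lam, F lam ∂robinMeasure a b ψ =
      (∫⁻ k, ENNReal.ofReal (‖robinG a b ψ k‖ ^ 2) * F (k ^ 2) ∂halfLine) +
        ENNReal.ofReal (‖robinP a b ψ‖ ^ 2) * F (-(b / a) ^ 2) := by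
  rw [robinMeasure, lintegral_add_measure, lintegral_map hF (by fun_prop),
    lintegral_withDensity_eq_lintegral_mul₀ (aemeasurable_density _)
      (g := fun k => F (k ^ 2)) ((hF.comp (by fun_prop)).aemeasurable), lintegral_smul_measure, lintegral_dirac]
  rfl

theorem integral_robinMeasure (a b : ℝ) (ψ : HalfLineC) {m : ℝ → ℂ} (hm : Measurable m)
    (hi : Integrable m (robinMeasure a b ψ)) :
    ∫ lam, m lam ∂robinMeasure a b ψ =
      (∫ k, ((‖robinG a b ψ k‖ ^ 2 : ℝ) : ℂ) * m (k ^ 2) ∂halfLine) +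
        ((‖robinP a b ψ‖ ^ 2 : ℝ) : ℂ) * m (-(b / a) ^ 2) := by
  rw [robinMeasure] at hi ⊢
  rw [integral_add_measure hi.left_of_add_measure hi.right_of_add_measure,
    integral_map (by fun_prop) hm.aestronglyMeasurable,
    integral_withDensity_eq_integral_toReal_smul₀ (aemeasurable_density _)
      (ae_of_all _ fun _ => ENNReal.ofReal_lt_top), integral_smul_measure, integral_dirac]
  congr 1
  · refine integral_congr_ae (ae_of_all _ fun k => ?_)
    simp only
    rw [ENNReal.toReal_ofReal (by positivity), Complex.real_smul]
  · rw [ENNReal.toReal_ofReal (by positivity), Complex.real_smul]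

theorem inner_robinP_self {a b : ℝ} (hab : a ≠ 0 ∨ b ≠ 0) (ψ : HalfLineC) :
    ⟪ψ, robinP a b ψ⟫_ℂ = ((‖robinP a b ψ‖ ^ 2 : ℝ) : ℂ) := by
  have h : ⟪robinP a b ψ, robinP a b ψ⟫_ℂ = ⟪ψ, robinP a b ψ⟫_ℂ := by
    rw [robinP_inner, robinP_robinP hab]
  rw [← h, inner_self_eq_norm_sq_to_K]
  norm_cast

theorem inner_robinG_eq (a b : ℝ) (ψ : HalfLineC) {g : HalfLineC} {q : ℝ → ℂ}
    (hg : g =ᵐ[halfLine] fun k => q k * robinG a b ψ k) :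
    ⟪ψ, robinGAdj a b g⟫_ℂ = ∫ k, ((‖robinG a b ψ k‖ ^ 2 : ℝ) : ℂ) * q k ∂halfLine := by
  rw [← robinG_inner, halfLineC_inner]
  refine integral_congr_ae ?_
  filter_upwards [hg] with k hk
  rw [hk, mul_left_comm, mul_comm (q k), ← Complex.normSq_eq_conj_mul_self,
    Complex.normSq_eq_norm_sq]

theorem inner_robinCalc_self {a b : ℝ} (hab : a ≠ 0 ∨ b ≠ 0) {m : ℝ → ℂ} (hm : IsBddMeasurable m)
    (ψ : HalfLineC) : Integrable m (robinMeasure a b ψ) ∧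
      ⟪ψ, robinCalc a b m ψ⟫_ℂ = ∫ lam, m lam ∂robinMeasure a b ψ := by
  obtain ⟨C, hC⟩ := hm.2
  have hi : Integrable m (robinMeasure a b ψ) :=
    Integrable.of_bound hm.1.aestronglyMeasurable C (ae_of_all _ hC)
  refine ⟨hi, ?_⟩
  rw [integral_robinMeasure a b ψ hm.1 hi, robinCalc_apply, inner_add_right, inner_smul_right,
    inner_robinP_self hab, inner_robinG_eq a b ψ (mulOp_ae hm.comp_sq _), mul_comm (m _)]

/-- The point mass is the only singular part. The rest is absolutely continuous because the inverse
of k ↦ k² on the positive axis, the square root, is differentiable there and so preserves null sets.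
-/
theorem robinMeasure_absolutelyContinuous_iff {a b : ℝ} {ψ : HalfLineC} :
    robinMeasure a b ψ ≪ volume ↔ robinP a b ψ = 0 := by
  constructor
  · intro h
    have h1 : robinMeasure a b ψ {-(b / a) ^ 2} = 0 := h (by simp)
    rw [robinMeasure, Measure.add_apply, add_eq_zero] at h1
    have h2 := h1.2
    rw [Measure.smul_apply, Measure.dirac_apply_of_mem (mem_singleton _), smul_eq_mul, mul_one,
      ENNReal.ofReal_eq_zero] at h2
    have h3 : ‖robinP a b ψ‖ ^ 2 = 0 := le_antisymm h2 (by positivity)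
    simpa using h3
  · intro h
    rw [robinMeasure, h, norm_zero]
    simp only [ne_eq, OfNat.ofNat_ne_zero, not_false_eq_true, zero_pow, ENNReal.ofReal_zero,
      zero_smul, add_zero]
    refine Measure.AbsolutelyContinuous.mk fun S hS h0 => ?_
    rw [Measure.map_apply (by fun_prop) hS]
    refine withDensity_absolutelyContinuous _ _ ?_
    rw [Measure.restrict_apply (hS.preimage (by fun_prop))]
    refine measure_mono_null (t := Real.sqrt '' (S ∩ Ioi 0)) ?_ ?_
    · rintro k ⟨hk1, hk2⟩
      have hk0 : 0 < k := hk2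
      exact ⟨k ^ 2, ⟨hk1, mem_Ioi.2 (by positivity)⟩, Real.sqrt_sq hk0.le⟩
    · refine addHaar_image_eq_zero_of_differentiableOn_of_addHaar_eq_zero volume ?_
        (measure_mono_null inter_subset_left h0)
      intro x hx
      exact (Real.hasDerivAt_sqrt (ne_of_gt hx.2)).differentiableAt.differentiableWithinAt

/-- Both sides say that k²Gψ is square integrable; the point mass contributes a finite amount in any
case. -/
theorem exists_isRobin_iff {a b : ℝ} (hab : a ≠ 0 ∨ b ≠ 0) {ψ : HalfLineC} :
    (∃ χ, IsRobin a b ψ χ) ↔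
      ∫⁻ lam, ENNReal.ofReal (lam ^ 2) ∂robinMeasure a b ψ < ⊤ := by
  have hm : AEStronglyMeasurable (fun k : ℝ => ((k ^ 2 : ℝ) : ℂ) * robinG a b ψ k) halfLine :=
    (Continuous.aestronglyMeasurable (by fun_prop)).mul (Lp.memLp _).1
  have h1 : (∃ χ, IsRobin a b ψ χ) ↔
      MemLp (fun k : ℝ => ((k ^ 2 : ℝ) : ℂ) * robinG a b ψ k) 2 halfLine := by
    constructor
    · rintro ⟨χ, h⟩
      obtain ⟨g₂, h2, _⟩ := (isRobin_iff hab).1 h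
      exact (memLp_congr_ae h2).1 (Lp.memLp g₂)
    · intro h
      exact ⟨_, (isRobin_iff hab).2 ⟨h.toLp _, h.coeFn_toLp, rfl⟩⟩
  rw [h1, memLp_two_iff_integrable_sq_norm hm, lintegral_robinMeasure a b ψ (by fun_prop)]
  have h2 : ENNReal.ofReal (‖robinP a b ψ‖ ^ 2) * ENNReal.ofReal ((-(b / a) ^ 2) ^ 2) < ⊤ :=
    ENNReal.mul_lt_top ENNReal.ofReal_lt_top ENNReal.ofReal_lt_top
  rw [ENNReal.add_lt_top, and_iff_left h2]
  have h3 : ∀ k, ENNReal.ofReal (‖robinG a b ψ k‖ ^ 2) * ENNReal.ofReal ((k ^ 2) ^ 2) =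
      ENNReal.ofReal (‖((k ^ 2 : ℝ) : ℂ) * robinG a b ψ k‖ ^ 2) := by
    intro k
    rw [← ENNReal.ofReal_mul (by positivity), norm_mul, mul_pow, Complex.norm_real,
      Real.norm_eq_abs, sq_abs, mul_comm]
  simp_rw [h3]
  have hm2 : AEStronglyMeasurable (fun k : ℝ => ‖((k ^ 2 : ℝ) : ℂ) * robinG a b ψ k‖ ^ 2)
      halfLine := hm.norm.pow 2
  rw [← hasFiniteIntegral_iff_ofReal (ae_of_all _ fun k => by positivity)]
  exact ⟨fun h => h.2, fun h => ⟨hm2, h⟩⟩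

theorem integrable_id_of_lintegral_sq {μ : Measure ℝ} [IsFiniteMeasure μ]
    (h : ∫⁻ lam, ENNReal.ofReal (lam ^ 2) ∂μ < ⊤) : Integrable (fun lam : ℝ => lam) μ := by
  have h1 : MemLp (fun lam : ℝ => lam) 2 μ := by
    rw [memLp_two_iff_integrable_sq (Continuous.aestronglyMeasurable (by fun_prop))]
    exact ⟨Continuous.aestronglyMeasurable (by fun_prop),
      (hasFiniteIntegral_iff_ofReal (ae_of_all _ fun k => by positivity)).2 h⟩
  exact h1.integrable (by norm_num)

theorem IsRobin.inner_eq {a b : ℝ} (hab : a ≠ 0 ∨ b ≠ 0) {ψ χ : HalfLineC}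
    (h : IsRobin a b ψ χ) : Integrable (fun lam : ℝ => lam) (robinMeasure a b ψ) ∧
      ⟪ψ, χ⟫_ℂ = ((∫ lam, lam ∂robinMeasure a b ψ : ℝ) : ℂ) := by
  have h1 := integrable_id_of_lintegral_sq ((exists_isRobin_iff hab).1 ⟨χ, h⟩)
  refine ⟨h1, ?_⟩
  obtain ⟨g₂, h2, h3⟩ := (isRobin_iff hab).1 h
  rw [← integral_complex_ofReal,
    integral_robinMeasure a b ψ (m := fun x => (x : ℂ)) (by fun_prop) h1.ofReal, h3, inner_add_right, inner_smul_right,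
    inner_robinP_self hab, inner_robinG_eq a b ψ h2, mul_comm (((-(b / a) ^ 2 : ℝ)) : ℂ)]

/-! ### Diagonalization of the boundary condition -/

theorem exists_real_det_add_smul_ne_zero {n : ℕ} (A B : Matrix (Fin n) (Fin n) ℂ)
    (hAB : -(B.conjTranspose * A) + A.conjTranspose * B = 0)
    (hpos : (A.conjTranspose * A + B.conjTranspose * B).PosDef) :
    ∃ α : ℝ, (A + (α : ℂ) • B).det ≠ 0 := by
  -- At z = i the mixed terms of (A + zB)†(A + zB) cancel by A†B = B†A, leaving the positive
  -- definite matrix.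
  have h0 : (A + Complex.I • B).det ≠ 0 := by
    have h1 : (A + Complex.I • B).conjTranspose * (A + Complex.I • B) =
        A.conjTranspose * A + B.conjTranspose * B := by
      rw [Matrix.conjTranspose_add, Matrix.conjTranspose_smul, add_mul, mul_add, mul_add,
        Matrix.smul_mul, Matrix.smul_mul, Matrix.mul_smul, Matrix.mul_smul, smul_smul]
      have h2 : A.conjTranspose * B = B.conjTranspose * A := by
        rw [← sub_eq_zero, ← hAB]; abel
      rw [h2]
      simp only [RCLike.star_def, Complex.conj_I, neg_mul, Complex.I_mul_I, neg_neg, one_smul,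
        neg_smul]
      abel
    intro h
    have h3 := congrArg Matrix.det h1
    rw [Matrix.det_mul, h, mul_zero] at h3
    exact hpos.det_pos.ne h3
  -- The determinant is a polynomial in z, nonzero at i, so it cannot vanish at every real number.
  set p : Polynomial ℂ :=
    (A.map Polynomial.C + (Polynomial.X : Polynomial ℂ) • B.map Polynomial.C).det with hp
  have hev : ∀ z, p.eval z = (A + z • B).det := by
    intro z
    rw [hp, ← Polynomial.coe_evalRingHom, RingHom.map_det]
    congr 1
    ext i j
    simp
    exact mul_comm _ _
  by_contra! h
  have hz : p = 0 := Polynomial.eq_zero_of_infinite_isRoot p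
    ((Set.infinite_range_of_injective Complex.ofReal_injective).mono (by
      rintro _ ⟨α, rfl⟩
      exact (hev α).trans (h α)))
  exact h0 (by rw [← hev, hz, Polynomial.eval_zero])

/-- Simultaneous diagonalization of the matrices of a self-adjoint boundary condition. -/
theorem exists_diagonal_boundary {n : ℕ} (A B : Matrix (Fin n) (Fin n) ℂ)
    (hAB : -(B.conjTranspose * A) + A.conjTranspose * B = 0)
    (hpos : (A.conjTranspose * A + B.conjTranspose * B).PosDef) :
    ∃ (M T : Matrix (Fin n) (Fin n) ℂ) (a b : Fin n → ℝ),
      M.conjTranspose * M = 1 ∧ IsUnit T ∧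
      A = M * Matrix.diagonal (fun j => (a j : ℂ)) * T ∧
      B = M * Matrix.diagonal (fun j => (b j : ℂ)) * T ∧ ∀ j, a j ≠ 0 ∨ b j ≠ 0 := by
  obtain ⟨α, hα⟩ := exists_real_det_add_smul_ne_zero A B hAB hpos
  set X := A + (α : ℂ) • B with hX
  have hu : IsUnit X := (Matrix.isUnit_iff_isUnit_det X).2 hα.isUnit
  have hdet : IsUnit X.det := hα.isUnit
  have hdet' : IsUnit X.conjTranspose.det := by
    rw [Matrix.det_conjTranspose]
    exact hdet.star
  -- This makes BX⁻¹ Hermitian; the reality of α enters here.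
  have hsymm : B.conjTranspose * X = X.conjTranspose * B := by
    rw [hX, Matrix.conjTranspose_add, Matrix.conjTranspose_smul, add_mul, mul_add,
      Matrix.smul_mul, Matrix.mul_smul]
    have h2 : A.conjTranspose * B = B.conjTranspose * A := by
      rw [← sub_eq_zero, ← hAB]; abel
    rw [h2]
    simp
  have hK : (B * X⁻¹).IsHermitian := by
    rw [Matrix.IsHermitian, Matrix.conjTranspose_mul, Matrix.conjTranspose_nonsing_inv]
    calc (X.conjTranspose)⁻¹ * B.conjTranspose
        = (X.conjTranspose)⁻¹ * (B.conjTranspose * X) * X⁻¹ := by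
          rw [mul_assoc, mul_assoc, Matrix.mul_nonsing_inv _ hdet, mul_one]
      _ = B * X⁻¹ := by
          rw [hsymm, ← mul_assoc, Matrix.nonsing_inv_mul _ hdet', one_mul]
  set M : Matrix (Fin n) (Fin n) ℂ := hK.eigenvectorUnitary.1 with hM
  have hM1 : M.conjTranspose * M = 1 := Unitary.star_mul_self_of_mem hK.eigenvectorUnitary.2
  have hM2 : M * M.conjTranspose = 1 := Unitary.mul_star_self_of_mem hK.eigenvectorUnitary.2
  set D := Matrix.diagonal (fun j => (hK.eigenvalues j : ℂ)) with hD
  have hsp : B * X⁻¹ = M * D * M.conjTranspose := by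
    have := hK.spectral_theorem
    rw [Unitary.conjStarAlgAut_apply] at this
    exact this
  have hB : B = M * D * (M.conjTranspose * X) := by
    rw [← mul_assoc, ← hsp, mul_assoc, Matrix.nonsing_inv_mul _ hdet, mul_one]
  -- With BX⁻¹ = MDM† one has B = MD(M†X) and A = X − αB = M(1 − αD)(M†X). The entries 1 − αλ and λ
  -- cannot both vanish.
  refine ⟨M, M.conjTranspose * X, fun j => 1 - α * hK.eigenvalues j, hK.eigenvalues, hM1,
    IsUnit.mul ?_ hu, ?_, hB, fun j => ?_⟩
  · exact ⟨⟨M.conjTranspose, M, hM1, hM2⟩, rfl⟩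
  · have h1 : Matrix.diagonal (fun j => ((1 - α * hK.eigenvalues j : ℝ) : ℂ)) =
        1 - (α : ℂ) • D := by
      rw [hD, ← Matrix.diagonal_one, ← Matrix.diagonal_smul, Matrix.diagonal_sub]
      congr 1
      funext j
      simp
    rw [h1, mul_sub, sub_mul, mul_one, ← mul_assoc, hM2, one_mul, Matrix.mul_smul, Matrix.smul_mul,
      ← hB, hX, add_sub_cancel_right]
  · by_cases h : hK.eigenvalues j = 0
    · left; simp [h]
    · exact Or.inr h

/-- Coordinates of the Euclidean linear map of a matrix. -/
theorem toEuclideanLin_coord {n : ℕ} (P : Matrix (Fin n) (Fin n) ℂ)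
    (v : EuclideanSpace ℂ (Fin n)) : (P.toEuclideanLin v).ofLp = P.mulVec v.ofLp := rfl

section Columns

variable {n : ℕ} {M : Matrix (Fin n) (Fin n) ℂ}

/-- The columns of a unitary matrix. -/
noncomputable def matCol (M : Matrix (Fin n) (Fin n) ℂ) (j : Fin n) : EuclideanSpace ℂ (Fin n) :=
  WithLp.toLp 2 fun i => M i j

theorem inner_matCol (M : Matrix (Fin n) (Fin n) ℂ) (j : Fin n) (v : EuclideanSpace ℂ (Fin n)) :
    ⟪matCol M j, v⟫_ℂ = M.conjTranspose.toEuclideanLin v j := by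
  rw [toEuclideanLin_coord, PiLp.inner_apply]
  simp [matCol, Matrix.mulVec, dotProduct, mul_comm]

theorem toEuclideanLin_mul_apply (P Q : Matrix (Fin n) (Fin n) ℂ) (v : EuclideanSpace ℂ (Fin n)) :
    (P * Q).toEuclideanLin v = P.toEuclideanLin (Q.toEuclideanLin v) := by
  ext i
  simp only [toEuclideanLin_coord, Matrix.mulVec_mulVec]

theorem inner_matCol_matCol (hM : M.conjTranspose * M = 1) (i j : Fin n) :
    ⟪matCol M i, matCol M j⟫_ℂ = if i = j then 1 else 0 := by
  rw [inner_matCol, toEuclideanLin_coord, ← Matrix.one_apply, ← hM]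
  rfl

theorem sum_inner_matCol (hM : M.conjTranspose * M = 1) (v : EuclideanSpace ℂ (Fin n)) :
    ∑ j, ⟪matCol M j, v⟫_ℂ • matCol M j = v := by
  have hM2 : M * M.conjTranspose = 1 := mul_eq_one_comm.1 hM
  have h : M.toEuclideanLin (M.conjTranspose.toEuclideanLin v) = v := by
    rw [← toEuclideanLin_mul_apply, hM2]
    ext i
    simp
  conv_rhs => rw [← h]
  ext i
  simp only [inner_matCol, toEuclideanLin_coord]
  simp [Matrix.mulVec, dotProduct, matCol, mul_comm]

theorem ext_inner_matCol (hM : M.conjTranspose * M = 1) {v w : EuclideanSpace ℂ (Fin n)}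
    (h : ∀ j, ⟪matCol M j, v⟫_ℂ = ⟪matCol M j, w⟫_ℂ) : v = w := by
  rw [← sum_inner_matCol hM v, ← sum_inner_matCol hM w]
  simp_rw [h]

/-- The boundary condition in terms of the components with respect to the columns of `M`. -/
theorem boundary_condition_iff {A B T : Matrix (Fin n) (Fin n) ℂ} {a b : Fin n → ℝ}
    (hT : IsUnit T) (hA : A = M * Matrix.diagonal (fun j => (a j : ℂ)) * T)
    (hB : B = M * Matrix.diagonal (fun j => (b j : ℂ)) * T) (α β : EuclideanSpace ℂ (Fin n)) :
    -(B.conjTranspose.toEuclideanLin α) + A.conjTranspose.toEuclideanLin β = 0 ↔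
      ∀ j, -(b j * ⟪matCol M j, α⟫_ℂ) + a j * ⟪matCol M j, β⟫_ℂ = 0 := by
  have hd : ∀ (c : Fin n → ℝ) (v : EuclideanSpace ℂ (Fin n)),
      (M * Matrix.diagonal (fun j => (c j : ℂ)) * T).conjTranspose.toEuclideanLin v =
      T.conjTranspose.toEuclideanLin (WithLp.toLp 2 fun j => c j * ⟪matCol M j, v⟫_ℂ) := by
    intro c v
    rw [Matrix.conjTranspose_mul, Matrix.conjTranspose_mul, toEuclideanLin_mul_apply,
      toEuclideanLin_mul_apply]
    congr 1
    ext j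
    rw [toEuclideanLin_coord, Matrix.diagonal_conjTranspose, Matrix.mulVec_diagonal]
    simp only [inner_matCol, Pi.star_apply, RCLike.star_def, Complex.conj_ofReal]
  have hinj : ∀ v, T.conjTranspose.toEuclideanLin v = 0 ↔ v = 0 := by
    intro v
    refine ⟨fun h => ?_, fun h => by rw [h, map_zero]⟩
    obtain ⟨S, hS⟩ := hT.star.exists_left_inv
    have h1 : (S * T.conjTranspose).toEuclideanLin v = 0 := by
      rw [toEuclideanLin_mul_apply, h, map_zero]
    rw [← Matrix.star_eq_conjTranspose, hS] at h1
    rw [← h1]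
    ext i
    simp
  rw [hA, hB, hd, hd, ← map_neg, ← map_add, hinj]
  constructor
  · intro h j
    have := congrArg (fun v : EuclideanSpace ℂ (Fin n) => v j) h
    simpa using this
  · intro h
    ext j
    simpa using h j

/-- The components of the physical solution. -/
theorem inner_matCol_physicalSolution (hM : M.conjTranspose * M = 1)
    {A B T : Matrix (Fin n) (Fin n) ℂ} {a b : Fin n → ℝ}
    (hT : IsUnit T) (hA : A = M * Matrix.diagonal (fun j => (a j : ℂ)) * T)
    (hB : B = M * Matrix.diagonal (fun j => (b j : ℂ)) * T) {κ : ℝ}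
    (hκ : ∀ j, (b j - Complex.I * κ * a j : ℂ) ≠ 0) (x : ℝ) (v : EuclideanSpace ℂ (Fin n))
    (j : Fin n) :
    ⟪matCol M j, (physicalSolution A B κ x).conjTranspose.toEuclideanLin v⟫_ℂ =
      (starRingEnd ℂ) (scalarPhysical (a j) (b j) κ x) * ⟪matCol M j, v⟫_ℂ := by
  have hM2 : M * M.conjTranspose = 1 := mul_eq_one_comm.1 hM
  have hTd : IsUnit T.det := (Matrix.isUnit_iff_isUnit_det T).1 hT
  have hlin : ∀ c s : ℂ, c • A + s • B =
      M * Matrix.diagonal (fun j => c * a j + s * b j) * T := by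
    intro c s
    have : Matrix.diagonal (fun j => c * a j + s * b j) =
        c • Matrix.diagonal (fun j => (a j : ℂ)) + s • Matrix.diagonal (fun j => (b j : ℂ)) := by
      rw [← Matrix.diagonal_smul, ← Matrix.diagonal_smul, Matrix.diagonal_add]
      rfl
    rw [this, mul_add, add_mul, Matrix.mul_smul, Matrix.mul_smul, Matrix.smul_mul, Matrix.smul_mul,
      ← hA, ← hB]
  have hJ : jostMatrix A B κ =
      M * Matrix.diagonal (fun j => (b j - Complex.I * κ * a j : ℂ)) * T := by
    have h1 := hlin (-(Complex.I * κ)) 1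
    rw [one_smul, neg_smul, neg_add_eq_sub] at h1
    rw [jostMatrix, h1]
    congr 3
    funext j
    ring
  have hJi : (jostMatrix A B κ)⁻¹ =
      T⁻¹ * (Matrix.diagonal (fun j => (b j - Complex.I * κ * a j : ℂ)⁻¹) * M.conjTranspose) := by
    refine Matrix.inv_eq_right_inv ?_
    rw [hJ]
    calc M * Matrix.diagonal (fun j => (b j - Complex.I * κ * a j : ℂ)) * T *
          (T⁻¹ * (Matrix.diagonal (fun j => (b j - Complex.I * κ * a j : ℂ)⁻¹) * M.conjTranspose))
        = M * (Matrix.diagonal (fun j => (b j - Complex.I * κ * a j : ℂ)) * (T * T⁻¹) *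
          Matrix.diagonal (fun j => (b j - Complex.I * κ * a j : ℂ)⁻¹)) * M.conjTranspose := by
          simp only [mul_assoc]
      _ = 1 := by
          rw [Matrix.mul_nonsing_inv _ hTd, mul_one, Matrix.diagonal_mul_diagonal]
          simp_rw [fun j => mul_inv_cancel₀ (hκ j)]
          rw [Matrix.diagonal_one, mul_one, hM2]
  -- The factor T of the regular solution meets the T⁻¹ of the inverse Jost matrix, so the physical
  -- solution is diagonal in the unitary basis.
  have hφ : physicalSolution A B κ x =
      M * Matrix.diagonal (fun j => scalarPhysical (a j) (b j) κ x) * M.conjTranspose := by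
    rw [physicalSolution, regularSolution, hlin, hJi]
    calc _ = M * ((-(Complex.I * κ)) • (Matrix.diagonal (fun j => (Real.cos (κ * x) : ℂ) * a j +
            ((x * Real.sinc (κ * x) : ℝ) : ℂ) * b j) * (T * T⁻¹) *
          Matrix.diagonal (fun j => (b j - Complex.I * κ * a j : ℂ)⁻¹))) * M.conjTranspose := by
          simp only [mul_assoc, Matrix.mul_smul, Matrix.smul_mul]
      _ = _ := by
          rw [Matrix.mul_nonsing_inv _ hTd, mul_one, Matrix.diagonal_mul_diagonal,
            ← Matrix.diagonal_smul]
          congr 3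
          funext j
          simp only [Pi.smul_apply, smul_eq_mul, scalarPhysical]
          ring
  rw [hφ, Matrix.conjTranspose_mul, Matrix.conjTranspose_mul, Matrix.conjTranspose_conjTranspose,
    inner_matCol, ← toEuclideanLin_mul_apply, ← mul_assoc, hM, one_mul, toEuclideanLin_mul_apply,
    toEuclideanLin_coord, Matrix.diagonal_conjTranspose, Matrix.mulVec_diagonal,
    inner_matCol]
  rfl

end Columns

section Components

variable {n : ℕ} {M : Matrix (Fin n) (Fin n) ℂ}

/-- The component of a vector-valued function along a column of `M`. -/
noncomputable def colComp (M : Matrix (Fin n) (Fin n) ℂ) (j : Fin n) :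
    HalfLineL2 n →L[ℂ] HalfLineC :=
  (innerSL ℂ (matCol M j)).compLpL 2 halfLine

/-- The vector-valued function with a given component along a column of `M`. -/
noncomputable def colEmbed (M : Matrix (Fin n) (Fin n) ℂ) (j : Fin n) :
    HalfLineC →L[ℂ] HalfLineL2 n :=
  (ContinuousLinearMap.toSpanSingleton ℂ (matCol M j)).compLpL 2 halfLine

theorem colComp_ae (j : Fin n) (ψ : HalfLineL2 n) :
    colComp M j ψ =ᵐ[halfLine] fun x => ⟪matCol M j, ψ x⟫_ℂ :=
  (innerSL ℂ (matCol M j)).coeFn_compLpL ψ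

theorem colEmbed_ae (j : Fin n) (f : HalfLineC) :
    colEmbed M j f =ᵐ[halfLine] fun x => f x • matCol M j :=
  (ContinuousLinearMap.toSpanSingleton ℂ (matCol M j)).coeFn_compLpL f

theorem colComp_colEmbed (hM : M.conjTranspose * M = 1) (i j : Fin n) (f : HalfLineC) :
    colComp M i (colEmbed M j f) = if i = j then f else 0 := by
  apply Lp.ext
  have h0 := Lp.coeFn_zero ℂ 2 halfLine
  filter_upwards [colComp_ae i (colEmbed M j f), colEmbed_ae (M := M) j f, h0] with x h1 h2 h3
  rw [h1, h2, inner_smul_right, inner_matCol_matCol hM]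
  split_ifs with h
  · rw [mul_one]
  · rw [mul_zero, h3, Pi.zero_apply]

theorem colComp_sum_colEmbed (hM : M.conjTranspose * M = 1) (f : Fin n → HalfLineC) (i : Fin n) :
    colComp M i (∑ j, colEmbed M j (f j)) = f i := by
  rw [map_sum]
  simp_rw [colComp_colEmbed hM]
  simp

theorem ext_colComp (hM : M.conjTranspose * M = 1) {ψ φ : HalfLineL2 n}
    (h : ∀ j, colComp M j ψ = colComp M j φ) : ψ = φ := by
  apply Lp.ext
  filter_upwards [ae_all_iff.2 fun j => colComp_ae (M := M) j ψ,
    ae_all_iff.2 fun j => colComp_ae (M := M) j φ] with x h1 h2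
  exact ext_inner_matCol hM fun j => by rw [← h1, ← h2, h]

theorem sum_colEmbed_colComp (hM : M.conjTranspose * M = 1) (ψ : HalfLineL2 n) :
    ∑ j, colEmbed M j (colComp M j ψ) = ψ :=
  ext_colComp hM fun i => colComp_sum_colEmbed hM _ i

theorem colEmbed_inner (j : Fin n) (f : HalfLineC) (ψ : HalfLineL2 n) :
    ⟪colEmbed M j f, ψ⟫_ℂ = ⟪f, colComp M j ψ⟫_ℂ := by
  rw [L2.inner_def, halfLineC_inner]
  refine integral_congr_ae ?_
  filter_upwards [colComp_ae (M := M) j ψ, colEmbed_ae (M := M) j f] with x h1 h2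
  rw [h1, h2, inner_smul_left]

/-- The space is the orthogonal sum of n copies of scalar L², one per column of M; every
vector-valued claim below is checked component by component. -/
theorem inner_eq_sum_colComp (hM : M.conjTranspose * M = 1) (ψ φ : HalfLineL2 n) :
    ⟪ψ, φ⟫_ℂ = ∑ j, ⟪colComp M j ψ, colComp M j φ⟫_ℂ := by
  conv_lhs => rw [← sum_colEmbed_colComp hM ψ, sum_inner]
  simp_rw [colEmbed_inner]

theorem norm_eq_of_colComp (hM : M.conjTranspose * M = 1) {ψ φ : HalfLineL2 n}
    (h : ∀ j, ‖colComp M j ψ‖ = ‖colComp M j φ‖) : ‖ψ‖ = ‖φ‖ := by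
  have e : ⟪ψ, ψ⟫_ℂ = ⟪φ, φ⟫_ℂ := by
    rw [inner_eq_sum_colComp hM, inner_eq_sum_colComp hM φ]
    simp_rw [inner_self_eq_norm_sq_to_K, h]
  rw [inner_self_eq_norm_sq_to_K, inner_self_eq_norm_sq_to_K] at e
  have h2 : ‖ψ‖ ^ 2 = ‖φ‖ ^ 2 := by exact_mod_cast e
  exact (sq_eq_sq₀ (norm_nonneg _) (norm_nonneg _)).1 h2

theorem tendsto_of_colComp (hM : M.conjTranspose * M = 1) {ι : Type*} {l : Filter ι}
    {f : ι → HalfLineL2 n} {ψ : HalfLineL2 n}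
    (h : ∀ j, Tendsto (fun i => colComp M j (f i)) l (𝓝 (colComp M j ψ))) :
    Tendsto f l (𝓝 ψ) := by
  have := tendsto_finsetSum Finset.univ fun j _ =>
    ((colEmbed M j).continuous.tendsto _).comp (h j)
  simpa only [Function.comp_def, sum_colEmbed_colComp hM] using this

/-- The operator that acts on the components along the columns of `M`. -/
noncomputable def colOp (M : Matrix (Fin n) (Fin n) ℂ) (T : Fin n → HalfLineC →L[ℂ] HalfLineC) :
    HalfLineL2 n →L[ℂ] HalfLineL2 n :=
  ∑ j, colEmbed M j ∘L T j ∘L colComp M j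

theorem colComp_colOp (hM : M.conjTranspose * M = 1) (T : Fin n → HalfLineC →L[ℂ] HalfLineC)
    (j : Fin n) (ψ : HalfLineL2 n) : colComp M j (colOp M T ψ) = T j (colComp M j ψ) := by
  rw [colOp, sum_apply]
  exact colComp_sum_colEmbed hM (fun j => T j (colComp M j ψ)) j

theorem colOp_inner (hM : M.conjTranspose * M = 1) {T S : Fin n → HalfLineC →L[ℂ] HalfLineC}
    (h : ∀ j f g, ⟪S j f, g⟫_ℂ = ⟪f, T j g⟫_ℂ) (ψ φ : HalfLineL2 n) :
    ⟪colOp M S ψ, φ⟫_ℂ = ⟪ψ, colOp M T φ⟫_ℂ := by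
  rw [inner_eq_sum_colComp hM, inner_eq_sum_colComp hM ψ]
  simp_rw [colComp_colOp hM, h]

/-! ### The operator in components -/

theorem integral_colComp (j : Fin n) (ψ : HalfLineL2 n) {η : ℝ → ℝ} (hη : Continuous η)
    (hc : HasCompactSupport η) : ∫ x, (η x : ℂ) * colComp M j ψ x ∂halfLine =
      ⟪matCol M j, ∫ x, η x • ψ x ∂halfLine⟫_ℂ := by
  have h := (innerSL ℂ (matCol M j)).integral_comp_comm
    (integrable_smul_of_testFunction ψ hη hc)
  rw [innerSL_apply_apply] at h
  rw [← h]
  refine integral_congr_ae ?_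
  filter_upwards [colComp_ae (M := M) j ψ] with x hx
  rw [hx, innerSL_apply_apply, inner_smul_right_eq_smul, Complex.real_smul]

theorem isWeakDeriv_iff (hM : M.conjTranspose * M = 1) {ψ φ : HalfLineL2 n} :
    IsWeakDeriv ψ φ ↔ ∀ j, IsWeakDerivC (colComp M j ψ) (colComp M j φ) := by
  constructor
  · intro h j η hη hc hs
    rw [integral_colComp j ψ (hη.continuous_deriv (by simp)) hc.deriv,
      integral_colComp j φ hη.continuous hc, h η hη hc hs, inner_neg_right]
  · intro h η hη hc hs
    refine ext_inner_matCol hM fun j => ?_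
    rw [inner_neg_right, ← integral_colComp j ψ (hη.continuous_deriv (by simp)) hc.deriv,
      ← integral_colComp j φ hη.continuous hc, h j η hη hc hs]

theorem HasBoundaryValue.colComp {ψ : HalfLineL2 n} {α : EuclideanSpace ℂ (Fin n)}
    (h : HasBoundaryValue ψ α) (j : Fin n) :
    HasBoundaryValueC (colComp M j ψ) ⟪matCol M j, α⟫_ℂ := by
  obtain ⟨u, hu, hψ, rfl⟩ := h
  refine ⟨fun x => ⟪matCol M j, u x⟫_ℂ, continuousOn_const.inner hu, ?_, rfl⟩
  filter_upwards [hψ, colComp_ae (M := M) j ψ] with x h1 h2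
  rw [h2, h1]

theorem hasBoundaryValue_of_colComp (hM : M.conjTranspose * M = 1) {ψ : HalfLineL2 n}
    {α : Fin n → ℂ} (h : ∀ j, HasBoundaryValueC (colComp M j ψ) (α j)) :
    HasBoundaryValue ψ (∑ j, α j • matCol M j) := by
  choose u hu hψ hα using h
  refine ⟨fun x => ∑ j, u j x • matCol M j,
    continuousOn_finsetSum _ fun j _ => (hu j).smul continuousOn_const, ?_, by simp_rw [hα]⟩
  filter_upwards [ae_all_iff.2 hψ, ae_all_iff.2 fun j => colComp_ae (M := M) j ψ] with x h1 h2
  simp_rw [h1, h2]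
  exact sum_inner_matCol hM _

theorem inner_matCol_sum (hM : M.conjTranspose * M = 1) (α : Fin n → ℂ) (i : Fin n) :
    ⟪matCol M i, ∑ j, α j • matCol M j⟫_ℂ = α i := by
  rw [inner_sum]
  simp_rw [inner_smul_right, inner_matCol_matCol hM]
  simp

theorem mem_laplacianGraph_iff (hM : M.conjTranspose * M = 1)
    {A B T : Matrix (Fin n) (Fin n) ℂ} {a b : Fin n → ℝ}
    (hT : IsUnit T) (hA : A = M * Matrix.diagonal (fun j => (a j : ℂ)) * T)
    (hB : B = M * Matrix.diagonal (fun j => (b j : ℂ)) * T) {ψ χ : HalfLineL2 n} :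
    (ψ, χ) ∈ laplacianGraph A B ↔
      ∀ j, IsRobin (a j) (b j) (colComp M j ψ) (colComp M j χ) := by
  constructor
  · rintro ⟨dψ, ddψ, α, β, h1, h2, h3, h4, h5, h6⟩ j
    simp only at h1 h3 h6
    refine ⟨colComp M j dψ, colComp M j ddψ, _, _, (isWeakDeriv_iff hM).1 h1 j,
      (isWeakDeriv_iff hM).1 h2 j, h3.colComp j, h4.colComp j,
      (boundary_condition_iff hT hA hB α β).1 h5 j, by rw [h6, map_neg]⟩
  -- The scalar derivatives and boundary values of the components are reassembled along the columns
  -- of M.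
  · intro h
    choose dψ ddψ α β h1 h2 h3 h4 h5 h6 using h
    refine ⟨∑ j, colEmbed M j (dψ j), ∑ j, colEmbed M j (ddψ j), _, _,
      (isWeakDeriv_iff hM).2 fun j => ?_, (isWeakDeriv_iff hM).2 fun j => ?_,
      hasBoundaryValue_of_colComp hM h3,
      hasBoundaryValue_of_colComp hM (α := β) fun j => ?_, ?_, ?_⟩
    · rw [colComp_sum_colEmbed hM]; exact h1 j
    · rw [colComp_sum_colEmbed hM, colComp_sum_colEmbed hM]; exact h2 j
    · rw [colComp_sum_colEmbed hM]; exact h4 j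
    · rw [boundary_condition_iff hT hA hB]
      intro j
      rw [inner_matCol_sum hM, inner_matCol_sum hM]
      exact h5 j
    · refine ext_colComp hM fun j => ?_
      rw [map_neg, colComp_sum_colEmbed hM]
      exact h6 j

/-! ### The spectral measure -/

/-- The spectral measure that acts on the components by the Robin functional calculus. -/
noncomputable def robinPVM (hM : M.conjTranspose * M = 1) {a b : Fin n → ℝ}
    (hab : ∀ j, a j ≠ 0 ∨ b j ≠ 0) : ProjectionValuedMeasure (HalfLineL2 n) where
  proj S := colOp M fun j => robinCalc (a j) (b j) (indC S)
  isStarProjection S hS := by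
    refine ⟨?_, ?_⟩
    · ext1 ψ
      refine ext_colComp hM fun j => ?_
      rw [mul_apply_eq_comp, colComp_colOp hM, colComp_colOp hM,
        robinCalc_robinCalc (hab j) (indC_bdd hS) (indC_bdd hS)]
      simp_rw [indC_mul_indC, inter_self]
    · rw [ContinuousLinearMap.isSelfAdjoint_iff_isSymmetric]
      refine colOp_inner hM fun j f g => ?_
      rw [← robinCalc_inner (indC_bdd hS)]
      simp_rw [conj_indC]
  proj_univ := by
    ext1 ψ
    refine ext_colComp hM fun j => ?_
    have h : indC univ = fun _ => 1 := by simp [indC]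
    rw [colComp_colOp hM, h, robinCalc_one, one_apply_eq_self]
  proj_inter S T hS hT := by
    ext1 ψ
    refine ext_colComp hM fun j => ?_
    rw [mul_apply_eq_comp, colComp_colOp hM, colComp_colOp hM, colComp_colOp hM,
      robinCalc_robinCalc (hab j) (indC_bdd hS) (indC_bdd hT)]
    simp_rw [indC_mul_indC]
  hasSum_proj S hS hd ψ := by
    refine tendsto_of_colComp hM fun j => ?_
    have h := hasSum_robinCalc (a j) (b j) hS hd (colComp M j ψ)
    simp_rw [map_sum, colComp_colOp hM]
    exact h

section Spectral

variable (hM : M.conjTranspose * M = 1) {a b : Fin n → ℝ} (hab : ∀ j, a j ≠ 0 ∨ b j ≠ 0)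

theorem robinPVM_proj (S : Set ℝ) :
    (robinPVM hM hab).proj S = colOp M fun j => robinCalc (a j) (b j) (indC S) := rfl

theorem robinPVM_scalarMeasure (ψ : HalfLineL2 n) : (robinPVM hM hab).scalarMeasure ψ =
    ∑ j, robinMeasure (a j) (b j) (colComp M j ψ) := by
  ext S hS
  have hj : ∀ j, (⟪colComp M j ψ, robinCalc (a j) (b j) (indC S) (colComp M j ψ)⟫_ℂ).re =
      (robinMeasure (a j) (b j) (colComp M j ψ)).real S := by
    intro j
    rw [(inner_robinCalc_self (hab j) (indC_bdd hS) _).2, indC, integral_indicator_const _ hS]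
    simp
  rw [ProjectionValuedMeasure.scalarMeasure_apply _ _ hS,
    ProjectionValuedMeasure.norm_sq_proj _ _ hS, robinPVM_proj, inner_eq_sum_colComp hM,
    Complex.re_sum]
  simp_rw [colComp_colOp hM, hj]
  rw [ENNReal.ofReal_sum_of_nonneg fun j _ => measureReal_nonneg, Measure.finsetSum_apply]
  exact Finset.sum_congr rfl fun j _ => ofReal_measureReal

/-- The quadratic form of the candidate is the integral against the scalar measures, which
characterizes the operator by `ProjectionValuedMeasure.integral_eq`. -/
theorem robinPVM_expI (t : ℝ) : (robinPVM hM hab).expI t =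
    colOp M fun j => robinCalc (a j) (b j) (evol t) := by
  refine ProjectionValuedMeasure.integral_eq _ fun ψ => ?_
  have h := fun j => inner_robinCalc_self (hab j) (evol_bdd t) (colComp M j ψ)
  rw [robinPVM_scalarMeasure, inner_eq_sum_colComp hM]
  simp_rw [colComp_colOp hM]
  exact (Finset.sum_congr rfl fun j _ => (h j).2).trans
    (integral_finsetSum_measure fun j _ => (h j).1).symm

/-- A finite sum of positive measures is absolutely continuous exactly when each summand is. -/
theorem mem_acSubspace_robinPVM {ψ : HalfLineL2 n} : ψ ∈ (robinPVM hM hab).acSubspace ↔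
    ∀ j, robinP (a j) (b j) (colComp M j ψ) = 0 := by
  change (robinPVM hM hab).scalarMeasure ψ ≪ volume ↔ _
  simp_rw [robinPVM_scalarMeasure, ← robinMeasure_absolutelyContinuous_iff]
  constructor
  · intro h j S hS
    have := h hS
    rw [Measure.finsetSum_apply, Finset.sum_eq_zero_iff] at this
    exact this j (Finset.mem_univ j)
  · intro h S hS
    rw [Measure.finsetSum_apply]
    exact Finset.sum_eq_zero fun j _ => h j hS

theorem robinPVM_isSpectralMeasureOf {A B T : Matrix (Fin n) (Fin n) ℂ}
    (hT : IsUnit T) (hA : A = M * Matrix.diagonal (fun j => (a j : ℂ)) * T)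
    (hB : B = M * Matrix.diagonal (fun j => (b j : ℂ)) * T) :
    (robinPVM hM hab).IsSpectralMeasureOf (matrixLaplacian A B) := by
  constructor
  · intro ψ
    rw [LinearPMap.mem_domain_iff, matrixLaplacian_graph, robinPVM_scalarMeasure,
      lintegral_finsetSum_measure, ENNReal.sum_lt_top]
    simp_rw [mem_laplacianGraph_iff hM hT hA hB, Finset.mem_univ, true_imp_iff,
      ← exists_isRobin_iff (hab _)]
    constructor
    · rintro ⟨χ, h⟩ j
      exact ⟨_, h j⟩
    · intro h
      choose χ hχ using h
      exact ⟨∑ j, colEmbed M j (χ j), fun j => by rw [colComp_sum_colEmbed hM]; exact hχ j⟩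
  · intro ψ
    have hg : ((ψ : HalfLineL2 n), matrixLaplacian A B ψ) ∈ laplacianGraph A B := by
      rw [← matrixLaplacian_graph]
      exact LinearPMap.mem_graph _ ψ
    have h := fun j => ((mem_laplacianGraph_iff hM hT hA hB).1 hg j).inner_eq (hab j)
    rw [robinPVM_scalarMeasure, inner_eq_sum_colComp hM,
      integral_finsetSum_measure fun j _ => (h j).1, Complex.ofReal_sum]
    exact Finset.sum_congr rfl fun j _ => (h j).2

end Spectral

/-! ### The generalized Fourier maps -/

theorem isGeneralizedFourierMap_colOp (hM : M.conjTranspose * M = 1)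
    {a b : Fin n → ℝ} (hab : ∀ j, a j ≠ 0 ∨ b j ≠ 0) {A B T : Matrix (Fin n) (Fin n) ℂ}
    (hT : IsUnit T) (hA : A = M * Matrix.diagonal (fun j => (a j : ℂ)) * T)
    (hB : B = M * Matrix.diagonal (fun j => (b j : ℂ)) * T) (d : TimeDirection) :
    IsGeneralizedFourierMap A B d (colOp M fun j => robinF (a j) (b j) d) := by
  intro ψ hψ
  have hint : ∀ j, Integrable (colComp M j ψ) halfLine := fun j =>
    ((innerSL ℂ (matCol M j)).integrable_comp hψ).congr (colComp_ae j ψ).symm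
  filter_upwards [ae_all_iff.2 fun j => robinF_ae (hab j) d (hint j),
    ae_all_iff.2 fun j => colComp_ae (M := M) j (colOp M (fun j => robinF (a j) (b j) d) ψ),
    ae_restrict_mem measurableSet_Ioi] with k h1 h2 hk
  have hκ : ∀ j, (b j - Complex.I * ((-d.sign * k : ℝ) : ℂ) * a j : ℂ) ≠ 0 := by
    intro j
    cases d with
    | plus =>
      convert scalarJost_ne_zero (hab j) .minus hk using 2
      simp [TimeDirection.sign]
    | minus =>
      convert scalarJost_ne_zero (hab j) .plus hk using 2
      simp [TimeDirection.sign]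
  -- Needed to move the inner product with a column inside the vector-valued integral, whose default
  -- value 0 would otherwise apply.
  have hφ : Integrable (fun x =>
      (physicalSolutionPM A B d k x).conjTranspose.toEuclideanLin (ψ x)) halfLine := by
    have hj : ∀ j, Integrable (fun x => (starRingEnd ℂ)
        (scalarPhysical (a j) (b j) (-d.sign * k) x) * colComp M j ψ x) halfLine := by
      intro j
      simp_rw [conj_scalarPhysical (hab j) d hk, mul_assoc]
      refine ((hint j).bdd_mul (c := ‖cosCoef (a j) (b j) k‖ + ‖sinCoef (a j) (b j) k‖)
        (Continuous.aestronglyMeasurable (by fun_prop)) (ae_of_all _ fun x => ?_)).const_mul _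
      refine (norm_add_le _ _).trans (add_le_add ?_ ?_)
      · rw [norm_mul, Complex.norm_real]
        exact mul_le_of_le_one_right (norm_nonneg _) (Real.abs_cos_le_one _)
      · rw [norm_mul, Complex.norm_real]
        exact mul_le_of_le_one_right (norm_nonneg _) (Real.abs_sin_le_one _)
    refine (integrable_finsetSum Finset.univ fun j _ =>
      (hj j).smul_const (matCol M j)).congr ?_
    filter_upwards [ae_all_iff.2 fun j => colComp_ae (M := M) j ψ] with x hx
    simp_rw [hx, physicalSolutionPM]
    conv_rhs => rw [← sum_inner_matCol hM (Matrix.toEuclideanLin _ _)]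
    exact Finset.sum_congr rfl fun j _ => by
      rw [inner_matCol_physicalSolution hM hT hA hB hκ]
  refine ext_inner_matCol hM fun j => ?_
  rw [← h2 j, colComp_colOp hM, h1 j, inner_smul_right_eq_smul, Complex.real_smul]
  congr 1
  have h := (innerSL ℂ (matCol M j)).integral_comp_comm hφ
  rw [innerSL_apply_apply] at h
  rw [← h]
  refine integral_congr_ae ?_
  filter_upwards [colComp_ae (M := M) j ψ] with x hx
  rw [hx, innerSL_apply_apply, physicalSolutionPM,
    inner_matCol_physicalSolution hM hT hA hB hκ]

end Components

/-! ### The matrix theorem from its scalar components -/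

theorem theorem7p1 {n : ℕ} (A B : Matrix (Fin n) (Fin n) ℂ)
    (hAB : -(B.conjTranspose * A) + A.conjTranspose * B = 0)
    (hpos : (A.conjTranspose * A + B.conjTranspose * B).PosDef) :
    ∃ E₀ E : ProjectionValuedMeasure (HalfLineL2 n),
      E₀.IsSpectralMeasureOf (matrixLaplacian (-1) 0) ∧
      E.IsSpectralMeasureOf (matrixLaplacian A B) ∧
      ∃ F₀ : HalfLineL2 n →L[ℂ] HalfLineL2 n,
        (∀ d, IsGeneralizedFourierMap (-1) 0 d F₀) ∧
        ∀ d : TimeDirection, ∃ F W : HalfLineL2 n →L[ℂ] HalfLineL2 n,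
          IsGeneralizedFourierMap A B d F ∧
          IsWaveOperator E E₀ d W ∧
          (∀ ψ, ‖W ψ‖ = ‖ψ‖) ∧
          LinearMap.range (W : HalfLineL2 n →ₗ[ℂ] HalfLineL2 n) = E.acSubspace ∧
          W = ContinuousLinearMap.adjoint F ∘L F₀ := by
  obtain ⟨M, T, a, b, hM, hT, hA, hB, hab⟩ := exists_diagonal_boundary A B hAB hpos
  have hM2 : M * M.conjTranspose = 1 := mul_eq_one_comm.1 hM
  have hab₀ : ∀ _ : Fin n, (-1 : ℝ) ≠ 0 ∨ (0 : ℝ) ≠ 0 := fun _ => Or.inl (by norm_num)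
  -- The Neumann pair is diagonalized with the same M, taking T = M†, so both evolutions act on the
  -- same components.
  have hT₀ : IsUnit M.conjTranspose := ⟨⟨M.conjTranspose, M, hM, hM2⟩, rfl⟩
  have hA₀ : (-1 : Matrix (Fin n) (Fin n) ℂ) =
      M * Matrix.diagonal (fun _ => ((-1 : ℝ) : ℂ)) * M.conjTranspose := by
    have : Matrix.diagonal (fun _ : Fin n => ((-1 : ℝ) : ℂ)) = -1 := by
      rw [← Matrix.diagonal_one, Matrix.diagonal_neg]
      simp
    rw [this, mul_neg, mul_one, neg_mul, hM2]
  have hB₀ : (0 : Matrix (Fin n) (Fin n) ℂ) =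
      M * Matrix.diagonal (fun _ => ((0 : ℝ) : ℂ)) * M.conjTranspose := by
    simp
  -- The Neumann problem has no bound states, so the projector in the wave operator is the identity.
  have htop : ∀ ψ, ψ ∈ (robinPVM hM hab₀).acSubspace := fun ψ =>
    (mem_acSubspace_robinPVM hM hab₀).2 fun j => robinP_neumann _
  refine ⟨robinPVM hM hab₀, robinPVM hM hab, robinPVM_isSpectralMeasureOf hM hab₀ hT₀ hA₀ hB₀,
    robinPVM_isSpectralMeasureOf hM hab hT hA hB, colOp M fun _ => cosT, fun d => ?_, fun d =>
    ⟨colOp M fun j => robinF (a j) (b j) d,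
      colOp M (fun j => robinFAdj (a j) (b j) d) ∘L colOp M fun _ => cosT,
      isGeneralizedFourierMap_colOp hM hab hT hA hB d, fun ψ => ?_, fun ψ => ?_, ?_, ?_⟩⟩
  · have h : robinF (-1) 0 d = cosT := ContinuousLinearMap.ext (robinF_neumann d)
    rw [← h]
    exact isGeneralizedFourierMap_colOp hM hab₀ hT₀ hA₀ hB₀ d
  · rw [Submodule.starProjection_eq_self_iff.2 (htop ψ)]
    refine tendsto_of_colComp hM fun j => ?_
    simp_rw [robinPVM_expI, ContinuousLinearMap.comp_apply, colComp_colOp hM]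
    exact tendsto_robin_wave (hab j) d _
  · refine norm_eq_of_colComp hM fun j => ?_
    rw [ContinuousLinearMap.comp_apply, colComp_colOp hM, colComp_colOp hM, norm_robinFAdj (hab j),
      norm_cosT]
  · ext ψ
    rw [mem_acSubspace_robinPVM]
    constructor
    · rintro ⟨φ, rfl⟩ j
      rw [ContinuousLinearMap.coe_coe, ContinuousLinearMap.comp_apply, colComp_colOp hM]
      exact robinP_robinFAdj (hab j) d _
    · intro h
      -- The preimage is C F ψ in each component: C² = 1, and F*F = 1 − P is the identity on vectors
      -- with Pψ = 0.
      refine ⟨∑ j, colEmbed M j (cosT (robinF (a j) (b j) d (colComp M j ψ))),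
        ext_colComp hM fun j => ?_⟩
      rw [ContinuousLinearMap.coe_coe, ContinuousLinearMap.comp_apply, colComp_colOp hM,
        colComp_colOp hM, colComp_sum_colEmbed hM, cosT_cosT, robinFAdj_robinF (hab j), h j,
        sub_zero]
  · congr 1
    rw [ContinuousLinearMap.eq_adjoint_iff]
    exact colOp_inner hM fun j f g => robinFAdj_inner _ _ _ _ _
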